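/- \textbf{Theorem.} Let $\mathcal H$ be the Hilbert space of one harmonic oscillator, with Fock basis $\{|n\rangle\}_{n\ge0}$, ladder operator $\hat a|n\rangle=\sqrt n\,|n-1\rangle$, number operator $\hat N=\hat a^\dagger\hat a$ and quadratures $\hat{\mathbf R}=(\hat Q,\hat P)$, where $\hat a=(\hat Q+i\hat P)/\sqrt2$. Let $\Phi$ be a one-mode Gaussian quantum channel, i.e. a continuous linear, Hermiticity-preserving, completely positive, trace-preserving map on the trace-class operators on $\mathcal H$ for which there are a real $2\times2$ matrix $M$, a real symmetric $2\times2$ matrix $\alpha$ and $\mathbf y\in\mathbb R^2$ with $$\chi_{\Phi(\hat X)}(\mathbf k)=e^{-\frac14\mathbf k\alpha\mathbf k^T+i\mathbf k\mathbf y}\,\chi_{\hat X}(\mathbf kM)\qquad\text{for all trace-class }\hat X\text{ and all row vectors }\mathbf k\in\mathbb R^2,$$ where $\chi_{\hat X}(\mathbf k)=\operatorname{Tr}\bigl[\hat X e^{i\mathbf k\hat{\mathbf R}}\bigr]$. Suppose that $\Phi$ is gauge-covariant: $\Phi(e^{-i\hat Nt}\hat Xe^{i\hat Nt})=e^{-i\hat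 Nt}\Phi(\hat X)e^{i\hat Nt}$ for all $t\in\mathbb R$ and all trace-class $\hat X$. For a positive trace-class operator $\hat X$ with eigenvalues $x_0\ge x_1\ge\dots\ge0$ (with multiplicity), let $\hat X^\downarrow=\sum_{n\ge0}x_n|n\rangle\langle n|$ be its Fock rearrangement, and call $\hat X$ passive if $\hat X=\hat X^\downarrow$. For positive trace-class $\hat X,\hat Y$ with decreasing eigenvalues $(x_n)$, $(y_n)$ write $\hat X\prec_w\hat Y$ if $\sum_{i=0}^nx_i\le\sum_{i=0}^ny_i$ for every $n\ge 0$, and $\hat X\prec\hat Y$ if moreover $\operatorname{Tr}\hat X=\operatorname{Tr}\hat Y$. Then: (i) $\Phi$ is passive-preserving: $\Phi(\hat X)$ is passive for every passive positive trace-class operator $\hat X$; (ii) $\Phi$ is Fock-optimal: $\Phi(\hat X)\prec_w\Phi(\hat X^\downarrow)$ for every positive trace-class operator $\hat X$; and, $\Phi$ being trace-preserving, in fact $\Phi(\hat X)\prec\Phi(\hat X^\downarrow)$. -/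

import Mathlib

namespace GaussianChannel

section

variable {H : Type*} [NormedAddCommGroup H] [InnerProductSpace ℂ H]

/-! ### One bosonic mode

`H` is the Hilbert space of one harmonic oscillator and the Hilbert basis `b` is the Fock basis,
`b n = |n⟩`; all operators of the mode are built from it. -/

/-- Finite linear combinations of Fock states: a common invariant domain of the (unbounded)
ladder operators. -/
abbrev FiniteStates : Type := ℕ →₀ ℂ

/-- The inclusion of the finite combinations of Fock states into the Hilbert space. -/
noncomputable def finiteStatesToHilbert (b : HilbertBasis ℕ ℂ H) : FiniteStates →ₗ[ℂ] H :=
  Finsupp.linearCombination ℂ b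

/-- The ladder operator `a`, with `a |n⟩ = √n |n-1⟩` (in particular `a |0⟩ = 0`). -/
noncomputable def annihilation : FiniteStates →ₗ[ℂ] FiniteStates :=
  Finsupp.linearCombination ℂ fun n : ℕ => Finsupp.single (n - 1) ((Real.sqrt n : ℝ) : ℂ)

/-- The ladder operator `a†`, with `a† |n⟩ = √(n+1) |n+1⟩`. -/
noncomputable def creation : FiniteStates →ₗ[ℂ] FiniteStates :=
  Finsupp.linearCombination ℂ fun n : ℕ =>
    Finsupp.single (n + 1) ((Real.sqrt ((n : ℝ) + 1) : ℝ) : ℂ)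

/-- The quadrature `Q = (a + a†) / √2`. -/
noncomputable def quadratureQ : FiniteStates →ₗ[ℂ] FiniteStates :=
  ((Real.sqrt 2 : ℝ) : ℂ)⁻¹ • (annihilation + creation)

/-- The quadrature `P = (a - a†) / (i √2)`, so that `a = (Q + i P) / √2`. -/
noncomputable def quadratureP : FiniteStates →ₗ[ℂ] FiniteStates :=
  (Complex.I * ((Real.sqrt 2 : ℝ) : ℂ))⁻¹ • (annihilation - creation)

/-- The operator `k · R = k₁ Q + k₂ P`. -/
noncomputable def quadratureCombination (k : Fin 2 → ℝ) : FiniteStates →ₗ[ℂ] FiniteStates :=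
  ((k 0 : ℝ) : ℂ) • quadratureQ + ((k 1 : ℝ) : ℂ) • quadratureP

/-- The vector `exp(i k · R) |n⟩`. Fock states are analytic vectors of the essentially
self-adjoint operator `k · R`, so the unitary `exp(i k · R)` acts on them by the
(norm convergent) exponential series. -/
noncomputable def weylFock (b : HilbertBasis ℕ ℂ H) (k : Fin 2 → ℝ) (n : ℕ) : H :=
  ∑' j : ℕ, (Complex.I ^ j / (j.factorial : ℂ)) •
    finiteStatesToHilbert b ((quadratureCombination k ^ j) (Finsupp.single n 1))

/-- The rotated Fock vectors `e^{-i t n} |n⟩` form an orthonormal family. -/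
theorem orthonormal_rotated (b : HilbertBasis ℕ ℂ H) (t : ℝ) :
    Orthonormal ℂ fun n : ℕ => Complex.exp (((-(t * n) : ℝ) : ℂ) * Complex.I) • b n := by
  refine ⟨fun n => ?_, fun m n h => ?_⟩
  · rw [norm_smul, Complex.norm_exp_ofReal_mul_I, one_mul, b.orthonormal.1]
  · show inner ℂ (_ • b m) (_ • b n) = 0
    rw [inner_smul_left, inner_smul_right, b.orthonormal.2 h, mul_zero, mul_zero]

/-- The rotated Fock vectors span a dense subspace. -/
theorem span_rotated (b : HilbertBasis ℕ ℂ H) (t : ℝ) :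
    ⊤ ≤ (Submodule.span ℂ (Set.range fun n : ℕ =>
      Complex.exp (((-(t * n) : ℝ) : ℂ) * Complex.I) • b n)).topologicalClosure := by
  rw [← b.dense_span]
  refine Submodule.topologicalClosure_mono (Submodule.span_le.2 ?_)
  rintro _ ⟨n, rfl⟩
  have h : Complex.exp (((-(t * n) : ℝ) : ℂ) * Complex.I) • b n ∈ Submodule.span ℂ
      (Set.range fun n : ℕ => Complex.exp (((-(t * n) : ℝ) : ℂ) * Complex.I) • b n) :=
    Submodule.subset_span ⟨n, rfl⟩
  exact (Submodule.smul_mem_iff _ (Complex.exp_ne_zero _)).1 h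

variable [CompleteSpace H]

/-- The unitary `e^{-i t N}`, where `N |n⟩ = n |n⟩` is the photon-number Hamiltonian: the unitary
that maps the basis vector `|n⟩` to `e^{-i t n} |n⟩`. -/
noncomputable def timeEvolution (b : HilbertBasis ℕ ℂ H) (t : ℝ) : H →L[ℂ] H :=
  (b.repr.trans
    (HilbertBasis.mk (orthonormal_rotated b t) (span_rotated b t)).repr.symm).toContinuousLinearEquiv

/-- The action of the time evolution on Fock states. -/
theorem timeEvolution_apply (b : HilbertBasis ℕ ℂ H) (t : ℝ) (n : ℕ) :
    timeEvolution b t (b n) = Complex.exp (((-(t * n) : ℝ) : ℂ) * Complex.I) • b n := by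
  change (HilbertBasis.mk (orthonormal_rotated b t) (span_rotated b t)).repr.symm
    (b.repr (b n)) = _
  rw [HilbertBasis.repr_self, HilbertBasis.repr_symm_single, HilbertBasis.coe_mk]

/-! ### Trace-class operators, eigenvalues and majorization -/

/-- `X` is trace class: `Tr √(X† X) < ∞`. -/
def IsTraceClass (b : HilbertBasis ℕ ℂ H) (X : H →L[ℂ] H) : Prop :=
  Summable fun n : ℕ => (inner ℂ (b n) (CFC.abs X (b n))).re

/-- The trace norm `‖X‖₁ = Tr √(X† X)` of a trace-class operator. -/
noncomputable def traceNorm (b : HilbertBasis ℕ ℂ H) (X : H →L[ℂ] H) : ℝ :=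
  ∑' n : ℕ, (inner ℂ (b n) (CFC.abs X (b n))).re

/-- The trace of a trace-class operator. -/
noncomputable def trace (b : HilbertBasis ℕ ℂ H) (X : H →L[ℂ] H) : ℂ :=
  ∑' n : ℕ, inner ℂ (b n) (X (b n))

/-- `x₀ ≥ x₁ ≥ … ≥ 0` are the eigenvalues of `X` in decreasing order, counted with multiplicity:
`X = ∑ₙ xₙ |ψₙ⟩⟨ψₙ|` for some orthonormal sequence `ψ`. (For a finite-rank operator the sequence
ends with zeros; an infinite-rank operator may vanish on the orthogonal complement of `ψ`.) -/
def IsDecreasingEigenvalues (X : H →L[ℂ] H) (x : ℕ → ℝ) : Prop :=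
  Antitone x ∧ (∀ n, 0 ≤ x n) ∧ ∃ ψ : ℕ → H, Orthonormal ℂ ψ ∧
    ∀ v : H, HasSum (fun n => (x n : ℂ) • InnerProductSpace.rankOne ℂ (ψ n) (ψ n) v) (X v)

open Classical in
/-- The eigenvalues in decreasing order of a positive trace-class operator (they exist, by the
spectral theorem, and are unique). -/
noncomputable def eigenvalues (X : H →L[ℂ] H) : ℕ → ℝ :=
  if h : ∃ x, IsDecreasingEigenvalues X x then h.choose else 0

/-- The Fock rearrangement `X↓ = ∑ₙ xₙ |n⟩⟨n|` of a positive trace-class operator `X` with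
eigenvalues `x₀ ≥ x₁ ≥ …`. -/
noncomputable def fockRearrangement (b : HilbertBasis ℕ ℂ H) (X : H →L[ℂ] H) : H →L[ℂ] H :=
  ∑' n : ℕ, (eigenvalues X n : ℂ) • InnerProductSpace.rankOne ℂ (b n) (b n)

/-- A positive trace-class operator is passive if it is its own Fock rearrangement. -/
def IsPassive (b : HilbertBasis ℕ ℂ H) (X : H →L[ℂ] H) : Prop :=
  X.IsPositive ∧ IsTraceClass b X ∧ X = fockRearrangement b X

/-- `X` is weakly sub-majorized by `Y` (for positive trace-class operators). -/
def WeaklySubmajorizedBy (X Y : H →L[ℂ] H) : Prop :=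
  ∀ n : ℕ, ∑ i ∈ Finset.range (n + 1), eigenvalues X i ≤
    ∑ i ∈ Finset.range (n + 1), eigenvalues Y i

/-- `X` is majorized by `Y` (for positive trace-class operators). -/
def MajorizedBy (b : HilbertBasis ℕ ℂ H) (X Y : H →L[ℂ] H) : Prop :=
  WeaklySubmajorizedBy X Y ∧ trace b X = trace b Y

/-! ### Quantum channels -/

open scoped ComplexOrder in
/-- The block operator `(X i j)` on `ℂⁿ ⊗ H` is positive. -/
def IsPositiveBlock {n : ℕ} (X : Fin n → Fin n → (H →L[ℂ] H)) : Prop :=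
  ∀ v : Fin n → H, 0 ≤ ∑ i, ∑ j, inner ℂ (v i) (X i j (v j))

/-- A quantum channel: a continuous linear map from trace-class operators to trace-class
operators that commutes with Hermitian conjugation, is completely positive (`id ⊗ Φ` is positive
for every finite-dimensional ancilla `ℂⁿ`) and preserves the trace. Only the values of `Φ` on
trace-class operators matter. -/
structure IsQuantumChannel (b : HilbertBasis ℕ ℂ H) (Φ : (H →L[ℂ] H) → (H →L[ℂ] H)) : Prop where
  mapsTo : ∀ X, IsTraceClass b X → IsTraceClass b (Φ X)
  map_add : ∀ X Y, IsTraceClass b X → IsTraceClass b Y → Φ (X + Y) = Φ X + Φ Y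
  map_smul : ∀ (c : ℂ) (X), IsTraceClass b X → Φ (c • X) = c • Φ X
  continuous : ∃ C : ℝ, ∀ X, IsTraceClass b X → traceNorm b (Φ X) ≤ C * traceNorm b X
  map_adjoint : ∀ X, IsTraceClass b X →
    Φ (ContinuousLinearMap.adjoint X) = ContinuousLinearMap.adjoint (Φ X)
  completelyPositive : ∀ (n : ℕ) (X : Fin n → Fin n → (H →L[ℂ] H)),
    (∀ i j, IsTraceClass b (X i j)) → IsPositiveBlock X → IsPositiveBlock fun i j => Φ (X i j)
  map_trace : ∀ X, IsTraceClass b X → trace b (Φ X) = trace b X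

/-- The characteristic function `χ_X(k) = Tr (X exp(i k · R))` of a trace-class operator. -/
noncomputable def characteristicFunction (b : HilbertBasis ℕ ℂ H) (X : H →L[ℂ] H)
    (k : Fin 2 → ℝ) : ℂ :=
  ∑' n : ℕ, inner ℂ (b n) (X (weylFock b k n))

open Matrix in
/-- A one-mode Gaussian quantum channel: a quantum channel that acts on characteristic functions
by `χ_{Φ(X)}(k) = exp(-k α kᵀ / 4 + i k y) χ_X(k M)` for some real `2 × 2` matrix `M`, some real
symmetric `2 × 2` matrix `α` and some `y ∈ ℝ²`. -/
structure IsGaussianChannel (b : HilbertBasis ℕ ℂ H) (Φ : (H →L[ℂ] H) → (H →L[ℂ] H)) : Prop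
    extends IsQuantumChannel b Φ where
  gaussian : ∃ (M α : Matrix (Fin 2) (Fin 2) ℝ) (y : Fin 2 → ℝ), α.IsSymm ∧
    ∀ X, IsTraceClass b X → ∀ k : Fin 2 → ℝ,
      characteristicFunction b (Φ X) k =
        Complex.exp (-(1 / 4) * ((k ⬝ᵥ (α *ᵥ k) : ℝ) : ℂ) + Complex.I * ((k ⬝ᵥ y : ℝ) : ℂ)) *
          characteristicFunction b X (k ᵥ* M)

/-- Gauge covariance: `Φ` commutes with the time evolution generated by the photon number. -/
def IsGaugeCovariant (b : HilbertBasis ℕ ℂ H) (Φ : (H →L[ℂ] H) → (H →L[ℂ] H)) : Prop :=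
  ∀ (t : ℝ) (X : H →L[ℂ] H), IsTraceClass b X →
    Φ (timeEvolution b t * X * timeEvolution b (-t)) =
      timeEvolution b t * Φ X * timeEvolution b (-t)

/-- `Φ` sends passive operators to passive operators. -/
def IsPassivePreserving (b : HilbertBasis ℕ ℂ H) (Φ : (H →L[ℂ] H) → (H →L[ℂ] H)) : Prop :=
  ∀ X : H →L[ℂ] H, IsPassive b X → IsPassive b (Φ X)

/-- `Φ` is Fock-optimal: Fock-rearranging the input makes the output less noisy. -/
def IsFockOptimal (b : HilbertBasis ℕ ℂ H) (Φ : (H →L[ℂ] H) → (H →L[ℂ] H)) : Prop :=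
  ∀ X : H →L[ℂ] H, X.IsPositive → IsTraceClass b X →
    WeaklySubmajorizedBy (Φ X) (Φ (fockRearrangement b X))

end

end GaussianChannel

/-!
The theorem is true because every gauge-covariant one-mode Gaussian channel is, up to a scalar
factor and a phase rotation, a quantum-limited attenuator followed by the adjoint of a
quantum-limited attenuator, and because attenuators are built from infinitesimal steps of photon
loss for which Fock optimality is elementary.

*Identification of the channel.* Gauge covariance makes `Φ` map each diagonal of the Fock matrix to
itself (`IsGaugeCovariant.inner_eq_zero`). The Fock matrix elements of the Weyl operators are
Laguerre functions (`inner_weylFock`): pairing with coherent vectors turns the exponential series of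
`ξ a† - ξ̄ a` into a Taylor series of an explicit Bargmann function. The Gaussian relation along one
ray of phase space therefore expresses a rescaled and damped Laguerre function as a series of
Laguerre functions, whose coefficients are the matrix elements of `Φ(|n+d⟩⟨n|)`. The Laplace
transform turns both sides into power series, and the coefficients can be read off
(`coeff_eq_of_laguerre`). The displacement vanishes because the output for the vacuum is even along
the ray, and positivity of `Φ` confines the two transmissivities to `[0, 1]`
(`IsGaussianChannel.exists_gaussianKernel`). No separate treatment of amplifiers is needed: up to
the factor, an amplifier is the adjoint of an attenuator.

*Attenuators.* An attenuator is the limit of `k` loss steps `X ↦ D X D + η a X a†`,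
`D = √(1 - η N)`, with `η` of order `1 / k` (`tendsto_lossMatrix_pow`), since attenuators form a semigroup with
the same generator. If the eigenvalues of `X` are weakly majorized by a decreasing sequence `d`,
then those of the loss step of `X` are weakly majorized by the loss step of the diagonal operator
`d` (`IsSubmajorized.lossStep`). Indeed, the sum of the `q` largest eigenvalues of the loss step of
`X` is a sum of the eigenvalues of `X` with weights that are at most `1`, because the step does not
increase the trace, and that add up to at most `(1 + η) q`, because `[a, a†] = 1`. Such a sum is at
most `x₀ + ⋯ + x_{q-1} + η q x_q`, and for diagonal operators this bound is attained. Together with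
von Neumann's trace inequality, applied to the images of `X` and `Y` under two attenuators, this
gives `IsSubmajorized.hsPairing_attenuator_le`.

*Conclusion.* The sum of `⟨φ_a| Φ(|ψ_n⟩⟨ψ_n|) |φ_a⟩` over `a < q` and `n < p`, for orthonormal `φ`
and `ψ`, is a pairing of two attenuated projections, hence largest when both families consist of the
first Fock states (`IsGaussianChannel.sum_inner_le`; the vectors are truncated to finitely many
photons, and the truncation is removed in the limit). Summation by parts over the eigenvalues of `X`
and Ky Fan's principle then bound the partial sums of eigenvalues of `Φ(X)` by those of the diagonal
entries of `Φ(X↓)` (`IsGaussianChannel.sum_inner_le_of_isDiagonalizedBy`). Applied to a passive `X`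
and the test vectors `|0⟩, …, |m-1⟩, |m+1⟩`, the same bound shows that the diagonal of `Φ(X)` is
decreasing, which is passivity.
-/

open Filter Topology
open InnerProductSpace (rankOne)

namespace GaussianChannel

/-! ### Positive trace-class operators and their eigenvalues -/

section Spectral

variable {H : Type*} [NormedAddCommGroup H] [InnerProductSpace ℂ H]

theorem hasSum_norm_inner_sq (b : HilbertBasis ℕ ℂ H) (v : H) :
    HasSum (fun n => ‖inner ℂ (b n) v‖ ^ 2) (‖v‖ ^ 2) := by
  have h := (Complex.hasSum_re (b.hasSum_inner_mul_inner v v))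
  have h2 : (inner ℂ v v).re = ‖v‖ ^ 2 := by
    rw [inner_self_eq_norm_sq_to_K]; norm_cast
  rw [h2] at h
  convert h using 2 with n
  rw [← inner_conj_symm v, ← Complex.normSq_eq_conj_mul_self, Complex.ofReal_re,
    Complex.normSq_eq_norm_sq]

/-- The sequence `x` and the orthonormal sequence `ψ` diagonalize `X`, with `x` decreasing. -/
structure IsDiagonalizedBy (X : H →L[ℂ] H) (x : ℕ → ℝ) (ψ : ℕ → H) : Prop where
  antitone : Antitone x
  nonneg : ∀ n, 0 ≤ x n
  orthonormal : Orthonormal ℂ ψ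
  hasSum : ∀ v : H, HasSum (fun n => (x n : ℂ) • rankOne ℂ (ψ n) (ψ n) v) (X v)

theorem isDecreasingEigenvalues_iff {X : H →L[ℂ] H} {x : ℕ → ℝ} :
    IsDecreasingEigenvalues X x ↔ ∃ ψ, IsDiagonalizedBy X x ψ :=
  ⟨fun ⟨h1, h2, ψ, h3, h4⟩ => ⟨ψ, h1, h2, h3, h4⟩,
    fun ⟨ψ, h1, h2, h3, h4⟩ => ⟨h1, h2, ψ, h3, h4⟩⟩

namespace IsDiagonalizedBy

variable {X : H →L[ℂ] H} {x : ℕ → ℝ} {ψ : ℕ → H}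

theorem hasSum_inner (h : IsDiagonalizedBy X x ψ) (u v : H) :
    HasSum (fun n => (x n : ℂ) * (inner ℂ u (ψ n) * inner ℂ (ψ n) v)) (inner ℂ u (X v)) := by
  have h1 := (innerSL ℂ u).hasSum (h.hasSum v)
  refine h1.congr_fun fun n => ?_
  simp only [innerSL_apply_apply, InnerProductSpace.rankOne_apply, inner_smul_right]
  ring

theorem hasSum_re_inner_self (h : IsDiagonalizedBy X x ψ) (v : H) :
    HasSum (fun n => x n * ‖inner ℂ (ψ n) v‖ ^ 2) (inner ℂ v (X v)).re := by
  convert Complex.hasSum_re (h.hasSum_inner v v) using 2 with n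
  rw [← inner_conj_symm v, ← Complex.normSq_eq_conj_mul_self, ← Complex.ofReal_mul,
    Complex.ofReal_re, Complex.normSq_eq_norm_sq]

theorem apply_eigenvector (h : IsDiagonalizedBy X x ψ) (n : ℕ) : X (ψ n) = (x n : ℂ) • ψ n := by
  refine (h.hasSum (ψ n)).unique ?_
  convert hasSum_single n ?_ using 1
  · simp [inner_self_eq_norm_sq_to_K, h.orthonormal.1 n]
  · intro m hm
    simp [h.orthonormal.2 hm]

theorem inner_eigenvector (h : IsDiagonalizedBy X x ψ) (n : ℕ) :
    (inner ℂ (ψ n) (X (ψ n))).re = x n := by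
  rw [h.apply_eigenvector, inner_smul_right, inner_self_eq_norm_sq_to_K, h.orthonormal.1 n]
  simp

theorem isPositive (h : IsDiagonalizedBy X x ψ) [CompleteSpace H] : X.IsPositive := by
  rw [ContinuousLinearMap.isPositive_def]
  refine ⟨fun u v => ?_, fun v => ?_⟩
  · have h1 := h.hasSum_inner u v
    have h2 := h.hasSum_inner v u
    have h3 := Complex.hasSum_conj'.2 h2
    rw [ContinuousLinearMap.coe_coe, ← inner_conj_symm]
    refine (h3.unique ?_)
    convert h1 using 2 with n
    simp only [map_mul, Complex.conj_ofReal, inner_conj_symm]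
    ring
  · rw [ContinuousLinearMap.reApplyInnerSelf_apply, ← inner_conj_symm]
    simp only [RCLike.conj_re]
    exact (h.hasSum_re_inner_self v).nonneg fun n => mul_nonneg (h.nonneg n) (by positivity)

theorem hasSum_norm_inner_basis_sq (h : IsDiagonalizedBy X x ψ) (b : HilbertBasis ℕ ℂ H) (n : ℕ) :
    HasSum (fun k => ‖inner ℂ (ψ n) (b k)‖ ^ 2) 1 := by
  have := hasSum_norm_inner_sq b (ψ n)
  rw [h.orthonormal.1 n, one_pow] at this
  convert this using 3 with k
  exact norm_inner_symm _ _

theorem sum_le_of_hasSum (h : IsDiagonalizedBy X x ψ) (b : HilbertBasis ℕ ℂ H) {t : ℝ}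
    (ht : HasSum (fun k => (inner ℂ (b k) (X (b k))).re) t) (n : ℕ) :
    ∑ i ∈ Finset.range n, x i ≤ t := by
  have h1 : HasSum (fun k => ∑ i ∈ Finset.range n, x i * ‖inner ℂ (ψ i) (b k)‖ ^ 2)
      (∑ i ∈ Finset.range n, x i * 1) :=
    hasSum_sum fun i _ => (h.hasSum_norm_inner_basis_sq b i).mul_left (x i)
  simp only [mul_one] at h1
  exact hasSum_le (fun k => sum_le_hasSum _ (fun i _ => mul_nonneg (h.nonneg i) (by positivity))
    (h.hasSum_re_inner_self (b k))) h1 ht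

theorem summable_of_summable (h : IsDiagonalizedBy X x ψ) (b : HilbertBasis ℕ ℂ H)
    (ht : Summable (fun k => (inner ℂ (b k) (X (b k))).re)) : Summable x :=
  summable_of_sum_range_le h.nonneg (h.sum_le_of_hasSum b ht.hasSum)

/-- The trace of a positive operator is the sum of its eigenvalues (Tonelli). -/
theorem hasSum_diagonal (h : IsDiagonalizedBy X x ψ) (b : HilbertBasis ℕ ℂ H) (hx : Summable x) :
    HasSum (fun k => (inner ℂ (b k) (X (b k))).re) (∑' n, x n) := by
  let f : ℕ × ℕ → ℝ := fun p => x p.1 * ‖inner ℂ (ψ p.1) (b p.2)‖ ^ 2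
  have hf0 : 0 ≤ f := fun p => mul_nonneg (h.nonneg _) (by positivity)
  have hrow : ∀ n, HasSum (fun k => f (n, k)) (x n) := fun n => by
    simpa using (h.hasSum_norm_inner_basis_sq b n).mul_left (x n)
  have hs : Summable f := by
    rw [summable_prod_of_nonneg hf0]
    refine ⟨fun n => (hrow n).summable, ?_⟩
    simpa only [(hrow _).tsum_eq] using hx
  have h1 : HasSum f (∑' n, x n) := by
    have := hs.hasSum.prod_fiberwise hrow
    rw [this.tsum_eq]; exact hs.hasSum
  have h2 : HasSum (f ∘ Prod.swap) (∑' n, x n) := (Equiv.prodComm ℕ ℕ).hasSum_iff.2 h1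
  exact h2.prod_fiberwise fun k => h.hasSum_re_inner_self (b k)

/-- Dropping the first `p` eigenvectors leaves a diagonalized operator. -/
theorem tail (h : IsDiagonalizedBy X x ψ) (p : ℕ) :
    IsDiagonalizedBy (X - ∑ n ∈ Finset.range p, (x n : ℂ) • rankOne ℂ (ψ n) (ψ n))
      (fun n => x (n + p)) (fun n => ψ (n + p)) where
  antitone := fun i j hij => h.antitone (by lia)
  nonneg := fun n => h.nonneg _
  orthonormal := h.orthonormal.comp _ (add_left_injective p)
  hasSum := fun v => by
    have := (hasSum_nat_add_iff' p).2 (h.hasSum v)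
    simpa [sum_apply] using this

end IsDiagonalizedBy

theorem exists_norm_apply_sq_le [CompleteSpace H] {X : H →L[ℂ] H} (hX : X.IsPositive) :
    ∃ C : ℝ, 0 ≤ C ∧ ∀ v, ‖X v‖ ^ 2 ≤ C * (inner ℂ v (X v)).re := by
  have hX0 : 0 ≤ X := (ContinuousLinearMap.nonneg_iff_isPositive X).2 hX
  set S := CFC.sqrt X with hS
  have hSS : S * S = X := CFC.sqrt_mul_sqrt_self X hX0
  have hSpos : S.IsPositive := (ContinuousLinearMap.nonneg_iff_isPositive S).1 (CFC.sqrt_nonneg X)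
  refine ⟨‖S‖ ^ 2, by positivity, fun v => ?_⟩
  have h1 : (inner ℂ v (X v)).re = ‖S v‖ ^ 2 := by
    rw [← hSS, mul_apply_eq_comp, ← hSpos.inner_left_eq_inner_right,
      inner_self_eq_norm_sq_to_K]
    norm_cast
  rw [h1, ← hSS, mul_apply_eq_comp, ← mul_pow]
  exact pow_le_pow_left₀ (norm_nonneg _) (S.le_opNorm _) 2

theorem isCompactOperator_rankOne (u v : H) : IsCompactOperator (rankOne ℂ u v) := by
  rw [InnerProductSpace.rankOne_def']
  exact (isCompactOperator_of_locallyCompactSpace_dom (innerSL ℂ v)).clm_comp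
    (ContinuousLinearMap.toSpanSingleton ℂ u)

theorem isCompactOperator_of_summable [CompleteSpace H] (b : HilbertBasis ℕ ℂ H)
    {X : H →L[ℂ] H} (hX : X.IsPositive)
    (hs : Summable fun n => (inner ℂ (b n) (X (b n))).re) : IsCompactOperator X := by
  obtain ⟨C, hC0, hC⟩ := exists_norm_apply_sq_le hX
  have hsq : Summable fun n => ‖X (b n)‖ ^ 2 :=
    Summable.of_nonneg_of_le (fun n => by positivity) (fun n => hC (b n)) (hs.mul_left C)
  let F : ℕ → H →L[ℂ] H := fun N => ∑ n ∈ Finset.range N, rankOne ℂ (X (b n)) (b n)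
  have hFb : ∀ N n, (X - F N) (b n) = if n < N then 0 else X (b n) := by
    intro N n
    simp only [F, sub_apply, sum_apply,
      InnerProductSpace.rankOne_apply, orthonormal_iff_ite.1 b.orthonormal, ite_smul, one_smul,
      zero_smul, Finset.sum_ite_eq', Finset.mem_range]
    split_ifs <;> simp
  have hF : ∀ N, IsCompactOperator (F N) := by
    intro N
    induction N with
    | zero => simpa [F] using isCompactOperator_zero
    | succ N ih =>
      simp only [F, Finset.sum_range_succ] at ih ⊢
      exact ih.add (isCompactOperator_rankOne _ _)
  -- The adjoint of `X - F N` has the coordinates `⟨X bₙ, u⟩`, `n ≥ N`: a Hilbert-Schmidt tail.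
  have hbound : ∀ N, ‖X - F N‖ ≤ √(∑' n, ‖X (b (n + N))‖ ^ 2) := by
    intro N
    rw [← LinearIsometryEquiv.norm_map ContinuousLinearMap.adjoint (X - F N)]
    refine ContinuousLinearMap.opNorm_le_bound _ (Real.sqrt_nonneg _) fun u => ?_
    have htail := (summable_nat_add_iff N).2 hsq
    rw [← Real.sqrt_sq (norm_nonneg u), ← Real.sqrt_mul (tsum_nonneg fun n => by positivity)]
    refine Real.le_sqrt_of_sq_le ?_
    have h1 := hasSum_norm_inner_sq b (ContinuousLinearMap.adjoint (X - F N) u)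
    simp only [ContinuousLinearMap.adjoint_inner_right, hFb] at h1
    rw [← hasSum_nat_add_iff' N] at h1
    have h0 : ∑ i ∈ Finset.range N,
        ‖inner ℂ (if i < N then (0 : H) else X (b i)) u‖ ^ 2 = 0 :=
      Finset.sum_eq_zero fun i hi => by simp [Finset.mem_range.1 hi]
    rw [h0, sub_zero] at h1
    refine hasSum_le (fun n => ?_) h1 (htail.hasSum.mul_right (‖u‖ ^ 2))
    simp only [Nat.not_lt.2 (Nat.le_add_left N n), if_false, ← mul_pow]
    exact pow_le_pow_left₀ (norm_nonneg _) (norm_inner_le_norm _ _) 2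
  refine isCompactOperator_of_tendsto (F := F) (l := atTop) ?_ (Eventually.of_forall hF)
  rw [tendsto_iff_norm_sub_tendsto_zero]
  refine squeeze_zero (fun N => norm_nonneg _) (fun N => (norm_sub_rev _ _).trans_le (hbound N)) ?_
  simpa using (tendsto_sum_nat_add fun n => ‖X (b n)‖ ^ 2).sqrt

theorem exists_eigenvector_norm [CompleteSpace H] {T : H →L[ℂ] H} (hT : T.IsPositive)
    (hc : IsCompactOperator T)
    (h0 : T ≠ 0) : ∃ ψ : H, ‖ψ‖ = 1 ∧ T ψ = ((‖T‖ : ℝ) : ℂ) • ψ := by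
  have hn : 0 < ‖T‖ := norm_pos_iff.2 h0
  have : Nontrivial H := by
    by_contra hH
    rw [not_nontrivial_iff_subsingleton] at hH
    exact h0 (Subsingleton.elim _ _)
  have hμ : ((‖T‖ : ℝ) : ℂ) ≠ 0 := by exact_mod_cast hn.ne'
  rcases hc.hasEigenvalue_or_mem_resolventSet hμ with h | h
  · obtain ⟨v, hv⟩ := h.exists_hasEigenvector
    have hv0 : ‖v‖ ≠ 0 := norm_ne_zero_iff.2 hv.2
    refine ⟨((‖v‖⁻¹ : ℝ) : ℂ) • v, ?_, ?_⟩
    · rw [norm_smul, Complex.norm_real, Real.norm_of_nonneg (by positivity), inv_mul_cancel₀ hv0]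
    · have := hv.apply_eq_smul
      rw [ContinuousLinearMap.coe_coe] at this
      rw [map_smul, this, smul_comm]
  · obtain ⟨ε, hε, hle⟩ := T.rayleighQuotient_le_of_norm_mem_resolventSet h
    exfalso
    have h1 := T.norm_eq_iSup_rayleighQuotient hT.isSymmetric
    have h2 : ⨆ v, |T.rayleighQuotient v| ≤ ‖T‖ - ε := by
      refine ciSup_le fun v => ?_
      rw [abs_of_nonneg]
      · exact hle v
      · rw [ContinuousLinearMap.rayleighQuotient]
        exact div_nonneg (hT.2 v) (by positivity)
    linarith

/-- Removing the component along a unit eigenvector leaves a positive operator. -/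
theorem isPositive_deflate {T : H →L[ℂ] H} (hT : T.IsPositive) {ψ : H} (hψ : ‖ψ‖ = 1) {c : ℝ}
    (he : T ψ = (c : ℂ) • ψ) : (T - (c : ℂ) • rankOne ℂ ψ ψ).IsPositive := by
  have hT' := hT
  rw [ContinuousLinearMap.isPositive_iff_complex]
  have key : ∀ v, inner ℂ ((T - (c : ℂ) • rankOne ℂ ψ ψ) v) v
      = inner ℂ (T (v - inner ℂ ψ v • ψ)) (v - inner ℂ ψ v • ψ) := by
    intro v
    have h1 : inner ℂ (T v) ψ = (c : ℂ) * inner ℂ v ψ := by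
      rw [hT.inner_left_eq_inner_right, he, inner_smul_right]
    have h2 : inner ℂ ψ ψ = (1 : ℂ) := by simp [inner_self_eq_norm_sq_to_K, hψ]
    simp only [map_sub, map_smul, he, sub_apply, smul_apply,
      InnerProductSpace.rankOne_apply, inner_sub_left, inner_sub_right, inner_smul_left,
      inner_smul_right, h1, h2, Complex.conj_ofReal, inner_conj_symm]
    ring
  intro v
  rw [key]
  exact (ContinuousLinearMap.isPositive_iff_complex T).1 hT' _

theorem exists_unit_mem_orthogonal (b : HilbertBasis ℕ ℂ H) (V : Submodule ℂ H)
    [FiniteDimensional ℂ V] : ∃ ψ ∈ Vᗮ, ‖ψ‖ = 1 := by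
  have hV : Vᗮ ≠ ⊥ := by
    intro h
    rw [Submodule.orthogonal_eq_bot_iff] at h
    have : FiniteDimensional ℂ H := by
      have : FiniteDimensional ℂ (⊤ : Submodule ℂ H) := h ▸ inferInstance
      exact Module.finite_def.2 ((Submodule.fg_top _).1 (Module.finite_def.1 this) |> fun h => by
        simpa using h)
    have hli := b.orthonormal.linearIndependent
    exact not_finite_iff_infinite.2 (inferInstance : Infinite ℕ) hli.finite
  obtain ⟨v, hv, hv0⟩ := Submodule.exists_mem_ne_zero_of_ne_bot hV
  refine ⟨((‖v‖⁻¹ : ℝ) : ℂ) • v, Submodule.smul_mem _ _ hv, ?_⟩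
  rw [norm_smul, Complex.norm_real, Real.norm_of_nonneg (by positivity),
    inv_mul_cancel₀ (norm_ne_zero_iff.2 hv0)]

/-- A state of the successive removal of largest eigenvalues: a compact positive operator, together
with a finite-dimensional space it annihilates, the span of the eigenvectors already found. -/
def DeflationState (H : Type*) [NormedAddCommGroup H] [InnerProductSpace ℂ H] [CompleteSpace H] :
    Type _ :=
  {p : (H →L[ℂ] H) × Submodule ℂ H //
    p.1.IsPositive ∧ IsCompactOperator p.1 ∧ FiniteDimensional ℂ p.2 ∧ ∀ v ∈ p.2, p.1 v = 0}

theorem DeflationState.exists_eigenvector [CompleteSpace H] (b : HilbertBasis ℕ ℂ H)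
    (s : DeflationState H) :
    ∃ ψ ∈ (s.1.2)ᗮ, ‖ψ‖ = 1 ∧ s.1.1 ψ = ((‖s.1.1‖ : ℝ) : ℂ) • ψ := by
  obtain ⟨⟨T, V⟩, hT, hc, hV, hTV⟩ := s
  dsimp only at *
  by_cases h0 : T = 0
  · obtain ⟨ψ, h1, h2⟩ := exists_unit_mem_orthogonal b V
    exact ⟨ψ, h1, h2, by simp [h0]⟩
  · obtain ⟨ψ, h1, h2⟩ := exists_eigenvector_norm hT hc h0
    refine ⟨ψ, ?_, h1, h2⟩
    rw [Submodule.mem_orthogonal]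
    intro v hv
    have h3 : ((‖T‖ : ℝ) : ℂ) * inner ℂ v ψ = 0 := by
      rw [← inner_smul_right, ← h2, ← hT.inner_left_eq_inner_right, hTV v hv, inner_zero_left]
    exact (mul_eq_zero.1 h3).resolve_left (by exact_mod_cast norm_ne_zero_iff.2 h0)

variable [CompleteSpace H]

/-- The eigenvector for the largest eigenvalue, orthogonal to those already found. -/
noncomputable def DeflationState.vec (b : HilbertBasis ℕ ℂ H) (s : DeflationState H) : H :=
  (s.exists_eigenvector b).choose

/-- Removal of the largest eigenvalue. -/
noncomputable def DeflationState.next (b : HilbertBasis ℕ ℂ H) (s : DeflationState H) :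
    DeflationState H :=
  ⟨(s.1.1 - ((‖s.1.1‖ : ℝ) : ℂ) • rankOne ℂ (s.vec b) (s.vec b),
    s.1.2 ⊔ Submodule.span ℂ {s.vec b}), by
    obtain ⟨h1, h2, h3⟩ := (s.exists_eigenvector b).choose_spec
    change s.vec b ∈ _ at h1
    change ‖s.vec b‖ = 1 at h2
    change s.1.1 (s.vec b) = _ • s.vec b at h3
    obtain ⟨hT, hc, hV, hTV⟩ := s.2
    refine ⟨isPositive_deflate hT h2 h3,
      hc.sub ((isCompactOperator_rankOne _ _).smul _), inferInstance, ?_⟩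
    intro v hv
    obtain ⟨y, hy, z, hz, rfl⟩ := Submodule.mem_sup.1 hv
    obtain ⟨a, rfl⟩ := Submodule.mem_span_singleton.1 hz
    have hy' : inner ℂ (s.vec b) y = 0 := (Submodule.mem_orthogonal' _ _).1 h1 y hy
    simp [hTV y hy, h3, hy', inner_self_eq_norm_sq_to_K, h2, inner_add_right, inner_smul_right,
      smul_comm a]⟩

/-- Spectral theorem: the eigenvalues of a positive trace-class operator can be listed in
decreasing order. -/
theorem exists_isDiagonalizedBy (b : HilbertBasis ℕ ℂ H) {X : H →L[ℂ] H} (hX : X.IsPositive)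
    (hs : Summable fun n => (inner ℂ (b n) (X (b n))).re) :
    ∃ x ψ, IsDiagonalizedBy X x ψ := by
  let s : ℕ → DeflationState H := fun n => Nat.rec
    ⟨(X, ⊥), hX, isCompactOperator_of_summable b hX hs, inferInstance, by simp⟩
    (fun _ t => t.next b) n
  let T : ℕ → H →L[ℂ] H := fun n => (s n).1.1
  let V : ℕ → Submodule ℂ H := fun n => (s n).1.2
  let ψ : ℕ → H := fun n => (s n).vec b
  let x : ℕ → ℝ := fun n => ‖T n‖
  have hψ : ∀ n, ψ n ∈ (V n)ᗮ ∧ ‖ψ n‖ = 1 ∧ T n (ψ n) = ((x n : ℝ) : ℂ) • ψ n :=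
    fun n => ((s n).exists_eigenvector b).choose_spec
  have hTpos : ∀ n, (T n).IsPositive := fun n => (s n).2.1
  have hTsucc : ∀ n, T (n + 1) = T n - (x n : ℂ) • rankOne ℂ (ψ n) (ψ n) := fun n => rfl
  have hVsucc : ∀ n, V (n + 1) = V n ⊔ Submodule.span ℂ {ψ n} := fun n => rfl
  have hVmono : Monotone V := monotone_nat_of_le_succ fun n => by
    rw [hVsucc]; exact le_sup_left
  have hmem : ∀ m n, m < n → ψ m ∈ V n := fun m n hmn =>
    hVmono (Nat.succ_le_of_lt hmn) (by
      rw [hVsucc]; exact Submodule.mem_sup_right (Submodule.mem_span_singleton_self _))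
  have horth : Orthonormal ℂ ψ := by
    refine ⟨fun n => (hψ n).2.1, fun m n hmn => ?_⟩
    rcases lt_or_gt_of_ne hmn with h | h
    · exact (Submodule.mem_orthogonal _ _).1 (hψ n).1 _ (hmem m n h)
    · exact (Submodule.mem_orthogonal' _ _).1 (hψ m).1 _ (hmem n m h)
  have hT : ∀ n, X = T n + ∑ i ∈ Finset.range n, (x i : ℂ) • rankOne ℂ (ψ i) (ψ i) := by
    intro n
    induction n with
    | zero => rw [Finset.sum_range_zero, add_zero]; rfl
    | succ n ih => rw [Finset.sum_range_succ, hTsucc]; exact ih.trans (by abel)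
  have hanti : Antitone x := antitone_nat_of_succ_le fun n => by
    refine CStarAlgebra.norm_le_norm_of_nonneg_of_le
      ((ContinuousLinearMap.nonneg_iff_isPositive _).2 (hTpos (n + 1))) ?_
    rw [ContinuousLinearMap.le_def, hTsucc, sub_sub_cancel]
    exact (InnerProductSpace.isPositive_rankOne_self _).smul_of_nonneg
      (by exact_mod_cast norm_nonneg _)
  have hx0 : ∀ n, 0 ≤ x n := fun n => norm_nonneg _
  have hsum : Summable x := by
    refine summable_of_sum_range_le hx0 (c := ∑' n, (inner ℂ (b n) (X (b n))).re) fun n => ?_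
    have h1 : HasSum (fun k => ∑ i ∈ Finset.range n, x i * ‖inner ℂ (b k) (ψ i)‖ ^ 2)
        (∑ i ∈ Finset.range n, x i * 1) := by
      refine hasSum_sum fun i _ => HasSum.mul_left (x i) ?_
      have := hasSum_norm_inner_sq b (ψ i)
      rwa [(hψ i).2.1, one_pow] at this
    simp only [mul_one] at h1
    refine hasSum_le (fun k => ?_) h1 hs.hasSum
    conv_rhs => rw [hT n]
    have h2 := (hTpos n).re_inner_nonneg_right (b k)
    simp only [add_apply, sum_apply, inner_add_right,
      inner_sum, Complex.add_re, Complex.re_sum]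
    refine le_add_of_nonneg_of_le h2 (Finset.sum_le_sum fun i _ => le_of_eq ?_)
    rw [smul_apply, inner_smul_right, InnerProductSpace.rankOne_apply,
      inner_smul_right, ← inner_conj_symm (ψ i), ← Complex.normSq_eq_conj_mul_self,
      ← Complex.ofReal_mul, Complex.ofReal_re, Complex.normSq_eq_norm_sq]
  refine ⟨x, ψ, hanti, hx0, horth, fun v => ?_⟩
  have hsv : Summable fun n => (x n : ℂ) • rankOne ℂ (ψ n) (ψ n) v := by
    refine Summable.of_norm_bounded (hsum.mul_right ‖v‖) fun n => ?_
    rw [norm_smul, Complex.norm_real, Real.norm_of_nonneg (hx0 n)]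
    refine mul_le_mul_of_nonneg_left ?_ (hx0 n)
    have := (rankOne ℂ (ψ n) (ψ n)).le_opNorm v
    rwa [InnerProductSpace.norm_rankOne, (hψ n).2.1, one_mul, one_mul] at this
  refine (hsv.hasSum_iff_tendsto_nat).2 ?_
  have h3 : ∀ n, ∑ i ∈ Finset.range n, (x i : ℂ) • rankOne ℂ (ψ i) (ψ i) v = X v - T n v := by
    intro n
    conv_rhs => rw [hT n]
    simp
  simp only [h3]
  have h4 : Tendsto (fun n => T n v) atTop (𝓝 0) :=
    squeeze_zero_norm (fun n => (T n).le_opNorm v)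
      (by simpa using hsum.tendsto_atTop_zero.mul_const ‖v‖)
  simpa using tendsto_const_nhds.sub h4

end Spectral

/-! ### Weighted sums of decreasing sequences -/

section Weights

/-- Against a decreasing sequence, weights in `[0, 1]` of total mass `q + θ` do best when they sit
on the first `q` terms, with the remaining mass `θ` on the next one. -/
theorem sum_mul_le_of_weights {x r : ℕ → ℝ} (hx : Antitone x) (hx0 : ∀ n, 0 ≤ x n)
    (hr0 : ∀ n, 0 ≤ r n) (hr1 : ∀ n, r n ≤ 1) {q : ℕ} {θ : ℝ} {K : ℕ}
    (hr : ∑ n ∈ Finset.range K, r n ≤ q + θ) :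
    ∑ n ∈ Finset.range K, x n * r n ≤ ∑ n ∈ Finset.range q, x n + θ * x q := by
  have h1 : ∑ n ∈ Finset.range K, (x n - x q) * r n ≤ ∑ n ∈ Finset.range q, (x n - x q) := by
    calc ∑ n ∈ Finset.range K, (x n - x q) * r n
        ≤ ∑ n ∈ Finset.range K, (if n < q then x n - x q else 0) := by
          refine Finset.sum_le_sum fun n _ => ?_
          split_ifs with h
          · exact mul_le_of_le_one_right (sub_nonneg.2 (hx h.le)) (hr1 n)
          · exact mul_nonpos_of_nonpos_of_nonneg (sub_nonpos.2 (hx (not_lt.1 h))) (hr0 n)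
      _ = ∑ n ∈ (Finset.range K).filter (· < q), (x n - x q) := (Finset.sum_filter _ _).symm
      _ ≤ ∑ n ∈ Finset.range q, (x n - x q) := by
          refine Finset.sum_le_sum_of_subset_of_nonneg (fun n hn => ?_) fun n hn _ => ?_
          · simpa using (Finset.mem_filter.1 hn).2
          · exact sub_nonneg.2 (hx (Finset.mem_range.1 hn).le)
  have h2 : x q * ∑ n ∈ Finset.range K, r n ≤ x q * (q + θ) :=
    mul_le_mul_of_nonneg_left hr (hx0 q)
  simp only [sub_mul, Finset.sum_sub_distrib, Finset.sum_const, Finset.card_range, nsmul_eq_mul,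
    ← Finset.mul_sum] at h1
  linarith

theorem le_of_hasSum_weights {x r : ℕ → ℝ} (hx : Antitone x) (hx0 : ∀ n, 0 ≤ x n)
    (hr0 : ∀ n, 0 ≤ r n) (hr1 : ∀ n, r n ≤ 1) {q : ℕ} {θ : ℝ}
    (hr : ∀ K, ∑ n ∈ Finset.range K, r n ≤ q + θ) {t : ℝ} (ht : HasSum (fun n => x n * r n) t) :
    t ≤ ∑ n ∈ Finset.range q, x n + θ * x q :=
  le_of_tendsto' ht.tendsto_sum_nat fun K => sum_mul_le_of_weights hx hx0 hr0 hr1 (hr K)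

/-- Summation by parts: majorization of partial sums is inherited by decreasing weights. -/
theorem sum_mul_le_sum_mul_of_antitone {x s t : ℕ → ℝ} (hx : Antitone x) (hx0 : ∀ n, 0 ≤ x n)
    (h : ∀ p, ∑ n ∈ Finset.range p, s n ≤ ∑ n ∈ Finset.range p, t n) (p : ℕ) :
    ∑ n ∈ Finset.range p, x n * s n ≤ ∑ n ∈ Finset.range p, x n * t n := by
  have key : ∀ p, x p * (∑ n ∈ Finset.range p, t n - ∑ n ∈ Finset.range p, s n) ≤
      ∑ n ∈ Finset.range p, x n * t n - ∑ n ∈ Finset.range p, x n * s n := by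
    intro p
    induction p with
    | zero => simp
    | succ p ih =>
      have h1 := mul_le_mul_of_nonneg_right (hx (Nat.le_succ p)) (sub_nonneg.2 (h (p + 1)))
      simp only [Finset.sum_range_succ, Nat.succ_eq_add_one] at h1 ⊢
      nlinarith
  have h2 := mul_nonneg (hx0 p) (sub_nonneg.2 (h p))
  linarith [key p]

end Weights

/-! ### Ky Fan's principle -/

section KyFan

variable {H : Type*} [NormedAddCommGroup H] [InnerProductSpace ℂ H]

/-- Ky Fan's maximum principle. -/
theorem IsDiagonalizedBy.sum_inner_le {X : H →L[ℂ] H} {x : ℕ → ℝ} {ψ : ℕ → H}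
    (h : IsDiagonalizedBy X x ψ) {ι : Type*} [Fintype ι] {φ : ι → H} (hφ : Orthonormal ℂ φ) :
    ∑ i, (inner ℂ (φ i) (X (φ i))).re ≤ ∑ n ∈ Finset.range (Fintype.card ι), x n := by
  have h1 : HasSum (fun n => x n * ∑ i, ‖inner ℂ (ψ n) (φ i)‖ ^ 2)
      (∑ i, (inner ℂ (φ i) (X (φ i))).re) := by
    simp only [Finset.mul_sum]
    exact hasSum_sum fun i _ => h.hasSum_re_inner_self (φ i)
  have := le_of_hasSum_weights (θ := 0) (q := Fintype.card ι) h.antitone h.nonneg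
    (fun n => Finset.sum_nonneg fun i _ => by positivity) (fun n => ?_) (fun K => ?_) h1
  · simpa using this
  · have := hφ.sum_inner_products_le (ψ n) (s := Finset.univ)
    rw [h.orthonormal.1 n, one_pow] at this
    simpa only [norm_inner_symm (ψ n)] using this
  · rw [Finset.sum_comm, add_zero]
    calc ∑ i, ∑ n ∈ Finset.range K, ‖inner ℂ (ψ n) (φ i)‖ ^ 2 ≤ ∑ i : ι, (1 : ℝ) := by
          refine Finset.sum_le_sum fun i _ => ?_
          have := h.orthonormal.sum_inner_products_le (φ i) (s := Finset.range K)
          rwa [hφ.1 i, one_pow] at this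
      _ = Fintype.card ι := by simp

theorem IsDiagonalizedBy.sum_range_le {X : H →L[ℂ] H} {x y : ℕ → ℝ} {ψ φ : ℕ → H}
    (h : IsDiagonalizedBy X x ψ) (h' : IsDiagonalizedBy X y φ) (n : ℕ) :
    ∑ i ∈ Finset.range n, y i ≤ ∑ i ∈ Finset.range n, x i := by
  have := h.sum_inner_le (h'.orthonormal.comp (fun i : Fin n => (i : ℕ)) Fin.val_injective)
  simp only [Function.comp_apply, h'.inner_eigenvector, Fintype.card_fin] at this
  rwa [Finset.sum_range]

theorem IsDiagonalizedBy.eigenvalues_unique {X : H →L[ℂ] H} {x y : ℕ → ℝ} {ψ φ : ℕ → H}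
    (h : IsDiagonalizedBy X x ψ) (h' : IsDiagonalizedBy X y φ) : x = y := by
  have key : ∀ n, ∑ i ∈ Finset.range n, x i = ∑ i ∈ Finset.range n, y i := fun n =>
    le_antisymm (h'.sum_range_le h n) (h.sum_range_le h' n)
  funext n
  have := key (n + 1)
  rwa [Finset.sum_range_succ, Finset.sum_range_succ, key n, add_right_inj] at this

theorem IsDiagonalizedBy.eigenvalues_eq [CompleteSpace H] {X : H →L[ℂ] H} {x : ℕ → ℝ} {ψ : ℕ → H}
    (h : IsDiagonalizedBy X x ψ) : eigenvalues X = x := by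
  have hex : ∃ x, IsDecreasingEigenvalues X x := ⟨x, isDecreasingEigenvalues_iff.2 ⟨ψ, h⟩⟩
  have h1 : IsDecreasingEigenvalues X (eigenvalues X) := by
    rw [eigenvalues, dif_pos hex]
    exact hex.choose_spec
  obtain ⟨φ, h2⟩ := isDecreasingEigenvalues_iff.1 h1
  exact h2.eigenvalues_unique h

end KyFan

/-! ### Trace-class operators -/

section TraceClass

variable {H : Type*} [NormedAddCommGroup H] [InnerProductSpace ℂ H]

theorem eq_of_inner_basis (b : HilbertBasis ℕ ℂ H) {u v : H}
    (h : ∀ n, inner ℂ (b n) u = inner ℂ (b n) v) : u = v := by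
  apply b.repr.injective
  ext n
  rw [b.repr_apply_apply, b.repr_apply_apply, h]

theorem clm_ext_basis (b : HilbertBasis ℕ ℂ H) {X Y : H →L[ℂ] H} (h : ∀ n, X (b n) = Y (b n)) :
    X = Y := by
  refine ContinuousLinearMap.ext_on (s := Set.range b) ?_ ?_
  · rw [dense_iff_closure_eq, ← Submodule.topologicalClosure_coe, b.dense_span]; rfl
  · rintro _ ⟨n, rfl⟩; exact h n

theorem trace_eq_of_isPositive (b : HilbertBasis ℕ ℂ H) {X : H →L[ℂ] H} (hX : X.IsPositive) :
    trace b X = ((∑' n, (inner ℂ (b n) (X (b n))).re : ℝ) : ℂ) := by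
  rw [trace, Complex.ofReal_tsum]
  congr 1
  funext n
  have h1 := hX.inner_nonneg_right (b n)
  rw [Complex.le_def] at h1
  apply Complex.ext <;> simp [← h1.2]

theorem IsDiagonalizedBy.norm_le {X : H →L[ℂ] H} {x : ℕ → ℝ} {ψ : ℕ → H}
    (h : IsDiagonalizedBy X x ψ) (hx : Summable x) : ‖X‖ ≤ ∑' n, x n := by
  refine ContinuousLinearMap.opNorm_le_bound _ (tsum_nonneg h.nonneg) fun v => ?_
  have hb : ∀ n, ‖(x n : ℂ) • rankOne ℂ (ψ n) (ψ n) v‖ ≤ x n * ‖v‖ := fun n => by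
    rw [norm_smul, Complex.norm_real, Real.norm_of_nonneg (h.nonneg n)]
    refine mul_le_mul_of_nonneg_left ?_ (h.nonneg n)
    have := (rankOne ℂ (ψ n) (ψ n)).le_opNorm v
    rwa [InnerProductSpace.norm_rankOne, h.orthonormal.1, one_mul, one_mul] at this
  rw [← (h.hasSum v).tsum_eq, ← tsum_mul_right]
  exact tsum_of_norm_bounded (hx.mul_right ‖v‖).hasSum hb

theorem hasSum_diagonal_rankOne_self (b : HilbertBasis ℕ ℂ H) (v : H) :
    HasSum (fun n => (inner ℂ (b n) (rankOne ℂ v v (b n))).re) (‖v‖ ^ 2) := by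
  refine (hasSum_norm_inner_sq b v).congr_fun fun n => ?_
  rw [InnerProductSpace.rankOne_apply, inner_smul_right, ← inner_conj_symm v,
    ← Complex.normSq_eq_conj_mul_self, Complex.ofReal_re, Complex.normSq_eq_norm_sq]

/-- Eigenvectors of the square of a positive operator are eigenvectors of the operator. -/
theorem apply_eq_smul_of_sq_apply {A : H →L[ℂ] H} (hA : A.IsPositive) {v : H} {c : ℝ} (hc : 0 ≤ c)
    (h : A (A v) = ((c ^ 2 : ℝ) : ℂ) • v) : A v = (c : ℂ) • v := by
  rcases hc.eq_or_lt with rfl | hc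
  · have h1 : inner ℂ (A v) (A v) = 0 := by
      rw [hA.inner_left_eq_inner_right, h]; simp
    rw [inner_self_eq_zero.1 h1]; simp
  · set w := A v - (c : ℂ) • v with hw
    have h1 : A w = -((c : ℂ) • w) := by
      rw [hw, map_sub, map_smul, h, smul_sub, smul_smul]
      push_cast
      rw [sq]; abel
    have h2 := hA.re_inner_nonneg_right w
    rw [h1, inner_neg_right, inner_smul_right, inner_self_eq_norm_sq_to_K] at h2
    have h3 : 0 ≤ -(c * ‖w‖ ^ 2) := by simpa [← Complex.ofReal_pow] using h2
    have h4 : ‖w‖ ^ 2 = 0 := by nlinarith [sq_nonneg ‖w‖]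
    exact sub_eq_zero.1 (norm_eq_zero.1 (pow_eq_zero_iff two_ne_zero |>.1 h4))

variable [CompleteSpace H]

theorem abs_eq_of_isPositive {X : H →L[ℂ] H} (hX : X.IsPositive) : CFC.abs X = X :=
  CFC.abs_of_nonneg X ((ContinuousLinearMap.nonneg_iff_isPositive X).2 hX)

theorem isTraceClass_iff_of_isPositive (b : HilbertBasis ℕ ℂ H) {X : H →L[ℂ] H}
    (hX : X.IsPositive) :
    IsTraceClass b X ↔ Summable fun n => (inner ℂ (b n) (X (b n))).re := by
  rw [IsTraceClass, abs_eq_of_isPositive hX]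

theorem isDiagonalizedBy_eigenvalues (b : HilbertBasis ℕ ℂ H) {X : H →L[ℂ] H} (hX : X.IsPositive)
    (hs : IsTraceClass b X) : ∃ ψ, IsDiagonalizedBy X (eigenvalues X) ψ := by
  obtain ⟨x, ψ, h⟩ := exists_isDiagonalizedBy b hX ((isTraceClass_iff_of_isPositive b hX).1 hs)
  exact ⟨ψ, h.eigenvalues_eq ▸ h⟩

theorem IsDiagonalizedBy.isTraceClass {X : H →L[ℂ] H} {x : ℕ → ℝ} {ψ : ℕ → H}
    (h : IsDiagonalizedBy X x ψ) (b : HilbertBasis ℕ ℂ H) (hx : Summable x) : IsTraceClass b X :=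
  (isTraceClass_iff_of_isPositive b h.isPositive).2 (h.hasSum_diagonal b hx).summable

theorem IsDiagonalizedBy.traceNorm_eq {X : H →L[ℂ] H} {x : ℕ → ℝ} {ψ : ℕ → H}
    (h : IsDiagonalizedBy X x ψ) (b : HilbertBasis ℕ ℂ H) (hx : Summable x) :
    traceNorm b X = ∑' n, x n := by
  rw [traceNorm, abs_eq_of_isPositive h.isPositive, (h.hasSum_diagonal b hx).tsum_eq]

theorem IsDiagonalizedBy.trace_eq {X : H →L[ℂ] H} {x : ℕ → ℝ} {ψ : ℕ → H}
    (h : IsDiagonalizedBy X x ψ) (b : HilbertBasis ℕ ℂ H) (hx : Summable x) :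
    trace b X = ((∑' n, x n : ℝ) : ℂ) := by
  rw [trace_eq_of_isPositive b h.isPositive, (h.hasSum_diagonal b hx).tsum_eq]

theorem IsDiagonalizedBy.summable {X : H →L[ℂ] H} {x : ℕ → ℝ} {ψ : ℕ → H}
    (h : IsDiagonalizedBy X x ψ) {b : HilbertBasis ℕ ℂ H} (hX : IsTraceClass b X) : Summable x :=
  h.summable_of_summable b ((isTraceClass_iff_of_isPositive b h.isPositive).1 hX)

theorem isPositive_abs (X : H →L[ℂ] H) : (CFC.abs X).IsPositive :=
  (ContinuousLinearMap.nonneg_iff_isPositive _).1 (CFC.abs_nonneg X)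

/-- The operator norm is at most the trace norm. -/
theorem norm_le_traceNorm {b : HilbertBasis ℕ ℂ H} {X : H →L[ℂ] H} (hX : IsTraceClass b X) :
    ‖X‖ ≤ traceNorm b X := by
  obtain ⟨x, ψ, h⟩ := exists_isDiagonalizedBy b (isPositive_abs X) hX
  have hx := h.summable_of_summable b hX
  rw [traceNorm, (h.hasSum_diagonal b hx).tsum_eq, ← CFC.norm_abs]
  exact h.norm_le hx

theorem abs_rankOne (u : H) {v : H} (hv : v ≠ 0) :
    CFC.abs (rankOne ℂ u v) = ((‖u‖ / ‖v‖ : ℝ) : ℂ) • rankOne ℂ v v := by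
  have hv' : ((‖v‖ : ℝ) : ℂ) ≠ 0 := by exact_mod_cast norm_ne_zero_iff.2 hv
  refine CFC.sqrt_unique ?_ ?_
  · ext w
    simp only [ContinuousLinearMap.star_eq_adjoint, InnerProductSpace.adjoint_rankOne,
      mul_apply_eq_comp, smul_apply, InnerProductSpace.rankOne_apply, map_smul, smul_smul,
      inner_self_eq_norm_sq_to_K]
    congr 1
    push_cast
    field_simp
    simp only [Complex.coe_algebraMap]
    ring
  · rw [ContinuousLinearMap.nonneg_iff_isPositive]
    exact (InnerProductSpace.isPositive_rankOne_self v).smul_of_nonneg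
      (by exact_mod_cast (by positivity : (0 : ℝ) ≤ ‖u‖ / ‖v‖))

theorem hasSum_abs_rankOne (b : HilbertBasis ℕ ℂ H) (u v : H) :
    HasSum (fun n => (inner ℂ (b n) (CFC.abs (rankOne ℂ u v) (b n))).re) (‖u‖ * ‖v‖) := by
  by_cases hv : v = 0
  · simp [hv]
  · have h1 := (hasSum_diagonal_rankOne_self b v).mul_left (‖u‖ / ‖v‖)
    have h2 : ‖u‖ / ‖v‖ * ‖v‖ ^ 2 = ‖u‖ * ‖v‖ := by
      field_simp [norm_ne_zero_iff.2 hv]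
    rw [h2] at h1
    refine h1.congr_fun fun n => ?_
    rw [abs_rankOne u hv, smul_apply, inner_smul_right, Complex.re_ofReal_mul]

theorem isTraceClass_rankOne (b : HilbertBasis ℕ ℂ H) (u v : H) :
    IsTraceClass b (rankOne ℂ u v) :=
  (hasSum_abs_rankOne b u v).summable

theorem traceNorm_rankOne (b : HilbertBasis ℕ ℂ H) (u v : H) :
    traceNorm b (rankOne ℂ u v) = ‖u‖ * ‖v‖ :=
  (hasSum_abs_rankOne b u v).tsum_eq

theorem isTraceClass_smul {b : HilbertBasis ℕ ℂ H} {X : H →L[ℂ] H} (hX : IsTraceClass b X)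
    (c : ℂ) : IsTraceClass b (c • X) := by
  refine (hX.mul_left ‖c‖).congr fun n => ?_
  rw [CFC.abs_smul, smul_apply, inner_smul_right_eq_smul, Complex.smul_re, smul_eq_mul]

/-- A trace-class operator `|k⟩ ↦ y k |k + d⟩` has absolutely summable coefficients. -/
theorem summable_norm_of_apply_basis {b : HilbertBasis ℕ ℂ H} {Y : H →L[ℂ] H} {y : ℕ → ℂ} {d : ℕ}
    (hY : ∀ k, Y (b k) = y k • b (k + d)) (hs : IsTraceClass b Y) : Summable fun k => ‖y k‖ := by
  refine Summable.congr hs fun k => ?_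
  have h1 : CFC.abs Y (b k) = ((‖y k‖ : ℝ) : ℂ) • b k := by
    refine apply_eq_smul_of_sq_apply (isPositive_abs Y) (norm_nonneg _) ?_
    rw [← mul_apply_eq_comp, CFC.abs_mul_abs, mul_apply_eq_comp,
      ContinuousLinearMap.star_eq_adjoint]
    refine eq_of_inner_basis b fun m => ?_
    rw [ContinuousLinearMap.adjoint_inner_right, hY, hY, inner_smul_left, inner_smul_right,
      inner_smul_right, orthonormal_iff_ite.1 b.orthonormal, orthonormal_iff_ite.1 b.orthonormal]
    by_cases hmk : m = k
    · subst hmk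
      simp [Complex.conj_mul']
    · simp [hmk]
  rw [h1, inner_smul_right, orthonormal_iff_ite.1 b.orthonormal]
  simp

end TraceClass

/-! ### One step of photon loss -/

section LossStep

variable {H : Type*} [NormedAddCommGroup H] [InnerProductSpace ℂ H]

/-- The operator `√(1 - η N)` on the span of the Fock states `|0⟩, …, |M⟩`. -/
noncomputable def damping (b : HilbertBasis ℕ ℂ H) (M : ℕ) (η : ℝ) : H →L[ℂ] H :=
  ∑ j ∈ Finset.range (M + 1), ((√(1 - η * j) : ℝ) : ℂ) • rankOne ℂ (b j) (b j)

/-- The ladder operator `a` on the span of the Fock states `|0⟩, …, |M⟩`. -/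
noncomputable def lowering (b : HilbertBasis ℕ ℂ H) (M : ℕ) : H →L[ℂ] H :=
  ∑ j ∈ Finset.range M, ((√((j : ℝ) + 1) : ℝ) : ℂ) • rankOne ℂ (b j) (b (j + 1))

theorem inner_damping (b : HilbertBasis ℕ ℂ H) (M : ℕ) (η : ℝ) (i : ℕ) (v : H) :
    inner ℂ (b i) (damping b M η v) =
      if i < M + 1 then ((√(1 - η * i) : ℝ) : ℂ) * inner ℂ (b i) v else 0 := by
  simp only [damping, sum_apply, smul_apply, InnerProductSpace.rankOne_apply, inner_sum,
    inner_smul_right, orthonormal_iff_ite.1 b.orthonormal, mul_ite, mul_one, mul_zero,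
    Finset.sum_ite_eq, Finset.mem_range]

theorem inner_lowering (b : HilbertBasis ℕ ℂ H) (M i : ℕ) (v : H) :
    inner ℂ (b i) (lowering b M v) =
      if i < M then ((√((i : ℝ) + 1) : ℝ) : ℂ) * inner ℂ (b (i + 1)) v else 0 := by
  simp only [lowering, sum_apply, smul_apply, InnerProductSpace.rankOne_apply, inner_sum,
    inner_smul_right, orthonormal_iff_ite.1 b.orthonormal, mul_ite, mul_one, mul_zero,
    Finset.sum_ite_eq, Finset.mem_range]

theorem hasSum_of_support {E : Type*} [AddCommMonoid E] [TopologicalSpace E] {f : ℕ → E} {M : ℕ}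
    (h : ∀ n, M < n → f n = 0) :
    HasSum f (∑ n ∈ Finset.range (M + 1), f n) :=
  hasSum_sum_of_ne_finset_zero fun n hn => h n (by simpa using hn)

theorem sum_norm_inner_sq_le (b : HilbertBasis ℕ ℂ H) (s : Finset ℕ) (v : H) :
    ∑ i ∈ s, ‖inner ℂ (b i) v‖ ^ 2 ≤ ‖v‖ ^ 2 :=
  b.orthonormal.sum_inner_products_le v

theorem norm_damping_sq (b : HilbertBasis ℕ ℂ H) {M : ℕ} {η : ℝ} (hη : η * M ≤ 1) (hη0 : 0 ≤ η)
    (v : H) : ‖damping b M η v‖ ^ 2 =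
      ∑ i ∈ Finset.range (M + 1), (1 - η * i) * ‖inner ℂ (b i) v‖ ^ 2 := by
  refine (hasSum_norm_inner_sq b (damping b M η v)).unique ?_
  convert hasSum_of_support (M := M) ?_ using 1
  · refine Finset.sum_congr rfl fun i hi => ?_
    have hi' : (i : ℝ) ≤ M := by exact_mod_cast Nat.lt_succ_iff.1 (Finset.mem_range.1 hi)
    rw [inner_damping, if_pos (Finset.mem_range.1 hi), norm_mul, mul_pow, Complex.norm_real,
      Real.norm_of_nonneg (Real.sqrt_nonneg _), Real.sq_sqrt]
    nlinarith
  · intro n hn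
    rw [inner_damping, if_neg (by lia)]
    simp

theorem norm_lowering_sq (b : HilbertBasis ℕ ℂ H) (M : ℕ) (v : H) :
    ‖lowering b M v‖ ^ 2 = ∑ i ∈ Finset.range (M + 1), (i : ℝ) * ‖inner ℂ (b i) v‖ ^ 2 := by
  refine (hasSum_norm_inner_sq b (lowering b M v)).unique ?_
  convert hasSum_of_support (M := M) ?_ using 1
  · rw [Finset.sum_range_succ', Finset.sum_range_succ, inner_lowering, if_neg (lt_irrefl M)]
    simp only [Nat.cast_zero, zero_mul, norm_zero, ne_eq, OfNat.ofNat_ne_zero, not_false_eq_true,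
      zero_pow, add_zero]
    refine Finset.sum_congr rfl fun i hi => ?_
    rw [inner_lowering, if_pos (Finset.mem_range.1 hi), norm_mul, mul_pow, Complex.norm_real,
      Real.norm_of_nonneg (Real.sqrt_nonneg _), Real.sq_sqrt (by positivity)]
    push_cast
    rfl
  · intro n hn
    rw [inner_lowering, if_neg (by lia)]
    simp

/-- `D† D + η a† a ≤ 1`: a loss step does not increase the trace. -/
theorem norm_damping_sq_add_le (b : HilbertBasis ℕ ℂ H) {M : ℕ} {η : ℝ} (hη : η * M ≤ 1)
    (hη0 : 0 ≤ η) (v : H) : ‖damping b M η v‖ ^ 2 + η * ‖lowering b M v‖ ^ 2 ≤ ‖v‖ ^ 2 := by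
  rw [norm_damping_sq b hη hη0, norm_lowering_sq, Finset.mul_sum, ← Finset.sum_add_distrib]
  refine le_trans (le_of_eq (Finset.sum_congr rfl fun i _ => ?_))
    (sum_norm_inner_sq_le b (Finset.range (M + 1)) v)
  ring

theorem damping_apply_of_lt (b : HilbertBasis ℕ ℂ H) {M n : ℕ} (h : M < n) (η : ℝ) :
    damping b M η (b n) = 0 := by
  refine eq_of_inner_basis b fun i => ?_
  rw [inner_damping, orthonormal_iff_ite.1 b.orthonormal]
  by_cases hi : i < M + 1
  · simp [hi, (by lia : i ≠ n)]
  · simp [hi]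

/-- A positive operator on the span of `|0⟩, …, |M⟩` is weakly sub-majorized by the decreasing
sequence `d`. -/
structure IsSubmajorized (b : HilbertBasis ℕ ℂ H) (M : ℕ) (X : H →L[ℂ] H) (d : ℕ → ℝ) : Prop where
  isPositive : X.IsPositive
  apply_of_lt : ∀ n, M < n → X (b n) = 0
  antitone : Antitone d
  eq_zero_of_lt : ∀ n, M < n → d n = 0
  sum_le : ∀ x ψ, IsDiagonalizedBy X x ψ → ∀ q,
    ∑ n ∈ Finset.range q, x n ≤ ∑ n ∈ Finset.range q, d n

theorem IsSubmajorized.nonneg {b : HilbertBasis ℕ ℂ H} {M : ℕ} {X : H →L[ℂ] H} {d : ℕ → ℝ}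
    (h : IsSubmajorized b M X d) (n : ℕ) : 0 ≤ d n :=
  (h.eq_zero_of_lt (n + M + 1) (by lia)).symm.le.trans (h.antitone (by lia))

theorem IsSubmajorized.hasSum_diagonal {b : HilbertBasis ℕ ℂ H} {M : ℕ} {X : H →L[ℂ] H}
    {d : ℕ → ℝ} (h : IsSubmajorized b M X d) :
    HasSum (fun n => (inner ℂ (b n) (X (b n))).re)
      (∑ n ∈ Finset.range (M + 1), (inner ℂ (b n) (X (b n))).re) :=
  hasSum_of_support fun n hn => by simp [h.apply_of_lt n hn]

/-- The rank of `X` is at most `M + 1`: the first `M + 1` eigenvalues already sum up to the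
trace. -/
theorem IsSubmajorized.eigenvalues_eq_zero {b : HilbertBasis ℕ ℂ H} {M : ℕ} {X : H →L[ℂ] H}
    {d : ℕ → ℝ} (h : IsSubmajorized b M X d) {x : ℕ → ℝ} {ψ : ℕ → H}
    (hX : IsDiagonalizedBy X x ψ) {q : ℕ} (hq : M < q) : x q = 0 := by
  have h1 := hX.sum_le_of_hasSum b h.hasSum_diagonal (M + 2)
  have h2 := hX.sum_inner_le
    (b.orthonormal.comp (fun i : Fin (M + 1) => (i : ℕ)) Fin.val_injective)
  rw [Fintype.card_fin] at h2
  simp only [Function.comp_apply] at h2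
  rw [← Finset.sum_range (fun i => (inner ℂ (b i) (X (b i))).re)] at h2
  rw [Finset.sum_range_succ] at h1
  have h3 : x q ≤ x (M + 1) := hX.antitone hq
  linarith [hX.nonneg q]

variable [CompleteSpace H]

theorem adjoint_damping (b : HilbertBasis ℕ ℂ H) (M : ℕ) (η : ℝ) :
    ContinuousLinearMap.adjoint (damping b M η) = damping b M η := by
  simp only [damping, map_sum, map_smulₛₗ, InnerProductSpace.adjoint_rankOne, Complex.conj_ofReal]

theorem inner_adjoint_lowering (b : HilbertBasis ℕ ℂ H) (M i : ℕ) (v : H) :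
    inner ℂ (b i) (ContinuousLinearMap.adjoint (lowering b M) v) =
      if i < M + 1 then ((√(i : ℝ) : ℝ) : ℂ) * inner ℂ (b (i - 1)) v else 0 := by
  rw [ContinuousLinearMap.adjoint_inner_right]
  simp only [lowering, sum_apply, smul_apply, InnerProductSpace.rankOne_apply, sum_inner,
    inner_smul_left, orthonormal_iff_ite.1 b.orthonormal]
  rcases i with _ | i
  · simp
  · simp only [Nat.add_right_cancel_iff, Nat.add_sub_cancel, Nat.add_lt_add_iff_right]
    split_ifs with hi
    · rw [Finset.sum_eq_single i]
      · simp
      · intro j _ hji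
        simp [hji]
      · intro h
        exact absurd (Finset.mem_range.2 hi) h
    · refine Finset.sum_eq_zero fun j hj => ?_
      have := Finset.mem_range.1 hj
      simp [(by lia : j ≠ i)]

theorem norm_adjoint_lowering_sq_le (b : HilbertBasis ℕ ℂ H) (M : ℕ) (v : H) :
    ‖ContinuousLinearMap.adjoint (lowering b M) v‖ ^ 2 ≤
      ∑ i ∈ Finset.range (M + 1), ((i : ℝ) + 1) * ‖inner ℂ (b i) v‖ ^ 2 := by
  have h1 : ‖ContinuousLinearMap.adjoint (lowering b M) v‖ ^ 2 =
      ∑ i ∈ Finset.range M, ((i : ℝ) + 1) * ‖inner ℂ (b i) v‖ ^ 2 := by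
    refine (hasSum_norm_inner_sq b _).unique ?_
    convert hasSum_of_support (M := M) ?_ using 1
    · rw [Finset.sum_range_succ', inner_adjoint_lowering]
      simp only [Nat.cast_zero, Real.sqrt_zero, Complex.ofReal_zero, zero_mul, ite_self, norm_zero,
        ne_eq, OfNat.ofNat_ne_zero, not_false_eq_true, zero_pow, add_zero]
      refine Finset.sum_congr rfl fun i hi => ?_
      rw [inner_adjoint_lowering, if_pos (by have := Finset.mem_range.1 hi; lia), norm_mul, mul_pow,
        Complex.norm_real, Real.norm_of_nonneg (Real.sqrt_nonneg _), Real.sq_sqrt (by positivity)]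
      push_cast
      rfl
    · intro n hn
      rw [inner_adjoint_lowering, if_neg (by lia)]
      simp
  rw [h1]
  exact Finset.sum_le_sum_of_subset_of_nonneg (Finset.range_mono (Nat.le_succ M))
    fun i _ _ => by positivity

/-- `D D† + η a a† ≤ 1 + η`, the commutation relation `[a, a†] = 1` of the ladder operators. -/
theorem norm_adjoint_damping_sq_add_le (b : HilbertBasis ℕ ℂ H) {M : ℕ} {η : ℝ} (hη : η * M ≤ 1)
    (hη0 : 0 ≤ η) (v : H) :
    ‖damping b M η v‖ ^ 2 + η * ‖ContinuousLinearMap.adjoint (lowering b M) v‖ ^ 2 ≤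
      (1 + η) * ‖v‖ ^ 2 := by
  rw [norm_damping_sq b hη hη0]
  have h1 := mul_le_mul_of_nonneg_left (norm_adjoint_lowering_sq_le b M v) hη0
  have h2 := mul_le_mul_of_nonneg_left (sum_norm_inner_sq_le b (Finset.range (M + 1)) v)
    (by positivity : 0 ≤ 1 + η)
  refine le_trans (add_le_add_right h1 _) (le_trans (le_of_eq ?_) h2)
  rw [Finset.mul_sum, Finset.mul_sum, ← Finset.sum_add_distrib]
  exact Finset.sum_congr rfl fun i _ => by ring

/-- One step `X ↦ D X D + η a X a†`, `D = √(1 - η N)`, of photon loss with probability `η` per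
photon, on the span of the Fock states `|0⟩, …, |M⟩`. -/
noncomputable def lossStep (b : HilbertBasis ℕ ℂ H) (M : ℕ) (η : ℝ) (X : H →L[ℂ] H) : H →L[ℂ] H :=
  damping b M η * X * damping b M η +
    (η : ℂ) • (lowering b M * X * ContinuousLinearMap.adjoint (lowering b M))

theorem inner_lossStep (b : HilbertBasis ℕ ℂ H) (M : ℕ) (η : ℝ) (X : H →L[ℂ] H) (u v : H) :
    inner ℂ u (lossStep b M η X v) =
      inner ℂ (damping b M η u) (X (damping b M η v)) +
        η * inner ℂ (ContinuousLinearMap.adjoint (lowering b M) u)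
          (X (ContinuousLinearMap.adjoint (lowering b M) v)) := by
  rw [lossStep, add_apply, inner_add_right, smul_apply, inner_smul_right,
    ContinuousLinearMap.adjoint_inner_left]
  simp only [mul_apply_eq_comp]
  congr 1
  conv_rhs => rw [← adjoint_damping, ContinuousLinearMap.adjoint_inner_left, adjoint_damping]

theorem lossStep_isPositive (b : HilbertBasis ℕ ℂ H) (M : ℕ) {η : ℝ} (hη0 : 0 ≤ η)
    {X : H →L[ℂ] H} (hX : X.IsPositive) : (lossStep b M η X).IsPositive := by
  refine ContinuousLinearMap.IsPositive.add ?_ (ContinuousLinearMap.IsPositive.smul_of_nonneg ?_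
    (by exact_mod_cast hη0))
  · have := hX.conj_adjoint (damping b M η)
    rwa [adjoint_damping] at this
  · exact hX.conj_adjoint (lowering b M)

theorem adjoint_lowering_apply_of_lt (b : HilbertBasis ℕ ℂ H) {M n : ℕ} (h : M < n) :
    ContinuousLinearMap.adjoint (lowering b M) (b n) = 0 := by
  refine eq_of_inner_basis b fun i => ?_
  rw [inner_adjoint_lowering, orthonormal_iff_ite.1 b.orthonormal]
  by_cases hi : i < M + 1
  · simp [hi, (by lia : i - 1 ≠ n)]
  · simp [hi]

theorem lossStep_apply_of_lt (b : HilbertBasis ℕ ℂ H) {M n : ℕ} (h : M < n) (η : ℝ)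
    (X : H →L[ℂ] H) : lossStep b M η X (b n) = 0 := by
  simp [lossStep, mul_apply_eq_comp, damping_apply_of_lt b h, adjoint_lowering_apply_of_lt b h]

/-- The effect of one step of photon loss on partial sums of eigenvalues. The weights
`∑ₐ ‖⟨φₐ, K ψₙ⟩‖²`, with `K` ranging over the Kraus operators, are at most `1` and sum up to at most
`(1 + η) q`. -/
theorem sum_eigenvalues_lossStep_le (b : HilbertBasis ℕ ℂ H) {M : ℕ} {η : ℝ} (hη : η * M ≤ 1)
    (hη0 : 0 ≤ η) {X : H →L[ℂ] H} {x y : ℕ → ℝ} {ψ φ : ℕ → H} (h : IsDiagonalizedBy X x ψ)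
    (h' : IsDiagonalizedBy (lossStep b M η X) y φ) (q : ℕ) :
    ∑ a ∈ Finset.range q, y a ≤ ∑ n ∈ Finset.range q, x n + η * q * x q := by
  let L := ContinuousLinearMap.adjoint (lowering b M)
  let r : ℕ → ℝ := fun n => ∑ a ∈ Finset.range q,
    (‖inner ℂ (ψ n) (damping b M η (φ a))‖ ^ 2 + η * ‖inner ℂ (ψ n) (L (φ a))‖ ^ 2)
  have h1 : HasSum (fun n => x n * r n) (∑ a ∈ Finset.range q, y a) := by
    simp only [r, Finset.mul_sum]
    refine hasSum_sum fun a _ => ?_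
    rw [← h'.inner_eigenvector a, inner_lossStep, Complex.add_re, Complex.re_ofReal_mul]
    refine ((h.hasSum_re_inner_self _).add ((h.hasSum_re_inner_self _).mul_left η)).congr_fun
      fun n => ?_
    ring
  refine le_of_hasSum_weights h.antitone h.nonneg
    (fun n => Finset.sum_nonneg fun a _ => by positivity) (fun n => ?_) (fun K => ?_) h1
  · have h2 := h'.orthonormal.sum_inner_products_le (damping b M η (ψ n)) (s := Finset.range q)
    have h3 := h'.orthonormal.sum_inner_products_le (lowering b M (ψ n)) (s := Finset.range q)
    have h4 := norm_damping_sq_add_le b hη hη0 (ψ n)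
    rw [h.orthonormal.1 n, one_pow] at h4
    have h5 : r n = ∑ a ∈ Finset.range q, ‖inner ℂ (φ a) (damping b M η (ψ n))‖ ^ 2 +
        η * ∑ a ∈ Finset.range q, ‖inner ℂ (φ a) (lowering b M (ψ n))‖ ^ 2 := by
      simp only [r, L, Finset.sum_add_distrib, Finset.mul_sum,
        ContinuousLinearMap.adjoint_inner_right]
      congr 1
      · refine Finset.sum_congr rfl fun a _ => ?_
        rw [norm_inner_symm, ← ContinuousLinearMap.adjoint_inner_right, adjoint_damping]
      · exact Finset.sum_congr rfl fun a _ => by rw [norm_inner_symm]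
    refine h5.trans_le ?_
    nlinarith
  · rw [Finset.sum_comm]
    calc _ ≤ ∑ a ∈ Finset.range q, (1 + η) := by
          refine Finset.sum_le_sum fun a _ => ?_
          have h2 := h.orthonormal.sum_inner_products_le (damping b M η (φ a))
            (s := Finset.range K)
          have h3 := h.orthonormal.sum_inner_products_le (L (φ a)) (s := Finset.range K)
          have h4 := norm_adjoint_damping_sq_add_le b hη hη0 (φ a)
          rw [h'.orthonormal.1 a, one_pow, mul_one] at h4
          rw [Finset.sum_add_distrib, ← Finset.mul_sum]
          nlinarith
      _ = q + η * q := by simp; ring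

/-- The effect of one step of photon loss on diagonal operators. -/
noncomputable def lossStepDiagonal (η : ℝ) (d : ℕ → ℝ) (j : ℕ) : ℝ :=
  (1 - η * j) * d j + η * (j + 1) * d (j + 1)

theorem sum_lossStepDiagonal (η : ℝ) (d : ℕ → ℝ) (q : ℕ) :
    ∑ j ∈ Finset.range q, lossStepDiagonal η d j = ∑ j ∈ Finset.range q, d j + η * q * d q := by
  induction q with
  | zero => simp
  | succ q ih => rw [Finset.sum_range_succ, ih, Finset.sum_range_succ, lossStepDiagonal]
                 push_cast
                 ring

namespace IsSubmajorized

variable {b : HilbertBasis ℕ ℂ H} {M : ℕ} {X Y : H →L[ℂ] H} {d e : ℕ → ℝ}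

theorem exists_isDiagonalizedBy (h : IsSubmajorized b M X d) : ∃ x ψ, IsDiagonalizedBy X x ψ :=
  GaussianChannel.exists_isDiagonalizedBy b h.isPositive h.hasSum_diagonal.summable

/-- Photon loss preserves sub-majorization. -/
theorem lossStep (h : IsSubmajorized b M X d) {η : ℝ} (hη0 : 0 ≤ η) (hη : η * (M + 1) ≤ 1) :
    IsSubmajorized b M (lossStep b M η X) (lossStepDiagonal η d) where
  isPositive := lossStep_isPositive b M hη0 h.isPositive
  apply_of_lt := fun n hn => lossStep_apply_of_lt b hn η X
  antitone := by
    refine antitone_nat_of_succ_le fun j => ?_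
    have e : lossStepDiagonal η d j - lossStepDiagonal η d (j + 1) =
        (1 - η * j) * (d j - d (j + 1)) + η * (j + 2) * (d (j + 1) - d (j + 2)) := by
      simp only [lossStepDiagonal]; push_cast; ring
    have h1 : 0 ≤ (1 - η * j) * (d j - d (j + 1)) := by
      rcases le_or_gt j M with hj | hj
      · have : (j : ℝ) ≤ M := by exact_mod_cast hj
        exact mul_nonneg (by nlinarith) (sub_nonneg.2 (h.antitone (Nat.le_succ j)))
      · rw [h.eq_zero_of_lt j hj, h.eq_zero_of_lt (j + 1) (by lia)]; simp
    have h2 : 0 ≤ η * (j + 2) * (d (j + 1) - d (j + 2)) :=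
      mul_nonneg (by positivity) (sub_nonneg.2 (h.antitone (Nat.le_succ _)))
    linarith
  eq_zero_of_lt := fun n hn => by
    simp [lossStepDiagonal, h.eq_zero_of_lt n hn, h.eq_zero_of_lt (n + 1) (by lia)]
  sum_le := fun y φ hy q => by
    obtain ⟨x, ψ, hx⟩ := h.exists_isDiagonalizedBy
    have h0 : η * M ≤ 1 := by nlinarith
    refine (sum_eigenvalues_lossStep_le b h0 hη0 hx hy q).trans ?_
    rw [sum_lossStepDiagonal]
    have h1 := h.sum_le x ψ hx q
    have h2 := h.sum_le x ψ hx (q + 1)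
    rw [Finset.sum_range_succ, Finset.sum_range_succ] at h2
    rcases le_or_gt q M with hq | hq
    · have hq' : η * q ≤ 1 := by
        have : (q : ℝ) ≤ M := by exact_mod_cast hq
        nlinarith
      have h3 : 0 ≤ η * q := by positivity
      nlinarith [mul_le_mul_of_nonneg_left h2 h3, mul_le_mul_of_nonneg_left h1 (sub_nonneg.2 hq')]
    · rw [h.eigenvalues_eq_zero hx hq, h.eq_zero_of_lt q hq]
      simpa using h1

theorem lossStep_iterate (h : IsSubmajorized b M X d) {η : ℝ} (hη0 : 0 ≤ η)
    (hη : η * (M + 1) ≤ 1) (k : ℕ) :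
    IsSubmajorized b M ((GaussianChannel.lossStep b M η)^[k] X) ((lossStepDiagonal η)^[k] d) := by
  induction k with
  | zero => exact h
  | succ k ih =>
    rw [Function.iterate_succ_apply', Function.iterate_succ_apply']
    exact ih.lossStep hη0 hη

/-- Von Neumann's trace inequality `Tr (Y X) ≤ ∑ⱼ eⱼ dⱼ`. -/
theorem sum_inner_mul_inner_le (hY : IsSubmajorized b M Y e) (hX : IsSubmajorized b M X d) :
    (∑ j ∈ Finset.range (M + 1), ∑ i ∈ Finset.range (M + 1),
      inner ℂ (b j) (Y (b i)) * inner ℂ (b i) (X (b j))).re ≤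
      ∑ j ∈ Finset.range (M + 1), e j * d j := by
  obtain ⟨x, ψ, hx⟩ := hX.exists_isDiagonalizedBy
  obtain ⟨y, φ, hy⟩ := hY.exists_isDiagonalizedBy
  have hrow : ∀ j, ∑ i ∈ Finset.range (M + 1), inner ℂ (b j) (Y (b i)) * inner ℂ (b i) (X (b j)) =
      inner ℂ (b j) (Y (X (b j))) := by
    intro j
    have h1 := b.hasSum_inner_mul_inner (Y (b j)) (X (b j))
    rw [hY.isPositive.inner_left_eq_inner_right] at h1
    refine (HasSum.unique h1 ?_).symm
    convert hasSum_of_support (M := M) ?_ using 1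
    · exact Finset.sum_congr rfl fun i _ => by rw [hY.isPositive.inner_left_eq_inner_right]
    · intro i hi
      rw [hY.isPositive.inner_left_eq_inner_right, hY.apply_of_lt i hi]
      simp
  simp only [hrow]
  have h2 : HasSum (fun n => (y n : ℂ) * inner ℂ (φ n) (X (φ n)))
      (∑ j ∈ Finset.range (M + 1), inner ℂ (b j) (Y (X (b j)))) := by
    have h3 : HasSum (fun n => ∑ j ∈ Finset.range (M + 1),
        (y n : ℂ) * (inner ℂ (b j) (φ n) * inner ℂ (φ n) (X (b j))))
        (∑ j ∈ Finset.range (M + 1), inner ℂ (b j) (Y (X (b j)))) :=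
      hasSum_sum fun j _ => hy.hasSum_inner (b j) (X (b j))
    refine h3.congr_fun fun n => ?_
    rw [← Finset.mul_sum]
    congr 1
    have h4 := b.hasSum_inner_mul_inner (X (φ n)) (φ n)
    rw [hX.isPositive.inner_left_eq_inner_right] at h4
    refine HasSum.unique h4 ?_
    convert hasSum_of_support (M := M) ?_ using 1
    · exact Finset.sum_congr rfl fun i _ => by
        rw [hX.isPositive.inner_left_eq_inner_right]; ring
    · intro i hi
      rw [hX.isPositive.inner_left_eq_inner_right, hX.apply_of_lt i hi]
      simp
  have h5 := Complex.hasSum_re h2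
  simp only [Complex.re_ofReal_mul] at h5
  refine le_of_tendsto' h5.tendsto_sum_nat fun K => ?_
  calc ∑ n ∈ Finset.range K, y n * (inner ℂ (φ n) (X (φ n))).re
      ≤ ∑ n ∈ Finset.range K, y n * d n := by
        refine sum_mul_le_sum_mul_of_antitone hy.antitone hy.nonneg (fun p => ?_) K
        have := hx.sum_inner_le
          (hy.orthonormal.comp (fun i : Fin p => (i : ℕ)) Fin.val_injective)
        rw [Fintype.card_fin] at this
        simp only [Function.comp_apply] at this
        rw [← Finset.sum_range (fun i => (inner ℂ (φ i) (X (φ i))).re)] at this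
        exact this.trans (hX.sum_le x ψ hx p)
    _ = ∑ n ∈ Finset.range K, d n * y n := Finset.sum_congr rfl fun n _ => mul_comm _ _
    _ ≤ ∑ n ∈ Finset.range K, d n * e n :=
        sum_mul_le_sum_mul_of_antitone hX.antitone hX.nonneg (hY.sum_le y φ hy) K
    _ ≤ ∑ n ∈ Finset.range (M + 1), d n * e n := by
        have h6 : HasSum (fun n => d n * e n) _ := hasSum_of_support (M := M) fun n hn => by
          simp [hX.eq_zero_of_lt n hn]
        exact sum_le_hasSum _ (fun n _ => mul_nonneg (hX.nonneg n) (hY.nonneg n)) h6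
    _ = ∑ n ∈ Finset.range (M + 1), e n * d n := Finset.sum_congr rfl fun n _ => mul_comm _ _

end IsSubmajorized

end LossStep

/-! ### Products of many near-identity elements -/

section PowLimit

variable {R : Type*} [NormedRing R] [NormOneClass R]

theorem norm_pow_sub_pow_le {a c : R} {m : ℝ} (hm : 1 ≤ m) (ha : ‖a‖ ≤ m)
    (hc : ‖c‖ ≤ m) (n : ℕ) : ‖a ^ n - c ^ n‖ ≤ n * m ^ n * ‖a - c‖ := by
  induction n with
  | zero => simp
  | succ n ih =>
    have h1 : a ^ (n + 1) - c ^ (n + 1) = a ^ n * (a - c) + (a ^ n - c ^ n) * c := by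
      rw [pow_succ, pow_succ]; noncomm_ring
    have h2 : ‖a ^ n * (a - c)‖ ≤ m ^ n * ‖a - c‖ :=
      (norm_mul_le _ _).trans (mul_le_mul_of_nonneg_right
        ((norm_pow_le a n).trans (pow_le_pow_left₀ (norm_nonneg _) ha n)) (norm_nonneg _))
    have h3 : ‖(a ^ n - c ^ n) * c‖ ≤ n * m ^ n * ‖a - c‖ * m :=
      (norm_mul_le _ _).trans (mul_le_mul ih hc (norm_nonneg _) (by positivity))
    have h4 : m ^ n * ‖a - c‖ ≤ m ^ n * ‖a - c‖ * m :=
      le_mul_of_one_le_right (by positivity) hm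
    rw [h1]
    refine (norm_add_le _ _).trans ((add_le_add h2 h3).trans ?_)
    push_cast
    rw [pow_succ]
    linarith

/-- Two families of near-identity elements with the same generator `L` have the same limiting
`k`-th powers. -/
theorem tendsto_pow_sub_pow [NormedAlgebra ℝ R] {S B : ℕ → R} {L : R}
    (hS : Tendsto (fun k : ℕ => (k : ℝ) • (S k - 1)) atTop (𝓝 L))
    (hB : Tendsto (fun k : ℕ => (k : ℝ) • (B k - 1)) atTop (𝓝 L)) :
    Tendsto (fun k => S k ^ k - B k ^ k) atTop (𝓝 0) := by
  have bound : ∀ {F : ℕ → R}, Tendsto (fun k : ℕ => (k : ℝ) • (F k - 1)) atTop (𝓝 L) →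
      ∀ᶠ k : ℕ in atTop, ‖F k‖ ≤ 1 + (‖L‖ + 1) / k := by
    intro F hF
    filter_upwards [hF.norm.eventually (gt_mem_nhds (lt_add_one ‖L‖)), eventually_gt_atTop 0]
      with k hk h0
    have h0' : (0 : ℝ) < k := by exact_mod_cast h0
    rw [norm_smul, Real.norm_of_nonneg h0'.le] at hk
    have h1 : ‖F k - 1‖ ≤ (‖L‖ + 1) / k := by
      rw [le_div_iff₀ h0', mul_comm]; exact hk.le
    calc ‖F k‖ = ‖1 + (F k - 1)‖ := by rw [add_sub_cancel]
      _ ≤ ‖(1 : R)‖ + ‖F k - 1‖ := norm_add_le _ _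
      _ ≤ _ := by rw [norm_one]; exact add_le_add_right h1 1
  have hdiff : Tendsto (fun k : ℕ => Real.exp (‖L‖ + 1) * ‖(k : ℝ) • (S k - 1) -
      (k : ℝ) • (B k - 1)‖) atTop (𝓝 0) := by
    simpa using (hS.sub hB).norm.const_mul (Real.exp (‖L‖ + 1))
  refine squeeze_zero_norm' ?_ hdiff
  filter_upwards [bound hS, bound hB, eventually_gt_atTop 0] with k hk1 hk2 h0
  have h0' : (0 : ℝ) < k := by exact_mod_cast h0
  have hm : (1 + (‖L‖ + 1) / k) ^ k ≤ Real.exp (‖L‖ + 1) := by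
    have h1 : 1 + (‖L‖ + 1) / k ≤ Real.exp ((‖L‖ + 1) / k) := by
      rw [add_comm]; exact Real.add_one_le_exp _
    refine (pow_le_pow_left₀ (by positivity) h1 k).trans (le_of_eq ?_)
    rw [← Real.exp_nat_mul, mul_div_cancel₀ _ h0'.ne']
  refine (norm_pow_sub_pow_le (le_add_of_nonneg_right (by positivity)) hk1 hk2 k).trans ?_
  rw [← smul_sub, norm_smul, Real.norm_of_nonneg h0'.le, sub_sub_sub_cancel_right]
  calc _ = (1 + (‖L‖ + 1) / k) ^ k * (k * ‖S k - B k‖) := by ring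
    _ ≤ _ := mul_le_mul_of_nonneg_right hm (by positivity)

attribute [local instance] Matrix.linftyOpNormedRing Matrix.linftyOpNormedAlgebra
  Matrix.linfty_opNormOneClass

theorem tendsto_matrix_pow_sub_pow {ι : Type*} [Fintype ι] [DecidableEq ι] [Nonempty ι]
    {S B : ℕ → Matrix ι ι ℝ} {L : Matrix ι ι ℝ}
    (hS : ∀ p q, Tendsto (fun k : ℕ => (k : ℝ) * (S k p q - (1 : Matrix ι ι ℝ) p q)) atTop
      (𝓝 (L p q)))
    (hB : ∀ p q, Tendsto (fun k : ℕ => (k : ℝ) * (B k p q - (1 : Matrix ι ι ℝ) p q)) atTop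
      (𝓝 (L p q))) (p q : ι) :
    Tendsto (fun k => (S k ^ k) p q - (B k ^ k) p q) atTop (𝓝 0) := by
  have h := tendsto_pow_sub_pow (R := Matrix ι ι ℝ) (S := S) (B := B) (L := L)
    (tendsto_pi_nhds.2 fun p => tendsto_pi_nhds.2 fun q => hS p q)
    (tendsto_pi_nhds.2 fun p => tendsto_pi_nhds.2 fun q => hB p q)
  exact tendsto_pi_nhds.1 (tendsto_pi_nhds.1 h p) q

end PowLimit

/-! ### The attenuator -/

section Attenuator

/-- The matrix element that takes `|m⟩⟨n|` to `|s⟩⟨t|` in the attenuator of transmissivity `lam`: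
the same number `m - s = n - t` of photons is lost on both sides. -/
noncomputable def attenuator (lam : ℝ) (s t m n : ℕ) : ℝ :=
  if s ≤ m ∧ m + t = n + s then
    √((m.choose s : ℝ) * (n.choose t : ℝ)) * (1 - lam) ^ (m - s) * √lam ^ (s + t) else 0

/-- The matrix element that takes `|m⟩⟨n|` to `|s⟩⟨t|` in one step of photon loss. -/
noncomputable def lossKernel (η : ℝ) (s t m n : ℕ) : ℝ :=
  if m = s ∧ n = t then √(1 - η * s) * √(1 - η * t)
  else if m = s + 1 ∧ n = t + 1 then η * (√((s : ℝ) + 1) * √((t : ℝ) + 1)) else 0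

theorem attenuator_add (lam : ℝ) (s t l : ℕ) : attenuator lam s t (s + l) (t + l) =
    √(((s + l).choose s : ℝ) * ((t + l).choose t : ℝ)) * (1 - lam) ^ l * √lam ^ (s + t) := by
  rw [attenuator, if_pos ⟨Nat.le_add_right s l, by ring⟩, Nat.add_sub_cancel_left]

theorem attenuator_one (s t m n : ℕ) :
    attenuator 1 s t m n = if s = m ∧ t = n then 1 else 0 := by
  rw [attenuator]
  by_cases h : s ≤ m ∧ m + t = n + s
  · rw [if_pos h]
    obtain ⟨l, rfl⟩ := Nat.exists_eq_add_of_le h.1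
    obtain rfl : n = t + l := by lia
    rcases l with _ | l
    · simp
    · simp
  · rw [if_neg h, if_neg (by lia)]

/-- A loss step and an attenuator of transmissivity `1 - η` agree to first order in `η`. -/
theorem exists_hasDerivAt_attenuator (s t m n : ℕ) : ∃ D : ℝ,
    HasDerivAt (fun η => lossKernel η s t m n) D 0 ∧
      HasDerivAt (fun η => attenuator (1 - η) s t m n) D 0 := by
  by_cases h : s ≤ m ∧ m + t = n + s
  · obtain ⟨l, rfl⟩ := Nat.exists_eq_add_of_le h.1
    obtain rfl : n = t + l := by lia
    have hpow : HasDerivAt (fun η : ℝ => √(1 - η) ^ (s + t)) (-((s + t : ℕ) : ℝ) / 2) 0 := by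
      have h1 : HasDerivAt (fun η : ℝ => 1 - η) (-1) 0 := by
        simpa using (hasDerivAt_id (0 : ℝ)).const_sub 1
      refine ((h1.sqrt (by norm_num)).fun_pow (s + t)).congr_deriv ?_
      simp; ring
    simp only [attenuator_add, sub_sub_cancel]
    rcases l with _ | _ | l
    · refine ⟨-((s + t : ℕ) : ℝ) / 2, ?_, ?_⟩
      · have hs : ∀ a : ℕ, HasDerivAt (fun η : ℝ => √(1 - η * a)) (-(a : ℝ) / 2) 0 := by
          intro a
          have h1 : HasDerivAt (fun η : ℝ => 1 - η * a) (-(a : ℝ)) 0 := by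
            simpa using ((hasDerivAt_id (0 : ℝ)).mul_const (a : ℝ)).const_sub 1
          refine (h1.sqrt (by norm_num)).congr_deriv ?_
          simp
        simp only [lossKernel, add_zero, and_self, if_true]
        refine ((hs s).fun_mul (hs t)).congr_deriv ?_
        simp
        ring
      · simpa using hpow
    · refine ⟨√((s : ℝ) + 1) * √((t : ℝ) + 1), ?_, ?_⟩
      · simp only [lossKernel, zero_add]
        simpa using (hasDerivAt_id (0 : ℝ)).mul_const (√((s : ℝ) + 1) * √((t : ℝ) + 1))
      · have h4 := ((hasDerivAt_id' (0 : ℝ)).const_mul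
          (√((s : ℝ) + 1) * √((t : ℝ) + 1))).fun_mul hpow
        simp only [zero_add, Nat.choose_succ_self_right, pow_one, Nat.cast_add, Nat.cast_one,
          Real.sqrt_mul (by positivity : (0 : ℝ) ≤ s + 1)]
        refine h4.congr_deriv ?_
        simp
    · refine ⟨0, ?_, ?_⟩
      · have h5 : (fun η => lossKernel η s t (s + (l + 1 + 1)) (t + (l + 1 + 1))) = fun _ => 0 := by
          funext η
          simp [lossKernel]
        rw [h5]
        exact hasDerivAt_const _ _
      · have h4 := (((hasDerivAt_id' (0 : ℝ)).fun_pow (l + 1 + 1)).const_mul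
          (√(((s + (l + 1 + 1)).choose s : ℝ) * ((t + (l + 1 + 1)).choose t : ℝ)))).fun_mul hpow
        refine h4.congr_deriv ?_
        simp
  · refine ⟨0, ?_, ?_⟩
    · have h5 : (fun η => lossKernel η s t m n) = fun _ => 0 := by
        funext η
        rw [lossKernel, if_neg (by lia), if_neg (by lia)]
      rw [h5]
      exact hasDerivAt_const _ _
    · simp only [attenuator, if_neg h]
      exact hasDerivAt_const _ _

theorem lossKernel_zero (s t m n : ℕ) :
    lossKernel 0 s t m n = if s = m ∧ t = n then 1 else 0 := by
  simp only [lossKernel, zero_mul, sub_zero, Real.sqrt_one, mul_one, ite_self, eq_comm]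

/-- The attenuator on the span of `|0⟩, …, |M⟩`. -/
noncomputable def attenuatorMatrix (M : ℕ) (lam : ℝ) :
    Matrix (Fin (M + 1) × Fin (M + 1)) (Fin (M + 1) × Fin (M + 1)) ℝ :=
  Matrix.of fun p q => attenuator lam p.1 p.2 q.1 q.2

/-- One step of photon loss on the span of `|0⟩, …, |M⟩`. -/
noncomputable def lossMatrix (M : ℕ) (η : ℝ) :
    Matrix (Fin (M + 1) × Fin (M + 1)) (Fin (M + 1) × Fin (M + 1)) ℝ :=
  Matrix.of fun p q => lossKernel η p.1 p.2 q.1 q.2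

theorem matrix_one_apply_eq {M : ℕ} (p q : Fin (M + 1) × Fin (M + 1)) :
    (1 : Matrix (Fin (M + 1) × Fin (M + 1)) (Fin (M + 1) × Fin (M + 1)) ℝ) p q =
      if (p.1 : ℕ) = q.1 ∧ (p.2 : ℕ) = q.2 then 1 else 0 := by
  rw [Matrix.one_apply]
  simp only [Prod.ext_iff, Fin.ext_iff]

theorem attenuatorMatrix_one (M : ℕ) : attenuatorMatrix M 1 = 1 := by
  ext p q
  rw [matrix_one_apply_eq, attenuatorMatrix, Matrix.of_apply, attenuator_one]

/-- Attenuators form a semigroup. -/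
theorem attenuatorMatrix_mul (M : ℕ) {lam μ : ℝ} (hlam : 0 ≤ lam) (hμ : 0 ≤ μ) :
    attenuatorMatrix M lam * attenuatorMatrix M μ = attenuatorMatrix M (lam * μ) := by
  ext ⟨⟨s, hs⟩, ⟨t, ht⟩⟩ ⟨⟨m, hm⟩, ⟨n, hn⟩⟩
  simp only [Matrix.mul_apply, attenuatorMatrix, Matrix.of_apply]
  by_cases h : s ≤ m ∧ m + t = n + s
  · obtain ⟨L, rfl⟩ := Nat.exists_eq_add_of_le h.1
    obtain rfl : n = t + L := by lia
    rw [attenuator_add]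
    let e : ℕ → Fin (M + 1) × Fin (M + 1) := fun l =>
      (Fin.ofNat (M + 1) (s + l), Fin.ofNat (M + 1) (t + l))
    have he : ∀ l ∈ Finset.range (L + 1), ((e l).1 : ℕ) = s + l ∧ ((e l).2 : ℕ) = t + l := by
      intro l hl
      have := Finset.mem_range.1 hl
      exact ⟨Nat.mod_eq_of_lt (by lia), Nat.mod_eq_of_lt (by lia)⟩
    have hterm : ∀ l ∈ Finset.range (L + 1),
        √(((s + L).choose s : ℝ) * ((t + L).choose t : ℝ)) * √(lam * μ) ^ (s + t) *
          ((((1 - lam) * μ) ^ l * (1 - μ) ^ (L - l)) * (L.choose l : ℝ)) =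
        attenuator lam s t (e l).1 (e l).2 * attenuator μ (e l).1 (e l).2 (s + L) (t + L) := by
      intro l hl
      obtain ⟨h1, h2⟩ := he l hl
      obtain ⟨j, rfl⟩ := Nat.exists_eq_add_of_le (Nat.lt_succ_iff.1 (Finset.mem_range.1 hl))
      rw [h1, h2, attenuator_add, ← add_assoc s, ← add_assoc t, attenuator_add,
        Nat.add_sub_cancel_left]
      have hc : ∀ a : ℕ, ((a + l).choose a : ℝ) * ((a + l + j).choose (a + l) : ℝ) =
          ((a + l + j).choose a : ℝ) * ((l + j).choose l : ℝ) := by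
        intro a
        have := Nat.choose_mul (n := a + l + j) (k := a + l) (s := a) (by lia)
        rw [show a + l + j - a = l + j by lia, show a + l - a = l by lia] at this
        rw [mul_comm]
        exact_mod_cast this
      have hsq : √(((s + l).choose s : ℝ) * ((t + l).choose t : ℝ)) *
          √(((s + l + j).choose (s + l) : ℝ) * ((t + l + j).choose (t + l) : ℝ)) =
          √(((s + l + j).choose s : ℝ) * ((t + l + j).choose t : ℝ)) * ((l + j).choose l : ℝ) := by
        rw [← Real.sqrt_mul (by positivity),
          show ((s + l).choose s : ℝ) * ((t + l).choose t : ℝ) *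
            (((s + l + j).choose (s + l) : ℝ) * ((t + l + j).choose (t + l) : ℝ)) =
            (((s + l).choose s : ℝ) * ((s + l + j).choose (s + l) : ℝ)) *
            (((t + l).choose t : ℝ) * ((t + l + j).choose (t + l) : ℝ)) by ring, hc, hc,
          show ((s + l + j).choose s : ℝ) * ((l + j).choose l : ℝ) *
            (((t + l + j).choose t : ℝ) * ((l + j).choose l : ℝ)) =
            (((s + l + j).choose s : ℝ) * ((t + l + j).choose t : ℝ)) *
              ((l + j).choose l : ℝ) ^ 2 by ring,
          Real.sqrt_mul (by positivity), Real.sqrt_sq (by positivity)]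
      have hμl : √μ ^ (s + l + (t + l)) = √μ ^ (s + t) * μ ^ l := by
        rw [show s + l + (t + l) = s + t + 2 * l by ring, pow_add, pow_mul, Real.sq_sqrt hμ]
      rw [hμl, Real.sqrt_mul hlam, mul_pow, mul_pow]
      linear_combination -(√lam ^ (s + t) * √μ ^ (s + t) * (1 - lam) ^ l * μ ^ l * (1 - μ) ^ j) *
        hsq
    rw [← Finset.sum_of_injOn e (s := Finset.range (L + 1)) ?_ (fun _ _ => Finset.mem_univ _) ?_
      hterm]
    · rw [← Finset.mul_sum, ← add_pow]
      ring
    · intro l hl l' hl' hll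
      have h1 := (he l (by simpa using hl)).1
      have h2 := (he l' (by simpa using hl')).1
      rw [hll] at h1
      lia
    · rintro ⟨⟨u, hu⟩, ⟨v, hv⟩⟩ - hnot
      simp only [attenuator]
      by_cases h1 : s ≤ u ∧ u + t = v + s
      · by_cases h2 : u ≤ s + L ∧ s + L + v = t + L + u
        · exfalso
          obtain ⟨l, rfl⟩ := Nat.exists_eq_add_of_le h1.1
          obtain rfl : v = t + l := by lia
          refine hnot ⟨l, by simp; lia, ?_⟩
          have := he l (by simp; lia)
          exact Prod.ext (Fin.ext this.1) (Fin.ext this.2)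
        · rw [if_neg h2, mul_zero]
      · rw [if_neg h1, zero_mul]
  · rw [attenuator, if_neg h]
    refine Finset.sum_eq_zero fun p _ => ?_
    simp only [attenuator]
    by_cases h1 : s ≤ (p.1 : ℕ) ∧ (p.1 : ℕ) + t = p.2 + s
    · rw [if_neg (show ¬((p.1 : ℕ) ≤ m ∧ m + (p.2 : ℕ) = n + p.1) by lia), mul_zero]
    · rw [if_neg h1, zero_mul]

theorem attenuatorMatrix_pow (M : ℕ) {lam : ℝ} (hlam : 0 ≤ lam) (k : ℕ) :
    attenuatorMatrix M lam ^ k = attenuatorMatrix M (lam ^ k) := by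
  induction k with
  | zero => rw [pow_zero, pow_zero, attenuatorMatrix_one]
  | succ k ih => rw [pow_succ, ih, attenuatorMatrix_mul M (by positivity) hlam, pow_succ]

theorem tendsto_nat_mul_sub {g : ℝ → ℝ} {D : ℝ} (h : HasDerivAt g D 0) :
    Tendsto (fun k : ℕ => (k : ℝ) * (g (1 / k) - g 0)) atTop (𝓝 D) := by
  have h1 := (hasDerivAt_iff_tendsto_slope_zero.1 h)
  have h2 : Tendsto (fun k : ℕ => (1 / (k : ℝ))) atTop (𝓝[≠] 0) := by
    refine tendsto_nhdsWithin_iff.2 ⟨tendsto_one_div_atTop_nhds_zero_nat, ?_⟩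
    filter_upwards [eventually_gt_atTop 0] with k hk
    simpa using hk.ne'
  refine (h1.comp h2).congr fun k => ?_
  simp

/-- The attenuator of transmissivity `lam > 0` is the limit of `k` loss steps with loss probability
`1 - lam ^ (1 / k)`. -/
theorem tendsto_lossMatrix_pow (M : ℕ) {lam : ℝ} (hlam : 0 < lam)
    (p q : Fin (M + 1) × Fin (M + 1)) :
    Tendsto (fun k : ℕ => (lossMatrix M (1 - Real.exp (Real.log lam * (1 / k))) ^ k) p q) atTop
      (𝓝 (attenuatorMatrix M lam p q)) := by
  let c := Real.log lam
  have hη : HasDerivAt (fun h : ℝ => 1 - Real.exp (c * h)) (-c) 0 := by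
    have h1 : HasDerivAt (fun h : ℝ => c * h) c 0 := by
      simpa using (hasDerivAt_id (0 : ℝ)).const_mul c
    simpa using h1.exp.const_sub 1
  have h0 : (1 : ℝ) - Real.exp (c * 0) = 0 := by simp
  have hη' : ∀ {g : ℝ → ℝ} {D : ℝ}, HasDerivAt g D 0 →
      HasDerivAt (fun h : ℝ => g (1 - Real.exp (c * h))) (D * (-c)) 0 := by
    intro g D hg
    exact HasDerivAt.comp (0 : ℝ) (h₂ := g) (by rwa [h0]) hη
  choose D hD1 hD2 using exists_hasDerivAt_attenuator
  have key := tendsto_matrix_pow_sub_pow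
    (S := fun k : ℕ => lossMatrix M (1 - Real.exp (c * (1 / k))))
    (B := fun k : ℕ => attenuatorMatrix M (Real.exp (c * (1 / k))))
    (L := Matrix.of fun p q => D p.1 p.2 q.1 q.2 * (-c)) ?_ ?_ p q
  · have hB : ∀ᶠ k : ℕ in atTop, attenuatorMatrix M (Real.exp (c * (1 / k))) ^ k =
        attenuatorMatrix M lam := by
      filter_upwards [eventually_gt_atTop 0] with k hk
      have hk' : (k : ℝ) ≠ 0 := by exact_mod_cast hk.ne'
      rw [attenuatorMatrix_pow M (Real.exp_pos _).le, ← Real.exp_nat_mul,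
        show (k : ℝ) * (c * (1 / k)) = c by field_simp, Real.exp_log hlam]
    have h2 : Tendsto (fun k : ℕ => (attenuatorMatrix M (Real.exp (c * (1 / k))) ^ k) p q) atTop
        (𝓝 (attenuatorMatrix M lam p q)) :=
      tendsto_const_nhds.congr' (hB.mono fun k hk => congrFun (congrFun hk.symm p) q)
    simpa using key.add h2
  · intro p q
    have := tendsto_nat_mul_sub (hη' (hD1 p.1 p.2 q.1 q.2))
    simpa only [mul_zero, Real.exp_zero, sub_self, lossKernel_zero, ← matrix_one_apply_eq,
      lossMatrix, Matrix.of_apply] using this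
  · intro p q
    have := tendsto_nat_mul_sub (hη' (hD2 p.1 p.2 q.1 q.2))
    simpa only [mul_zero, Real.exp_zero, sub_self, sub_zero, sub_sub_cancel, attenuator_one,
      ← matrix_one_apply_eq, attenuatorMatrix, Matrix.of_apply] using this

end Attenuator

section AttenuatorInequality

/-- The action of a real matrix on the matrix elements of an operator on the span of
`|0⟩, …, |M⟩`. -/
noncomputable def kernelAction {ι : Type*} [Fintype ι] (A : Matrix ι ι ℝ) (v : ι → ℂ) (p : ι) : ℂ :=
  ∑ q, (A p q : ℂ) * v q

theorem kernelAction_mul {ι : Type*} [Fintype ι] (A B : Matrix ι ι ℝ) (v : ι → ℂ) :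
    kernelAction (A * B) v = kernelAction A (kernelAction B v) := by
  funext p
  simp only [kernelAction, Matrix.mul_apply, Complex.ofReal_sum, Finset.sum_mul, Finset.mul_sum,
    Complex.ofReal_mul]
  rw [Finset.sum_comm]
  exact Finset.sum_congr rfl fun _ _ => Finset.sum_congr rfl fun _ _ => mul_assoc _ _ _

theorem kernelAction_one {ι : Type*} [Fintype ι] [DecidableEq ι] (v : ι → ℂ) :
    kernelAction 1 v = v := by
  funext p
  rw [kernelAction, Finset.sum_eq_single p]
  · simp
  · intro q _ hq
    simp [Matrix.one_apply_ne hq.symm]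
  · simp

theorem kernelAction_lossMatrix (M : ℕ) (η : ℝ) (F : ℕ → ℕ → ℂ) (p : Fin (M + 1) × Fin (M + 1)) :
    kernelAction (lossMatrix M η) (fun q => F q.1 q.2) p =
      (√(1 - η * (p.1 : ℕ)) * √(1 - η * (p.2 : ℕ)) : ℝ) * F p.1 p.2 +
      if (p.1 : ℕ) < M ∧ (p.2 : ℕ) < M then
        (η * (√(((p.1 : ℕ) : ℝ) + 1) * √(((p.2 : ℕ) : ℝ) + 1)) : ℝ) * F (p.1 + 1) (p.2 + 1)
      else 0 := by
  obtain ⟨⟨s, hs⟩, ⟨t, ht⟩⟩ := p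
  have hsplit : ∀ q : Fin (M + 1) × Fin (M + 1),
      (lossMatrix M η (⟨s, hs⟩, ⟨t, ht⟩) q : ℂ) * F q.1 q.2 =
        (if q = (⟨s, hs⟩, ⟨t, ht⟩) then
          ((√(1 - η * s) * √(1 - η * t) : ℝ) : ℂ) * F s t else 0) +
        (if (q.1 : ℕ) = s + 1 ∧ (q.2 : ℕ) = t + 1 then
          ((η * (√((s : ℝ) + 1) * √((t : ℝ) + 1)) : ℝ) : ℂ) * F (s + 1) (t + 1) else 0) := by
    rintro ⟨⟨m, hm⟩, ⟨n, hn⟩⟩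
    simp only [lossMatrix, Matrix.of_apply, lossKernel, Prod.mk.injEq, Fin.mk.injEq]
    by_cases h1 : m = s ∧ n = t
    · obtain ⟨rfl, rfl⟩ := h1
      simp
    · by_cases h2 : m = s + 1 ∧ n = t + 1
      · obtain ⟨rfl, rfl⟩ := h2
        simp
      · simp [h1, h2]
  simp only [kernelAction, hsplit, Finset.sum_add_distrib, Finset.sum_ite_eq', Finset.mem_univ,
    if_true]
  congr 1
  split_ifs with h
  · rw [Finset.sum_eq_single (⟨s + 1, by lia⟩, ⟨t + 1, by lia⟩)]
    · simp
    · rintro ⟨⟨m, hm⟩, ⟨n, hn⟩⟩ - hne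
      rw [if_neg]
      rintro ⟨h1, h2⟩
      exact hne (Prod.ext (Fin.ext h1) (Fin.ext h2))
    · intro hx
      exact absurd (Finset.mem_univ _) hx
  · refine Finset.sum_eq_zero ?_
    rintro ⟨⟨m, hm⟩, ⟨n, hn⟩⟩ -
    rw [if_neg]
    rintro ⟨h1, h2⟩
    simp only at h1 h2
    exact h ⟨by lia, by lia⟩

/-- The matrix elements of the diagonal operator with diagonal `d`. -/
noncomputable def diagonalElements (M : ℕ) (d : ℕ → ℝ) (p : Fin (M + 1) × Fin (M + 1)) : ℂ :=
  if (p.1 : ℕ) = p.2 then (d p.1 : ℂ) else 0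

theorem kernelAction_diagonalElements {M : ℕ} {η : ℝ} (hη : η * (M + 1) ≤ 1)
    {d : ℕ → ℝ} (hd : ∀ n, M < n → d n = 0) :
    kernelAction (lossMatrix M η) (diagonalElements M d) =
      diagonalElements M (lossStepDiagonal η d) := by
  funext p
  have h1 := kernelAction_lossMatrix M η (fun m n => if m = n then (d m : ℂ) else 0) p
  refine h1.trans ?_
  obtain ⟨⟨s, hs⟩, ⟨t, ht⟩⟩ := p
  simp only [diagonalElements, lossStepDiagonal, Nat.add_right_cancel_iff]
  by_cases hst : s = t
  · subst hst
    have hs' : (s : ℝ) ≤ M := by exact_mod_cast Nat.lt_succ_iff.1 hs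
    have h2 : 0 ≤ 1 - η * s := by
      have hs0 : (0 : ℝ) ≤ s := Nat.cast_nonneg s
      rcases le_total 0 η with h | h <;> nlinarith
    rw [Real.mul_self_sqrt h2, Real.mul_self_sqrt (by positivity)]
    by_cases h3 : s < M
    · simp [h3]
    · rw [hd (s + 1) (by lia)]
      simp [h3]
  · simp [hst]

variable {H : Type*} [NormedAddCommGroup H] [InnerProductSpace ℂ H]

/-- The matrix elements of an operator between the Fock states `|0⟩, …, |M⟩`. -/
noncomputable def matrixElements (b : HilbertBasis ℕ ℂ H) (M : ℕ) (X : H →L[ℂ] H)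
    (p : Fin (M + 1) × Fin (M + 1)) : ℂ :=
  inner ℂ (b p.1) (X (b p.2))

theorem damping_apply (b : HilbertBasis ℕ ℂ H) {M s : ℕ} (hs : s < M + 1) (η : ℝ) :
    damping b M η (b s) = ((√(1 - η * s) : ℝ) : ℂ) • b s := by
  refine eq_of_inner_basis b fun i => ?_
  rw [inner_damping, inner_smul_right, orthonormal_iff_ite.1 b.orthonormal]
  by_cases h : i = s
  · subst h; simp [hs]
  · simp [h]

variable [CompleteSpace H]

theorem adjoint_lowering_apply (b : HilbertBasis ℕ ℂ H) (M s : ℕ) :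
    ContinuousLinearMap.adjoint (lowering b M) (b s) =
      if s < M then ((√((s : ℝ) + 1) : ℝ) : ℂ) • b (s + 1) else 0 := by
  refine eq_of_inner_basis b fun i => ?_
  rw [inner_adjoint_lowering, orthonormal_iff_ite.1 b.orthonormal]
  simp only [apply_ite (inner ℂ (b i)), inner_smul_right, orthonormal_iff_ite.1 b.orthonormal,
    inner_zero_right]
  rcases i with _ | i
  · simp
  · simp only [Nat.add_sub_cancel, Nat.add_lt_add_iff_right, Nat.add_right_cancel_iff]
    by_cases h : i = s
    · subst h; simp
    · simp [h]

theorem matrixElements_lossStep (b : HilbertBasis ℕ ℂ H) (M : ℕ) (η : ℝ) (X : H →L[ℂ] H) :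
    matrixElements b M (lossStep b M η X) =
      kernelAction (lossMatrix M η) (matrixElements b M X) := by
  funext p
  refine Eq.trans ?_ (kernelAction_lossMatrix M η (fun m n => inner ℂ (b m) (X (b n))) p).symm
  obtain ⟨⟨s, hs⟩, ⟨t, ht⟩⟩ := p
  rw [matrixElements, inner_lossStep]
  simp only
  rw [damping_apply b hs, damping_apply b ht, adjoint_lowering_apply, adjoint_lowering_apply]
  congr 1
  · rw [map_smul, inner_smul_left, inner_smul_right, Complex.conj_ofReal]
    push_cast; ring
  · by_cases h1 : s < M
    · by_cases h2 : t < M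
      · simp only [h1, h2, if_true, and_self, map_smul, inner_smul_left, inner_smul_right,
          Complex.conj_ofReal]
        push_cast; ring
      · simp [h2]
    · simp [h1]

theorem matrixElements_lossStep_iterate (b : HilbertBasis ℕ ℂ H) (M : ℕ) (η : ℝ) (X : H →L[ℂ] H)
    (k : ℕ) : matrixElements b M ((lossStep b M η)^[k] X) =
      kernelAction (lossMatrix M η ^ k) (matrixElements b M X) := by
  induction k with
  | zero => rw [pow_zero, kernelAction_one]; rfl
  | succ k ih =>
    rw [Function.iterate_succ_apply', matrixElements_lossStep, ih, pow_succ', kernelAction_mul]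

theorem IsSubmajorized.diagonalElements_iterate {b : HilbertBasis ℕ ℂ H} {M : ℕ} {X : H →L[ℂ] H}
    {d : ℕ → ℝ} (h : IsSubmajorized b M X d) {η : ℝ} (hη0 : 0 ≤ η) (hη : η * (M + 1) ≤ 1) (k : ℕ) :
    diagonalElements M ((lossStepDiagonal η)^[k] d) =
      kernelAction (lossMatrix M η ^ k) (diagonalElements M d) := by
  induction k with
  | zero => rw [pow_zero, kernelAction_one]; rfl
  | succ k ih =>
    rw [Function.iterate_succ_apply', pow_succ', kernelAction_mul, ← ih,
      kernelAction_diagonalElements hη (h.lossStep_iterate hη0 hη k).eq_zero_of_lt]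

/-- The pairing `Tr (Y† X)` of matrix elements. -/
noncomputable def hsPairing {ι : Type*} [Fintype ι] (y x : ι → ℂ) : ℝ :=
  (∑ p, starRingEnd ℂ (y p) * x p).re

/-- Von Neumann's trace inequality, in terms of matrix elements. -/
theorem IsSubmajorized.hsPairing_le {b : HilbertBasis ℕ ℂ H} {M : ℕ} {X Y : H →L[ℂ] H}
    {d e : ℕ → ℝ} (hY : IsSubmajorized b M Y e) (hX : IsSubmajorized b M X d) :
    hsPairing (matrixElements b M Y) (matrixElements b M X) ≤
      hsPairing (diagonalElements M e) (diagonalElements M d) := by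
  have h := hY.sum_inner_mul_inner_le hX
  convert h using 1
  · rw [hsPairing, Fintype.sum_prod_type_right, Finset.sum_range]
    congr 1
    refine Finset.sum_congr rfl fun j _ => ?_
    rw [Finset.sum_range]
    refine Finset.sum_congr rfl fun i _ => ?_
    simp only [matrixElements]
    rw [inner_conj_symm, hY.isPositive.inner_left_eq_inner_right]
  · rw [hsPairing, Fintype.sum_prod_type, Finset.sum_range, Complex.re_sum]
    refine Finset.sum_congr rfl fun i _ => ?_
    rw [Finset.sum_eq_single i]
    · simp [diagonalElements]
    · intro j _ hji
      simp [diagonalElements, Fin.val_inj, Ne.symm hji]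
    · simp

theorem tendsto_hsPairing_kernelAction {ι α : Type*} [Fintype ι] {l : Filter α}
    {A B : α → Matrix ι ι ℝ} {A' B' : Matrix ι ι ℝ}
    (hA : ∀ p q, Tendsto (fun k => A k p q) l (𝓝 (A' p q)))
    (hB : ∀ p q, Tendsto (fun k => B k p q) l (𝓝 (B' p q))) (y x : ι → ℂ) :
    Tendsto (fun k => hsPairing (kernelAction (A k) y) (kernelAction (B k) x)) l
      (𝓝 (hsPairing (kernelAction A' y) (kernelAction B' x))) := by
  have hact : ∀ {A : α → Matrix ι ι ℝ} {A' : Matrix ι ι ℝ},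
      (∀ p q, Tendsto (fun k => A k p q) l (𝓝 (A' p q))) → ∀ (v : ι → ℂ) p,
      Tendsto (fun k => kernelAction (A k) v p) l (𝓝 (kernelAction A' v p)) := fun h v p =>
    tendsto_finsetSum _ fun q _ =>
      ((Complex.continuous_ofReal.tendsto _).comp (h p q)).mul_const (v q)
  refine (Complex.continuous_re.tendsto _).comp (tendsto_finsetSum _ fun p _ => ?_)
  exact ((Complex.continuous_conj.tendsto _).comp (hact hA y p)).mul (hact hB x p)

theorem IsSubmajorized.hsPairing_attenuator_le_of_pos {b : HilbertBasis ℕ ℂ H} {M : ℕ}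
    {X Y : H →L[ℂ] H} {d e : ℕ → ℝ} (hY : IsSubmajorized b M Y e) (hX : IsSubmajorized b M X d)
    {lam μ : ℝ} (hlam : 0 < lam) (hlam1 : lam ≤ 1) (hμ : 0 < μ) (hμ1 : μ ≤ 1) :
    hsPairing (kernelAction (attenuatorMatrix M μ) (matrixElements b M Y))
        (kernelAction (attenuatorMatrix M lam) (matrixElements b M X)) ≤
      hsPairing (kernelAction (attenuatorMatrix M μ) (diagonalElements M e))
        (kernelAction (attenuatorMatrix M lam) (diagonalElements M d)) := by
  let η : ℝ → ℕ → ℝ := fun c k => 1 - Real.exp (Real.log c * (1 / k))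
  have hη0 : ∀ {c : ℝ}, 0 < c → c ≤ 1 → ∀ k, 0 ≤ η c k := by
    intro c hc hc1 k
    have h1 : Real.log c * (1 / k) ≤ 0 :=
      mul_nonpos_of_nonpos_of_nonneg (Real.log_nonpos hc.le hc1) (by positivity)
    exact sub_nonneg.2 (Real.exp_le_one_iff.2 h1)
  have hη : ∀ c : ℝ, ∀ᶠ k : ℕ in atTop, η c k * (M + 1) ≤ 1 := by
    intro c
    have h1 : Tendsto (fun k : ℕ => η c k * (M + 1)) atTop
        (𝓝 ((1 - Real.exp (Real.log c * 0)) * (M + 1))) :=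
      (((Real.continuous_exp.tendsto _).comp
        (tendsto_one_div_atTop_nhds_zero_nat.const_mul (Real.log c))).const_sub 1).mul_const _
    rw [mul_zero, Real.exp_zero, sub_self, zero_mul] at h1
    exact (h1.eventually (gt_mem_nhds one_pos)).mono fun k hk => hk.le
  refine le_of_tendsto_of_tendsto
    (tendsto_hsPairing_kernelAction (tendsto_lossMatrix_pow M hμ) (tendsto_lossMatrix_pow M hlam)
      _ _)
    (tendsto_hsPairing_kernelAction (tendsto_lossMatrix_pow M hμ) (tendsto_lossMatrix_pow M hlam)
      _ _) ?_
  filter_upwards [hη lam, hη μ] with k hk1 hk2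
  have hl0 := hη0 hlam hlam1 k
  have hm0 := hη0 hμ hμ1 k
  have h := (hY.lossStep_iterate hm0 hk2 k).hsPairing_le (hX.lossStep_iterate hl0 hk1 k)
  rwa [matrixElements_lossStep_iterate, matrixElements_lossStep_iterate,
    hY.diagonalElements_iterate hm0 hk2, hX.diagonalElements_iterate hl0 hk1] at h

theorem tendsto_attenuatorMatrix (M : ℕ) {lam : ℝ} (hlam : 0 ≤ lam)
    (p q : Fin (M + 1) × Fin (M + 1)) :
    Tendsto (fun k : ℕ => attenuatorMatrix M (max lam (1 / ((k : ℝ) + 1))) p q) atTop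
      (𝓝 (attenuatorMatrix M lam p q)) := by
  have h1 : Tendsto (fun k : ℕ => max lam (1 / ((k : ℝ) + 1))) atTop (𝓝 lam) := by
    have := (tendsto_const_nhds (x := lam)).max (tendsto_one_div_add_atTop_nhds_zero_nat (𝕜 := ℝ))
    rwa [max_eq_left hlam] at this
  have h2 : Continuous fun lam => attenuatorMatrix M lam p q := by
    simp only [attenuatorMatrix, Matrix.of_apply, attenuator]
    split_ifs
    · fun_prop
    · exact continuous_const
  exact (h2.tendsto lam).comp h1

/-- Fock optimality of attenuators: if the operators `X`, `Y` are weakly sub-majorized by decreasing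
sequences `d`, `e`, then `Tr (𝓔_μ(Y) 𝓔_λ(X))` is largest when `X` and `Y` are diagonal with
diagonals `d` and `e`. -/
theorem IsSubmajorized.hsPairing_attenuator_le {b : HilbertBasis ℕ ℂ H} {M : ℕ} {X Y : H →L[ℂ] H}
    {d e : ℕ → ℝ} (hY : IsSubmajorized b M Y e) (hX : IsSubmajorized b M X d) {lam μ : ℝ}
    (hlam : 0 ≤ lam) (hlam1 : lam ≤ 1) (hμ : 0 ≤ μ) (hμ1 : μ ≤ 1) :
    hsPairing (kernelAction (attenuatorMatrix M μ) (matrixElements b M Y))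
        (kernelAction (attenuatorMatrix M lam) (matrixElements b M X)) ≤
      hsPairing (kernelAction (attenuatorMatrix M μ) (diagonalElements M e))
        (kernelAction (attenuatorMatrix M lam) (diagonalElements M d)) := by
  refine le_of_tendsto_of_tendsto'
    (tendsto_hsPairing_kernelAction (tendsto_attenuatorMatrix M hμ)
      (tendsto_attenuatorMatrix M hlam) _ _)
    (tendsto_hsPairing_kernelAction (tendsto_attenuatorMatrix M hμ)
      (tendsto_attenuatorMatrix M hlam) _ _) fun k => ?_
  have hk : (0 : ℝ) < 1 / ((k : ℝ) + 1) := by positivity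
  have hk1 : 1 / ((k : ℝ) + 1) ≤ 1 := by
    rw [div_le_one (by positivity)]
    exact le_add_of_nonneg_left (Nat.cast_nonneg k)
  exact hY.hsPairing_attenuator_le_of_pos hX (lt_max_of_lt_right hk) (max_le hlam1 hk1)
    (lt_max_of_lt_right hk) (max_le hμ1 hk1)

end AttenuatorInequality

/-! ### Power series -/

/-- Shifting the summands of a series. -/
theorem hasSum_shift {f : ℕ → ℂ} {s : ℂ} (h : HasSum f s) (i : ℕ) :
    HasSum (fun j => if i ≤ j then f (j - i) else 0) s := by
  have hinj : Function.Injective fun a : ℕ => a + i := add_left_injective i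
  refine (hinj.hasSum_iff fun j hj => ?_).1 ?_
  · rw [if_neg]
    intro hij
    exact hj ⟨j - i, Nat.sub_add_cancel hij⟩
  · refine h.congr_fun fun a => ?_
    simp

/-- A power series with value zero on an interval `(0, r)` has zero coefficients. -/
theorem coeff_eq_zero_of_hasSum {c : ℕ → ℂ} {r : ℝ} (hr : 0 < r)
    (h : ∀ x : ℝ, 0 < x → x < r → HasSum (fun j => c j * (x : ℂ) ^ j) 0) (j : ℕ) : c j = 0 := by
  induction j using Nat.strong_induction_on with
  | _ j ih =>
    have key : ∀ x : ℝ, 0 < x → x < r → HasSum (fun m => c (j + m) * (x : ℂ) ^ m) 0 := by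
      intro x hx hxr
      have h1 := (hasSum_nat_add_iff' j).2 (h x hx hxr)
      rw [Finset.sum_eq_zero fun i hi => by rw [ih i (Finset.mem_range.1 hi), zero_mul],
        sub_zero] at h1
      have hx0 : (x : ℂ) ^ j ≠ 0 := pow_ne_zero _ (Complex.ofReal_ne_zero.2 hx.ne')
      have h2 := h1.mul_left ((x : ℂ) ^ j)⁻¹
      rw [mul_zero] at h2
      refine h2.congr_fun fun m => ?_
      rw [pow_add, add_comm m j]
      field_simp
    have hρ : 0 < r / 2 := by positivity
    have hs : Summable fun m => ‖c (j + (m + 1))‖ * (r / 2) ^ m := by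
      have h1 := ((summable_nat_add_iff 1).2 (key (r / 2) hρ (by linarith)).summable).norm
      refine (h1.mul_left (r / 2)⁻¹).congr fun m => ?_
      rw [norm_mul, norm_pow, Complex.norm_real, Real.norm_of_nonneg hρ.le, pow_succ]
      field_simp
    have hle : ∀ x : ℝ, 0 < x → x < r / 2 →
        ‖c j‖ ≤ x * ∑' m, ‖c (j + (m + 1))‖ * (r / 2) ^ m := by
      intro x hx hxr
      have h1 := (hasSum_nat_add_iff' 1).2 (key x hx (by linarith))
      simp only [Finset.range_one, Finset.sum_singleton, add_zero, pow_zero, mul_one,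
        zero_sub] at h1
      rw [← norm_neg]
      refine h1.norm_le_of_bounded (hs.hasSum.mul_left x) fun m => ?_
      rw [norm_mul, norm_pow, Complex.norm_real, Real.norm_of_nonneg hx.le, pow_succ]
      have : x ^ m ≤ (r / 2) ^ m := pow_le_pow_left₀ hx.le hxr.le m
      calc ‖c (j + (m + 1))‖ * (x ^ m * x) ≤ ‖c (j + (m + 1))‖ * ((r / 2) ^ m * x) := by gcongr
        _ = _ := by ring
    have hlim : Tendsto (fun x : ℝ => x * ∑' m, ‖c (j + (m + 1))‖ * (r / 2) ^ m) (𝓝[>] 0)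
        (𝓝 0) := by
      have : Tendsto (fun x : ℝ => x * ∑' m, ‖c (j + (m + 1))‖ * (r / 2) ^ m) (𝓝 0)
        (𝓝 (0 * _)) := tendsto_id.mul_const _
      rw [zero_mul] at this
      exact this.mono_left nhdsWithin_le_nhds
    have : ‖c j‖ ≤ 0 := by
      refine ge_of_tendsto hlim ?_
      filter_upwards [Ioo_mem_nhdsGT hρ] with x hx
      exact hle x hx.1 hx.2
    exact norm_le_zero_iff.1 this

theorem coeff_eq_of_hasSum {c c' : ℕ → ℂ} {r : ℝ} (hr : 0 < r) {F : ℝ → ℂ}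
    (h : ∀ x : ℝ, 0 < x → x < r → HasSum (fun j => c j * (x : ℂ) ^ j) (F x))
    (h' : ∀ x : ℝ, 0 < x → x < r → HasSum (fun j => c' j * (x : ℂ) ^ j) (F x)) (j : ℕ) :
    c j = c' j := by
  refine sub_eq_zero.1 (coeff_eq_zero_of_hasSum (c := fun j => c j - c' j) hr
    (fun x hx hxr => ?_) j)
  have := (h x hx hxr).sub (h' x hx hxr)
  rw [sub_self] at this
  exact this.congr_fun fun j => sub_mul _ _ _

/-! ### Matrix elements of the Weyl operators -/

section Weyl

/-- The complex amplitude `ξ` of the displacement `exp(i k · R) = exp(ξ a† - ξ̄ a)`. -/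
noncomputable def displacement (k : Fin 2 → ℝ) : ℂ :=
  (-(k 1 : ℂ) + Complex.I * (k 0 : ℂ)) / ((Real.sqrt 2 : ℝ) : ℂ)

/-- The generator `ξ a† - ξ̄ a` on finite combinations of Fock states. -/
noncomputable def displacementGenerator (ξ : ℂ) : FiniteStates →ₗ[ℂ] FiniteStates :=
  ξ • creation - (starRingEnd ℂ ξ) • annihilation

theorem I_smul_quadratureCombination (k : Fin 2 → ℝ) :
    Complex.I • quadratureCombination k = displacementGenerator (displacement k) := by
  have h2 : ((Real.sqrt 2 : ℝ) : ℂ) ≠ 0 :=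
    Complex.ofReal_ne_zero.2 (Real.sqrt_ne_zero'.2 two_pos)
  have hI := Complex.I_ne_zero
  have hII : Complex.I * Complex.I = -1 := Complex.I_mul_I
  have hc : (starRingEnd ℂ) (displacement k) =
      (-(k 1 : ℂ) - Complex.I * (k 0 : ℂ)) / ((Real.sqrt 2 : ℝ) : ℂ) := by
    simp [displacement, map_div₀, sub_eq_add_neg]
  rw [displacementGenerator, hc, displacement, quadratureCombination, quadratureQ, quadratureP]
  simp only [smul_add, smul_smul]
  have e1 : Complex.I * ((k 0 : ℂ) * ((Real.sqrt 2 : ℝ) : ℂ)⁻¹) =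
      Complex.I * (k 0 : ℂ) / ((Real.sqrt 2 : ℝ) : ℂ) := by ring
  have e2 : Complex.I * ((k 1 : ℂ) * (Complex.I * ((Real.sqrt 2 : ℝ) : ℂ))⁻¹) =
      (k 1 : ℂ) / ((Real.sqrt 2 : ℝ) : ℂ) := by field_simp
  rw [e1, e2, add_div, sub_div, neg_div]
  module

variable (ξ : ℂ)

theorem displacementGenerator_single (n : ℕ) :
    displacementGenerator ξ (Finsupp.single n 1) =
      (ξ * (Real.sqrt ((n : ℝ) + 1) : ℝ)) • Finsupp.single (n + 1) 1 -
        (starRingEnd ℂ ξ * (Real.sqrt n : ℝ)) • Finsupp.single (n - 1) 1 := by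
  simp [displacementGenerator, creation, annihilation, mul_comm]

/-- The summands of the exponential series of `ξ a† - ξ̄ a` on a Fock state. -/
noncomputable def weylTerm {H : Type*} [NormedAddCommGroup H] [InnerProductSpace ℂ H]
    (b : HilbertBasis ℕ ℂ H) (ξ : ℂ) (n l : ℕ) : H :=
  ((l.factorial : ℂ)⁻¹) •
    finiteStatesToHilbert b ((displacementGenerator ξ ^ l) (Finsupp.single n 1))

variable {H : Type*} [NormedAddCommGroup H] [InnerProductSpace ℂ H] (b : HilbertBasis ℕ ℂ H)

theorem finiteStatesToHilbert_single (n : ℕ) :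
    finiteStatesToHilbert b (Finsupp.single n 1) = b n := by
  simp [finiteStatesToHilbert]

theorem norm_displacementGenerator_pow_le (l : ℕ) : ∀ n : ℕ,
    ‖finiteStatesToHilbert b ((displacementGenerator ξ ^ l) (Finsupp.single n 1))‖ ≤
      (2 * ‖ξ‖) ^ l * Real.sqrt ((n + 1).ascFactorial l) := by
  induction l with
  | zero =>
    intro n
    simp [finiteStatesToHilbert_single, b.orthonormal.1 n]
  | succ l ih =>
    intro n
    rw [pow_succ, Module.End.mul_apply, displacementGenerator_single, map_sub, map_smul, map_smul,
      map_sub, map_smul, map_smul]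
    refine (norm_sub_le _ _).trans ?_
    rw [norm_smul, norm_smul, norm_mul, norm_mul, RCLike.norm_conj, Complex.norm_real,
      Complex.norm_real, Real.norm_of_nonneg (Real.sqrt_nonneg _),
      Real.norm_of_nonneg (Real.sqrt_nonneg _)]
    have e1 : Real.sqrt ((n : ℝ) + 1) * Real.sqrt ((n + 1 + 1).ascFactorial l) =
        Real.sqrt ((n + 1).ascFactorial (l + 1)) := by
      rw [← Real.sqrt_mul (by positivity)]
      congr 1
      have := Nat.succ_ascFactorial (n + 1) l
      rw [Nat.ascFactorial_succ, ← this]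
      push_cast
      ring
    have e2 : Real.sqrt (n : ℝ) * Real.sqrt ((n - 1 + 1).ascFactorial l) ≤
        Real.sqrt ((n + 1).ascFactorial (l + 1)) := by
      rcases Nat.eq_zero_or_pos n with rfl | hn
      · simp
      · rw [← Real.sqrt_mul (by positivity), Nat.sub_add_cancel hn]
        refine Real.sqrt_le_sqrt ?_
        rw [Nat.ascFactorial_succ]
        have h1 : n.ascFactorial l ≤ (n + 1).ascFactorial l := by
          rw [Nat.ascFactorial_eq_prod_range, Nat.ascFactorial_eq_prod_range]
          exact Finset.prod_le_prod' fun i _ => by omega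
        have h2 : n * n.ascFactorial l ≤ (n + 1 + l) * (n + 1).ascFactorial l :=
          Nat.mul_le_mul (by omega) h1
        exact_mod_cast h2
    have i1 := ih (n + 1)
    have i2 := ih (n - 1)
    have hx : 0 ≤ (2 * ‖ξ‖) ^ l := by positivity
    calc _ ≤ ‖ξ‖ * Real.sqrt ((n : ℝ) + 1) * ((2 * ‖ξ‖) ^ l *
          Real.sqrt ((n + 1 + 1).ascFactorial l)) +
          ‖ξ‖ * Real.sqrt n * ((2 * ‖ξ‖) ^ l * Real.sqrt ((n - 1 + 1).ascFactorial l)) := by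
          gcongr
      _ = ‖ξ‖ * (2 * ‖ξ‖) ^ l * (Real.sqrt ((n : ℝ) + 1) *
          Real.sqrt ((n + 1 + 1).ascFactorial l) +
          Real.sqrt n * Real.sqrt ((n - 1 + 1).ascFactorial l)) := by ring
      _ ≤ ‖ξ‖ * (2 * ‖ξ‖) ^ l * (Real.sqrt ((n + 1).ascFactorial (l + 1)) +
          Real.sqrt ((n + 1).ascFactorial (l + 1))) := by
          gcongr
          exact e1.le
      _ = _ := by ring

theorem summable_weylBound (n : ℕ) (c : ℝ) :
    Summable fun l : ℕ => (l.factorial : ℝ)⁻¹ * (c ^ l * Real.sqrt ((n + 1).ascFactorial l)) := by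
  have hlim : Tendsto (fun l : ℕ => |c| * Real.sqrt (n + 1) / Real.sqrt ((l : ℝ) + 1)) atTop
      (𝓝 0) :=
    tendsto_const_nhds.div_atTop (Real.tendsto_sqrt_atTop.comp
      (tendsto_atTop_add_const_right _ _ tendsto_natCast_atTop_atTop))
  refine summable_of_ratio_norm_eventually_le (r := 1 / 2) (by norm_num) ?_
  filter_upwards [hlim.eventually_le_const (show (0 : ℝ) < 1 / 2 by norm_num)] with l hl
  have hsq : 0 < Real.sqrt ((l : ℝ) + 1) := Real.sqrt_pos.2 (by positivity)
  rw [norm_mul, norm_mul, norm_mul, norm_mul, norm_pow, norm_pow, Real.norm_eq_abs c]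
  simp only [norm_inv, Real.norm_natCast, Real.norm_of_nonneg (Real.sqrt_nonneg _)]
  have h1 : Real.sqrt ((n + 1).ascFactorial (l + 1) : ℕ) ≤
      Real.sqrt (n + 1) * Real.sqrt ((l : ℝ) + 1) * Real.sqrt ((n + 1).ascFactorial l) := by
    rw [← Real.sqrt_mul (by positivity), ← Real.sqrt_mul (by positivity)]
    refine Real.sqrt_le_sqrt ?_
    rw [Nat.ascFactorial_succ]
    push_cast
    have : 0 ≤ (((n + 1).ascFactorial l : ℕ) : ℝ) := by positivity
    refine mul_le_mul_of_nonneg_right ?_ this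
    have : (0 : ℝ) ≤ n * l := by positivity
    nlinarith
  have h2 : (((l + 1).factorial : ℕ) : ℝ)⁻¹ =
      (Real.sqrt ((l : ℝ) + 1))⁻¹ * (Real.sqrt ((l : ℝ) + 1))⁻¹ * (l.factorial : ℝ)⁻¹ := by
    rw [← mul_inv, Real.mul_self_sqrt (by positivity), Nat.factorial_succ]
    push_cast
    rw [mul_inv]
  have hq : 0 ≤ (l.factorial : ℝ)⁻¹ * (|c| ^ l * Real.sqrt ((n + 1).ascFactorial l)) := by
    positivity
  calc _ ≤ (((l + 1).factorial : ℕ) : ℝ)⁻¹ * (|c| ^ (l + 1) *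
        (Real.sqrt (n + 1) * Real.sqrt ((l : ℝ) + 1) * Real.sqrt ((n + 1).ascFactorial l))) := by
        gcongr
    _ = |c| * Real.sqrt (n + 1) / Real.sqrt ((l : ℝ) + 1) *
        ((l.factorial : ℝ)⁻¹ * (|c| ^ l * Real.sqrt ((n + 1).ascFactorial l))) := by
        rw [h2, pow_succ]
        field_simp
    _ ≤ _ := mul_le_mul_of_nonneg_right hl hq

theorem summable_norm_weylTerm (n : ℕ) : Summable fun l => ‖weylTerm b ξ n l‖ := by
  refine Summable.of_nonneg_of_le (fun _ => norm_nonneg _) (fun l => ?_)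
    (summable_weylBound n (2 * ‖ξ‖))
  rw [weylTerm, norm_smul, norm_inv, Complex.norm_natCast]
  gcongr
  exact norm_displacementGenerator_pow_le ξ b l n

/-- The norm-convergent exponential series defining the Weyl operators. -/
theorem hasSum_weylTerm [CompleteSpace H] (k : Fin 2 → ℝ) (n : ℕ) :
    HasSum (weylTerm b (displacement k) n) (weylFock b k n) := by
  have h := (summable_norm_weylTerm (displacement k) b n).of_norm.hasSum
  have : ∑' l, weylTerm b (displacement k) n l = weylFock b k n := by
    refine tsum_congr fun l => ?_
    rw [weylTerm, ← I_smul_quadratureCombination, smul_pow, LinearMap.smul_apply, map_smul,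
      smul_smul, div_eq_inv_mul]
  rwa [this] at h

theorem inner_displacementGenerator (f g : FiniteStates) :
    inner ℂ (finiteStatesToHilbert b (displacementGenerator ξ f)) (finiteStatesToHilbert b g) =
      - inner ℂ (finiteStatesToHilbert b f)
        (finiteStatesToHilbert b (displacementGenerator ξ g)) := by
  have hδ : ∀ m n : ℕ, (Real.sqrt ((m : ℝ) + 1) : ℂ) * (if m + 1 = n then (1 : ℂ) else 0) =
      (Real.sqrt n : ℂ) * if m = n - 1 then (1 : ℂ) else 0 := by
    intro m n
    rcases Nat.eq_zero_or_pos n with rfl | hn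
    · simp
    · obtain ⟨n, rfl⟩ := Nat.exists_eq_succ_of_ne_zero hn.ne'
      by_cases h : m = n
      · subst h
        simp
      · simp [h]
  have key : ∀ m n : ℕ,
      inner ℂ (finiteStatesToHilbert b (displacementGenerator ξ (Finsupp.single m 1)))
        (b n) = - inner ℂ (b m)
        (finiteStatesToHilbert b (displacementGenerator ξ (Finsupp.single n 1))) := by
    intro m n
    simp only [displacementGenerator_single, map_sub, map_smul, finiteStatesToHilbert_single,
      inner_sub_left, inner_sub_right, inner_smul_left, inner_smul_right,
      orthonormal_iff_ite.1 b.orthonormal, map_mul, Complex.conj_ofReal, RCLike.conj_conj]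
    have h1 := hδ m n
    have h2 := hδ n m
    simp only [eq_comm (a := n + 1), eq_comm (a := n) (b := m - 1)] at h2
    linear_combination (starRingEnd ℂ ξ) * h1 + ξ * h2
  induction f using Finsupp.induction_linear with
  | zero => simp
  | add f f' hf hf' => simp only [map_add, inner_add_left, hf, hf', neg_add]
  | single m c =>
    induction g using Finsupp.induction_linear with
    | zero => simp
    | add g g' hg hg' => simp only [map_add, inner_add_right, hg, hg', neg_add]
    | single n c' =>
      have e : ∀ (i : ℕ) (z : ℂ), Finsupp.single i z = z • Finsupp.single i (1 : ℂ) := by simp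
      rw [e m, e n]
      simp only [map_smul, inner_smul_left, inner_smul_right, finiteStatesToHilbert_single, key]
      ring

theorem inner_displacementGenerator_pow (l : ℕ) : ∀ f g : FiniteStates,
    inner ℂ (finiteStatesToHilbert b ((displacementGenerator ξ ^ l) f))
        (finiteStatesToHilbert b g) =
      (-1) ^ l * inner ℂ (finiteStatesToHilbert b f)
        (finiteStatesToHilbert b ((displacementGenerator ξ ^ l) g)) := by
  induction l with
  | zero => simp
  | succ l ih =>
    intro f g
    conv_lhs => rw [pow_succ, Module.End.mul_apply, ih, inner_displacementGenerator,
      ← Module.End.mul_apply, ← pow_succ']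
    ring

variable [CompleteSpace H]

/-- The Weyl operators preserve the norm, because their generator is skew-adjoint: in the double
series for `‖exp(A)|n⟩‖²` the terms of total order `s ≥ 1` add up to `(1 - 1)^s / s! = 0`. -/
theorem norm_weylFock (k : Fin 2 → ℝ) (n : ℕ) : ‖weylFock b k n‖ = 1 := by
  set ξ := displacement k
  set f := weylTerm b ξ n with hf
  set W := weylFock b k n
  have hsum : HasSum f W := hasSum_weylTerm b k n
  have hnorm : Summable fun l => ‖f l‖ := summable_norm_weylTerm ξ b n
  have hS : Summable fun p : ℕ × ℕ => inner ℂ (f p.1) (f p.2) := by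
    refine Summable.of_norm_bounded (hnorm.mul_of_nonneg hnorm (fun _ => norm_nonneg _)
      fun _ => norm_nonneg _) fun p => norm_inner_le_norm _ _
  have h1 : ∑' p : ℕ × ℕ, inner ℂ (f p.1) (f p.2) = inner ℂ W W := by
    rw [hS.tsum_prod]
    have e1 : ∀ l, ∑' m, inner ℂ (f l) (f m) = inner ℂ (f l) W := fun l =>
      (hsum.mapL (innerSL ℂ (f l))).tsum_eq
    rw [tsum_congr e1]
    have e2 := Complex.hasSum_conj'.2 (hsum.mapL (innerSL ℂ W))
    refine (e2.congr_fun fun l => ?_).tsum_eq.trans ?_ <;> simp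
  have h2 : ∑' p : ℕ × ℕ, inner ℂ (f p.1) (f p.2) = 1 := by
    have hS' := Finset.HasAntidiagonal.sigmaAntidiagonalEquivProd.summable_iff.2 hS
    simp only [Function.comp_def] at hS'
    rw [← Finset.HasAntidiagonal.sigmaAntidiagonalEquivProd.tsum_eq,
      hS'.tsum_sigma' fun s => (hasSum_fintype _).summable, tsum_eq_single 0]
    · simp [Finset.HasAntidiagonal.sigmaAntidiagonalEquivProd, hf, weylTerm,
        finiteStatesToHilbert_single, b.orthonormal.1 n]
    · intro s hs
      rw [tsum_fintype]
      simp only [Finset.HasAntidiagonal.sigmaAntidiagonalEquivProd, Equiv.coe_fn_mk]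
      rw [Finset.sum_coe_sort (Finset.HasAntidiagonal.antidiagonal s)
        fun p : ℕ × ℕ => inner ℂ (f p.1) (f p.2)]
      have hterm : ∀ p ∈ Finset.HasAntidiagonal.antidiagonal s, inner ℂ (f p.1) (f p.2) =
          ((s.factorial : ℂ)⁻¹ * inner ℂ (b n) (finiteStatesToHilbert b
            ((displacementGenerator ξ ^ s) (Finsupp.single n 1)))) *
            (s.choose p.1 * ((-1) ^ p.1 * 1 ^ p.2)) := by
        intro p hp
        obtain rfl := Finset.HasAntidiagonal.mem_antidiagonal.1 hp
        have hfac := Nat.add_choose_mul_factorial_mul_factorial p.1 p.2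
        have hfac' : (((p.1 + p.2).choose p.1 : ℕ) : ℂ) * p.1.factorial * p.2.factorial =
            (p.1 + p.2).factorial := by
          rw [Nat.choose_symm_add]
          exact_mod_cast hfac
        rw [hf]
        simp only [weylTerm, inner_smul_left, inner_smul_right]
        rw [inner_displacementGenerator_pow, ← Module.End.mul_apply, ← pow_add,
          finiteStatesToHilbert_single, ← hfac']
        have h1 : (p.1.factorial : ℂ) ≠ 0 := by exact_mod_cast p.1.factorial_ne_zero
        have h2 : (p.2.factorial : ℂ) ≠ 0 := by exact_mod_cast p.2.factorial_ne_zero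
        have h3 : (((p.1 + p.2).choose p.1 : ℕ) : ℂ) ≠ 0 := by
          exact_mod_cast (Nat.choose_pos (Nat.le_add_right _ _)).ne'
        simp only [map_inv₀, map_natCast, one_pow, mul_one]
        field_simp
      rw [Finset.sum_congr rfl hterm, ← Finset.mul_sum]
      have := (Commute.all (-1 : ℂ) 1).add_pow' s
      simp only [nsmul_eq_mul] at this
      rw [← this, neg_add_cancel, zero_pow hs, mul_zero]
  have h3 : ((‖W‖ : ℝ) : ℂ) ^ 2 = 1 := by
    exact (inner_self_eq_norm_sq_to_K (𝕜 := ℂ) W).symm.trans (h1.symm.trans h2)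
  have h4 : ‖W‖ ^ 2 = 1 := by exact_mod_cast h3
  exact (pow_eq_one_iff_of_nonneg (norm_nonneg _) two_ne_zero).1 h4

/-- The vector `∑ⱼ conj(u)ʲ / √j! |j⟩`: the unnormalized coherent state, which represents
the point evaluation at `u` of the Bargmann space. -/
noncomputable def coherent (b : HilbertBasis ℕ ℂ H) (u : ℂ) : H :=
  ∑' j : ℕ, ((starRingEnd ℂ u) ^ j / (Real.sqrt j.factorial : ℝ)) • b j

theorem inner_coherent (u : ℂ) (j : ℕ) :
    inner ℂ (coherent b u) (b j) = u ^ j / (Real.sqrt j.factorial : ℝ) := by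
  have hs : Summable fun j : ℕ => ((starRingEnd ℂ u) ^ j / (Real.sqrt j.factorial : ℝ)) • b j := by
    refine Summable.of_norm (Summable.of_nonneg_of_le (fun _ => norm_nonneg _) (fun j => ?_)
      (summable_weylBound 0 ‖u‖))
    have hj := Real.sqrt_pos.2 (Nat.cast_pos.2 j.factorial_pos : (0 : ℝ) < j.factorial)
    rw [norm_smul, b.orthonormal.1 j, norm_div, norm_pow, RCLike.norm_conj, Complex.norm_real,
      Real.norm_of_nonneg hj.le, Nat.zero_add, Nat.one_ascFactorial]
    refine le_of_eq ?_
    nth_rw 2 [← Real.mul_self_sqrt (Nat.cast_nonneg j.factorial)]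
    field_simp
  have h := (hs.hasSum.mapL (innerSL ℂ (b j)))
  have h' := hasSum_single (f := fun i => innerSL ℂ (b j)
    (((starRingEnd ℂ u) ^ i / (Real.sqrt i.factorial : ℝ)) • b i)) j (fun i hi => by
      simp [orthonormal_iff_ite.1 b.orthonormal, hi.symm])
  have e := h.unique h'
  rw [← inner_conj_symm]
  simp only [innerSL_apply_apply, inner_smul_right, orthonormal_iff_ite.1 b.orthonormal] at e
  change inner ℂ (b j) (coherent b u) = _ at e
  rw [e]
  simp

/-- The Bargmann function at `u` of `exp(t (ξ a† - ξ̄ a)) |n⟩`. -/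
noncomputable def bargmannFunction (ξ u t : ℂ) (n : ℕ) : ℂ :=
  Complex.exp (-(t ^ 2 * (ξ * starRingEnd ℂ ξ)) / 2 + t * (u * ξ)) *
    (u - t * starRingEnd ℂ ξ) ^ n / (Real.sqrt n.factorial : ℝ)

theorem hasDerivAt_bargmannFunction (u t : ℂ) (n : ℕ) :
    HasDerivAt (fun t => bargmannFunction ξ u t n)
      (ξ * (Real.sqrt ((n : ℝ) + 1) : ℝ) * bargmannFunction ξ u t (n + 1) -
        starRingEnd ℂ ξ * (Real.sqrt n : ℝ) * bargmannFunction ξ u t (n - 1)) t := by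
  have h1 : HasDerivAt (fun t : ℂ => -(t ^ 2 * (ξ * starRingEnd ℂ ξ)) / 2 + t * (u * ξ))
      (-(2 * t * (ξ * starRingEnd ℂ ξ)) / 2 + u * ξ) t := by
    have := (((hasDerivAt_id' t).fun_pow 2).mul_const (ξ * starRingEnd ℂ ξ)).fun_neg.div_const 2
    refine (this.fun_add ((hasDerivAt_id' t).mul_const (u * ξ))).congr_deriv ?_
    simp
  have h2 : HasDerivAt (fun t : ℂ => (u - t * starRingEnd ℂ ξ) ^ n)
      (n * (u - t * starRingEnd ℂ ξ) ^ (n - 1) * (-starRingEnd ℂ ξ)) t := by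
    have := (((hasDerivAt_id' t).mul_const (starRingEnd ℂ ξ)).const_sub u).fun_pow n
    refine this.congr_deriv ?_
    simp
  refine ((h1.cexp.fun_mul h2).div_const _).congr_deriv ?_
  have hf : ∀ m : ℕ, (Real.sqrt m.factorial : ℂ) ≠ 0 := fun m =>
    Complex.ofReal_ne_zero.2 (Real.sqrt_ne_zero'.2 (by positivity))
  have hs : ∀ m : ℕ, (Real.sqrt (m + 1).factorial : ℂ) =
      (Real.sqrt ((m : ℝ) + 1) : ℂ) * (Real.sqrt m.factorial : ℂ) := by
    intro m
    rw [← Complex.ofReal_mul, ← Real.sqrt_mul (by positivity), Nat.factorial_succ]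
    push_cast
    rfl
  have hp : ∀ m : ℕ, (Real.sqrt ((m : ℝ) + 1) : ℂ) ≠ 0 := fun m =>
    Complex.ofReal_ne_zero.2 (Real.sqrt_ne_zero'.2 (by positivity))
  have hq : ∀ m : ℕ, (Real.sqrt ((m : ℝ) + 1) : ℂ) * (Real.sqrt ((m : ℝ) + 1) : ℂ) = m + 1 := by
    intro m
    rw [← Complex.ofReal_mul, Real.mul_self_sqrt (by positivity)]
    push_cast
    rfl
  simp only [bargmannFunction]
  rcases Nat.eq_zero_or_pos n with rfl | hn
  · simp
    ring
  · obtain ⟨n, rfl⟩ := Nat.exists_eq_succ_of_ne_zero hn.ne'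
    simp only [Nat.succ_eq_add_one, Nat.add_sub_cancel]
    rw [hs (n + 1), hs n]
    have := hf n
    have := hp n
    have h3 := hp (n + 1)
    have h4 := hq n
    push_cast at h3 ⊢
    field_simp
    rw [← h4]
    ring

theorem hasDerivAt_linearCombination_bargmannFunction (u t : ℂ) (f : FiniteStates) :
    HasDerivAt (fun t => Finsupp.linearCombination ℂ (bargmannFunction ξ u t) f)
      (Finsupp.linearCombination ℂ (bargmannFunction ξ u t) (displacementGenerator ξ f)) t := by
  induction f using Finsupp.induction_linear with
  | zero => simpa using hasDerivAt_const t (0 : ℂ)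
  | add f g hf hg =>
    simp only [map_add]
    exact hf.fun_add hg
  | single n c =>
    have e : Finsupp.single n c = c • Finsupp.single n (1 : ℂ) := by simp
    rw [e]
    simp only [map_smul, displacementGenerator_single, map_sub, Finsupp.linearCombination_single,
      smul_eq_mul, one_mul]
    exact (hasDerivAt_bargmannFunction ξ u t n).const_mul c

/-- The Bargmann function of the displaced Fock state `exp(i k · R) |n⟩`. -/
theorem inner_coherent_weylFock (u : ℂ) (k : Fin 2 → ℝ) (n : ℕ) :
    inner ℂ (coherent b u) (weylFock b k n) = bargmannFunction (displacement k) u 1 n := by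
  set ξ := displacement k
  have hderiv : ∀ (l : ℕ) (f : FiniteStates),
      iteratedDeriv l (fun t => Finsupp.linearCombination ℂ (bargmannFunction ξ u t) f) =
        fun t => Finsupp.linearCombination ℂ (bargmannFunction ξ u t)
          ((displacementGenerator ξ ^ l) f) := by
    intro l
    induction l with
    | zero => intro f; simp
    | succ l ih =>
      intro f
      have h : deriv (fun t => Finsupp.linearCombination ℂ (bargmannFunction ξ u t) f) =
          fun t => Finsupp.linearCombination ℂ (bargmannFunction ξ u t)
            (displacementGenerator ξ f) :=
        funext fun t => (hasDerivAt_linearCombination_bargmannFunction ξ u t f).deriv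
      rw [iteratedDeriv_succ', h, ih, pow_succ]
      rfl
  have hzero : ∀ f : FiniteStates, Finsupp.linearCombination ℂ (bargmannFunction ξ u 0) f =
      inner ℂ (coherent b u) (finiteStatesToHilbert b f) := by
    intro f
    induction f using Finsupp.induction_linear with
    | zero => simp
    | add f g hf hg => simp only [map_add, hf, hg, inner_add_right]
    | single n c =>
      simp [finiteStatesToHilbert, inner_coherent, bargmannFunction]
  have hT := Complex.hasSum_taylorSeries_of_entire
    (f := fun t => Finsupp.linearCombination ℂ (bargmannFunction ξ u t) (Finsupp.single n 1))
    (fun t => (hasDerivAt_linearCombination_bargmannFunction ξ u t _).differentiableAt) 0 1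
  have hW := (hasSum_weylTerm b k n).mapL (innerSL ℂ (coherent b u))
  simp only [hderiv, hzero, sub_zero, one_pow] at hT
  refine hW.unique ?_
  have e : Finsupp.linearCombination ℂ (bargmannFunction ξ u 1) (Finsupp.single n 1) =
    bargmannFunction ξ u 1 n := by simp
  rw [e] at hT
  refine hT.congr_fun fun l => ?_
  simp [weylTerm, ξ]

/-- The coefficient of `u ^ j` in `exp(u ξ) (u - ξ̄) ^ n`. -/
theorem hasSum_bargmannFunction (ξ u : ℂ) (n : ℕ) :
    HasSum (fun j => Complex.exp (-(ξ * starRingEnd ℂ ξ) / 2) / (Real.sqrt n.factorial : ℝ) *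
      (∑ i ∈ Finset.range (n + 1), if i ≤ j then
        n.choose i * (-starRingEnd ℂ ξ) ^ (n - i) * (ξ ^ (j - i) / (j - i).factorial) else 0) *
          u ^ j) (bargmannFunction ξ u 1 n) := by
  have hexp : HasSum (fun j : ℕ => (u * ξ) ^ j / (j.factorial : ℂ)) (Complex.exp (u * ξ)) := by
    rw [Complex.exp_eq_exp_ℂ]
    exact NormedSpace.exp_series_hasSum_exp' (u * ξ) |>.congr_fun fun j => by
      rw [smul_eq_mul, div_eq_inv_mul]
  have h1 := hasSum_sum (s := Finset.range (n + 1)) fun i _ =>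
    (hasSum_shift hexp i).mul_left (n.choose i * (-starRingEnd ℂ ξ) ^ (n - i) * u ^ i)
  have h2 := h1.mul_left (Complex.exp (-(ξ * starRingEnd ℂ ξ) / 2) / (Real.sqrt n.factorial : ℝ))
  have hval : Complex.exp (-(ξ * starRingEnd ℂ ξ) / 2) / (Real.sqrt n.factorial : ℝ) *
      ∑ i ∈ Finset.range (n + 1),
        (n.choose i * (-starRingEnd ℂ ξ) ^ (n - i) * u ^ i) * Complex.exp (u * ξ) =
      bargmannFunction ξ u 1 n := by
    rw [← Finset.sum_mul, bargmannFunction, one_pow, one_mul, one_mul, one_mul, Complex.exp_add,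
      sub_eq_add_neg, add_pow]
    have : ∑ i ∈ Finset.range (n + 1), (n.choose i * (-starRingEnd ℂ ξ) ^ (n - i) * u ^ i) =
        ∑ i ∈ Finset.range (n + 1), u ^ i * (-starRingEnd ℂ ξ) ^ (n - i) * n.choose i :=
      Finset.sum_congr rfl fun i _ => by ring
    rw [this]
    ring
  rw [hval] at h2
  refine h2.congr_fun fun j => ?_
  rw [mul_assoc, Finset.sum_mul]
  congr 1
  refine Finset.sum_congr rfl fun i _ => ?_
  split_ifs with h
  · rw [mul_pow, ← Nat.add_sub_of_le h, pow_add u, Nat.add_sub_cancel_left]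
    ring
  · simp

/-- The associated Laguerre polynomial `L_j^(d)(x) = ∑ᵢ C(j + d, d + i) (-x)ⁱ / i!`. -/
noncomputable def laguerre (j d : ℕ) (x : ℝ) : ℝ :=
  ∑ i ∈ Finset.range (j + 1), ((j + d).choose (d + i) : ℝ) * (-x) ^ i / i.factorial

/-- The matrix elements of the Weyl operators above the diagonal, in terms of Laguerre
polynomials. -/
theorem inner_weylFock (k : Fin 2 → ℝ) (j d : ℕ) :
    inner ℂ (b j) (weylFock b k (j + d)) =
      (Real.sqrt j.factorial / Real.sqrt (j + d).factorial : ℝ) *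
        (-starRingEnd ℂ (displacement k)) ^ d *
        (Real.exp (-‖displacement k‖ ^ 2 / 2) * laguerre j d (‖displacement k‖ ^ 2) : ℝ) := by
  set ξ := displacement k with hξ
  have hx : ξ * starRingEnd ℂ ξ = ((‖ξ‖ ^ 2 : ℝ) : ℂ) := by
    rw [Complex.mul_conj, Complex.normSq_eq_norm_sq]
  have h := coeff_eq_of_hasSum one_pos
    (c := fun i => inner ℂ (b i) (weylFock b k (j + d)) / (Real.sqrt i.factorial : ℝ))
    (F := fun u => bargmannFunction ξ u 1 (j + d)) (fun u _ _ => by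
      rw [← inner_coherent_weylFock b]
      refine (b.hasSum_inner_mul_inner _ _).congr_fun fun i => ?_
      rw [inner_coherent]
      ring) (fun u _ _ => hasSum_bargmannFunction ξ u (j + d)) j
  have hj : (Real.sqrt j.factorial : ℂ) ≠ 0 :=
    Complex.ofReal_ne_zero.2 (Real.sqrt_ne_zero'.2 (by positivity))
  rw [div_eq_iff hj] at h
  rw [h]
  have hsum : (∑ i ∈ Finset.range (j + d + 1), if i ≤ j then
        ((j + d).choose i : ℂ) * (-starRingEnd ℂ ξ) ^ (j + d - i) *
          (ξ ^ (j - i) / (j - i).factorial) else 0) =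
      (-starRingEnd ℂ ξ) ^ d * (laguerre j d (‖ξ‖ ^ 2) : ℝ) := by
    rw [← Finset.sum_filter]
    have hfil : (Finset.range (j + d + 1)).filter (fun i => i ≤ j) = Finset.range (j + 1) := by
      ext i
      simp only [Finset.mem_filter, Finset.mem_range]
      omega
    rw [hfil, ← Finset.sum_range_reflect, laguerre, Complex.ofReal_sum, Finset.mul_sum]
    refine Finset.sum_congr rfl fun i hi => ?_
    have hij : i ≤ j := Nat.lt_succ_iff.1 (Finset.mem_range.1 hi)
    have e1 : j + 1 - 1 - i = j - i := by omega
    have e2 : j + d - (j - i) = d + i := by omega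
    have e3 : j - (j - i) = i := by omega
    have e4 : (j + d).choose (j - i) = (j + d).choose (d + i) :=
      Nat.choose_symm_of_eq_add (by omega)
    rw [e1, e2, e3, e4]
    push_cast
    have : (-((‖ξ‖ : ℂ) ^ 2)) ^ i = (-starRingEnd ℂ ξ) ^ i * ξ ^ i := by
      rw [← mul_pow, neg_mul, mul_comm (starRingEnd ℂ ξ), hx]
      push_cast
      rfl
    rw [this, pow_add]
    ring
  rw [hsum, hx]
  push_cast
  ring

end Weyl

/-! ### Laplace transforms of Laguerre polynomials -/

section Laplace

open MeasureTheory Set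

theorem integrableOn_pow_mul_exp (m : ℕ) {τ : ℝ} (hτ : 0 < τ) :
    IntegrableOn (fun x : ℝ => x ^ m * Real.exp (-(τ * x))) (Ioi 0) := by
  have h := integrableOn_rpow_mul_exp_neg_mul_rpow (s := m) (p := 1) (b := τ)
    (by have := m.cast_nonneg (α := ℝ); linarith) one_pos hτ
  refine h.congr_fun (fun x _ => ?_) measurableSet_Ioi
  simp [Real.rpow_natCast]

theorem integral_pow_mul_exp (m : ℕ) {τ : ℝ} (hτ : 0 < τ) :
    ∫ x in Ioi (0 : ℝ), x ^ m * Real.exp (-(τ * x)) = m.factorial / τ ^ (m + 1) := by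
  have h := Real.integral_rpow_mul_exp_neg_mul_Ioi (a := m + 1) (r := τ) (by positivity) hτ
  have e : ∀ x : ℝ, x ^ ((m : ℝ) + 1 - 1) = x ^ m := fun x => by
    rw [add_sub_cancel_right, Real.rpow_natCast]
  simp only [e] at h
  rw [h, Real.Gamma_nat_eq_factorial, ← Nat.cast_add_one, Real.rpow_natCast, one_div, inv_pow]
  ring

theorem laguerre_mul_eq (j d : ℕ) (c τ x : ℝ) :
    x ^ d * laguerre j d (c * x) * Real.exp (-(τ * x)) = ∑ i ∈ Finset.range (j + 1),
      ((j + d).choose (d + i) : ℝ) * (-c) ^ i / i.factorial *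
        (x ^ (d + i) * Real.exp (-(τ * x))) := by
  rw [laguerre, Finset.mul_sum, Finset.sum_mul]
  refine Finset.sum_congr rfl fun i _ => ?_
  rw [← neg_mul, mul_pow, pow_add]
  ring

theorem integrableOn_laguerre (j d : ℕ) (c : ℝ) {τ : ℝ} (hτ : 0 < τ) :
    IntegrableOn (fun x : ℝ => x ^ d * laguerre j d (c * x) * Real.exp (-(τ * x))) (Ioi 0) := by
  simp only [laguerre_mul_eq]
  exact integrable_finsetSum _ fun i _ => (integrableOn_pow_mul_exp (d + i) hτ).const_mul _

theorem integral_laguerre (j d : ℕ) (c : ℝ) {τ : ℝ} (hτ : 0 < τ) :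
    ∫ x in Ioi (0 : ℝ), x ^ d * laguerre j d (c * x) * Real.exp (-(τ * x)) =
      (j + d).factorial / j.factorial * (τ⁻¹) ^ (d + 1) * (1 - c * τ⁻¹) ^ j := by
  simp only [laguerre_mul_eq]
  rw [integral_finsetSum _ fun i _ => (integrableOn_pow_mul_exp (d + i) hτ).const_mul _]
  simp only [integral_const_mul, integral_pow_mul_exp _ hτ]
  rw [sub_eq_neg_add, ← neg_mul, add_pow, Finset.mul_sum]
  refine Finset.sum_congr rfl fun i hi => ?_
  have hij : i ≤ j := Nat.lt_succ_iff.1 (Finset.mem_range.1 hi)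
  have h1 : ((j + d).choose (d + i) : ℝ) * (d + i).factorial * (j - i).factorial =
      (j + d).factorial := by
    have := Nat.choose_mul_factorial_mul_factorial (show d + i ≤ j + d by omega)
    rw [show j + d - (d + i) = j - i by omega] at this
    exact_mod_cast this
  have h2 : (j.choose i : ℝ) * i.factorial * (j - i).factorial = j.factorial := by
    exact_mod_cast Nat.choose_mul_factorial_mul_factorial hij
  have p1 : (0 : ℝ) < i.factorial := by positivity
  have p2 : (0 : ℝ) < (j - i).factorial := by positivity
  have p3 : (0 : ℝ) < j.choose i := by exact_mod_cast Nat.choose_pos hij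
  rw [← h1, ← h2, inv_pow, mul_pow, inv_pow, one_pow, mul_one]
  field_simp
  ring

/-- Inversion by the Laplace transform: a series of Laguerre functions with summable coefficients
that equals a rescaled and damped Laguerre function determines its coefficients. With `X = 1 - 1/σ`
and `σ` the transform variable, both sides become power series in `X`. -/
theorem coeff_eq_of_laguerre {y : ℕ → ℂ} {d n : ℕ} {a c : ℝ} {z : ℂ} (ha : 0 ≤ a)
    (hy : Summable fun j => ‖y j‖)
    (hb : ∀ (j : ℕ) (x : ℝ), 0 < x → |Real.sqrt j.factorial / Real.sqrt (j + d).factorial *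
      (Real.exp (-x / 2) * laguerre j d x)| * Real.sqrt x ^ d ≤ 1)
    (h : ∀ x : ℝ, 0 < x → HasSum (fun j => y j * ((Real.sqrt j.factorial /
      Real.sqrt (j + d).factorial * (Real.exp (-x / 2) * laguerre j d x) : ℝ) : ℂ))
      (z * ((Real.sqrt n.factorial / Real.sqrt (n + d).factorial *
        (Real.exp (-(a * x) / 2) * laguerre n d (c * x)) : ℝ) : ℂ))) (j : ℕ) :
    y j * ((Real.sqrt (j + d).factorial / Real.sqrt j.factorial : ℝ) : ℂ) =
      z * ((Real.sqrt (n + d).factorial / Real.sqrt n.factorial * (2 / (1 + a)) ^ (d + 1) *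
        ∑ s ∈ Finset.range (n + 1), if s ≤ j then
          n.choose s * (1 - c * (2 / (1 + a))) ^ (n - s) * (c * (2 / (1 + a)) * (2 / (1 + a))) ^ s *
            ((j + d).choose (s + d) * (1 - 2 / (1 + a)) ^ (j - s)) else 0 : ℝ) : ℂ) := by
  set μ := 2 / (1 + a) with hμ
  have hw : ∀ m : ℕ, Real.sqrt m.factorial / Real.sqrt (m + d).factorial *
      ((m + d).factorial / m.factorial) = Real.sqrt (m + d).factorial / Real.sqrt m.factorial := by
    intro m
    have h1 : 0 < Real.sqrt (m.factorial : ℝ) := Real.sqrt_pos.2 (by positivity)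
    have h2 : 0 < Real.sqrt ((m + d).factorial : ℝ) := Real.sqrt_pos.2 (by positivity)
    have h3 : (0 : ℝ) < m.factorial := by positivity
    have e1 := Real.mul_self_sqrt (Nat.cast_nonneg (α := ℝ) m.factorial)
    have e2 := Real.mul_self_sqrt (Nat.cast_nonneg (α := ℝ) (m + d).factorial)
    rw [div_mul_div_comm, div_eq_div_iff (by positivity) h1.ne']
    linear_combination ((m + d).factorial : ℝ) * e1 - (m.factorial : ℝ) * e2
  -- the Laplace transform at `σ`
  have hL : ∀ σ : ℝ, 1 < σ → HasSum (fun j => y j * ((Real.sqrt (j + d).factorial /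
      Real.sqrt j.factorial * (σ⁻¹ ^ (d + 1) * (1 - σ⁻¹) ^ j) : ℝ) : ℂ))
      (z * ((Real.sqrt (n + d).factorial / Real.sqrt n.factorial *
        ((σ - 1 / 2 + a / 2)⁻¹ ^ (d + 1) * (1 - c * (σ - 1 / 2 + a / 2)⁻¹) ^ n) : ℝ) : ℂ)) := by
    intro σ hσ
    have hσ0 : 0 < σ := by linarith
    have hτ : 0 < σ - 1 / 2 + a / 2 := by linarith
    have hσ' : 0 < σ - 1 / 2 := by linarith
    let F : ℕ → ℝ → ℂ := fun j x => (y j * ((Real.sqrt j.factorial /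
      Real.sqrt (j + d).factorial : ℝ) : ℂ)) *
        ((x ^ d * laguerre j d (1 * x) * Real.exp (-(σ * x)) : ℝ) : ℂ)
    have hF : ∀ j x, F j x = ((x ^ d * Real.exp (-((σ - 1 / 2) * x)) : ℝ) : ℂ) *
        (y j * ((Real.sqrt j.factorial /
      Real.sqrt (j + d).factorial * (Real.exp (-x / 2) * laguerre j d x) : ℝ) : ℂ)) := by
      intro j x
      have : Real.exp (-(σ * x)) = Real.exp (-((σ - 1 / 2) * x)) * Real.exp (-x / 2) := by
        rw [← Real.exp_add]; congr 1; ring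
      simp only [F, this, one_mul]
      push_cast
      ring
    have hint : ∀ j, Integrable (F j) (volume.restrict (Ioi 0)) := fun j =>
      ((integrableOn_laguerre j d 1 hσ0).ofReal (𝕜 := ℂ)).const_mul _
    have hI := ((integrableOn_pow_mul_exp 0 hσ').add (integrableOn_pow_mul_exp d hσ'))
    have hbound : ∀ j, ∀ x ∈ Ioi (0 : ℝ), ‖F j x‖ ≤ ‖y j‖ *
        (x ^ 0 * Real.exp (-((σ - 1 / 2) * x)) + x ^ d * Real.exp (-((σ - 1 / 2) * x))) := by
      intro j x hx
      have hx : 0 < x := hx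
      have h1 := hb j x hx
      have h2 : Real.sqrt x ^ d ≤ 1 + x ^ d := by
        have e := Real.mul_self_sqrt hx.le
        have : x ^ d = Real.sqrt x ^ d * Real.sqrt x ^ d := by rw [← mul_pow, e]
        rw [this]
        nlinarith [sq_nonneg (Real.sqrt x ^ d - 1)]
      have h3 : x ^ d = Real.sqrt x ^ d * Real.sqrt x ^ d := by
        rw [← mul_pow, Real.mul_self_sqrt hx.le]
      rw [hF, norm_mul, norm_mul, Complex.norm_real, Complex.norm_real, Real.norm_eq_abs,
        Real.norm_eq_abs, abs_of_nonneg (by positivity : 0 ≤ x ^ d * _)]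
      generalize |Real.sqrt j.factorial / Real.sqrt (j + d).factorial *
        (Real.exp (-x / 2) * laguerre j d x)| = w at h1
      have hs : 0 ≤ Real.sqrt x ^ d := by positivity
      calc _ = ‖y j‖ * Real.exp (-((σ - 1 / 2) * x)) * ((w * Real.sqrt x ^ d) * Real.sqrt x ^ d) :=
        by
            rw [h3]; ring
        _ ≤ ‖y j‖ * Real.exp (-((σ - 1 / 2) * x)) * (1 * (1 + x ^ d)) := by gcongr
        _ = _ := by ring
    have hsum : Summable fun j => ∫ x in Ioi (0 : ℝ), ‖F j x‖ := by
      refine Summable.of_nonneg_of_le (fun j => integral_nonneg fun _ => norm_nonneg _)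
        (fun j => ?_) (hy.mul_right (∫ x in Ioi (0 : ℝ), (x ^ 0 * Real.exp (-((σ - 1 / 2) * x)) +
          x ^ d * Real.exp (-((σ - 1 / 2) * x)))))
      rw [← integral_const_mul]
      exact setIntegral_mono_on (hint j).norm (hI.const_mul _) measurableSet_Ioi (hbound j)
    have key := hasSum_integral_of_summable_integral_norm hint hsum
    have hR : ∫ x in Ioi (0 : ℝ), ∑' j, F j x = z * ((Real.sqrt (n + d).factorial /
        Real.sqrt n.factorial *
        ((σ - 1 / 2 + a / 2)⁻¹ ^ (d + 1) * (1 - c * (σ - 1 / 2 + a / 2)⁻¹) ^ n) : ℝ) : ℂ) := by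
      have e : ∀ x ∈ Ioi (0 : ℝ), ∑' j, F j x = (z * ((Real.sqrt n.factorial /
          Real.sqrt (n + d).factorial : ℝ) : ℂ)) *
          ((x ^ d * laguerre n d (c * x) * Real.exp (-((σ - 1 / 2 + a / 2) * x)) : ℝ) : ℂ) := by
        intro x hx
        have h1 := (h x hx).mul_left ((x ^ d * Real.exp (-((σ - 1 / 2) * x)) : ℝ) : ℂ)
        have h2 := (h1.congr_fun fun j => hF j x).tsum_eq
        rw [h2]
        have : Real.exp (-((σ - 1 / 2 + a / 2) * x)) =
            Real.exp (-((σ - 1 / 2) * x)) * Real.exp (-(a * x) / 2) := by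
          rw [← Real.exp_add]; congr 1; ring
        rw [this]
        push_cast
        ring
      rw [setIntegral_congr_fun measurableSet_Ioi e, integral_const_mul, integral_complex_ofReal,
        integral_laguerre n d c hτ, ← hw n]
      push_cast
      ring
    rw [hR] at key
    refine key.congr_fun fun j => ?_
    simp only [F]
    rw [integral_const_mul, integral_complex_ofReal, integral_laguerre j d 1 hσ0, ← hw j]
    push_cast
    ring
  have hμ0 : 0 < μ := by positivity
  have hμ2 : μ ≤ 2 := by
    rw [hμ, div_le_iff₀ (by linarith)]
    linarith
  have hμa : μ * (1 + a) = 2 := div_mul_cancel₀ _ (by linarith)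
  refine (coeff_eq_of_hasSum one_pos (c := fun j => y j * ((Real.sqrt (j + d).factorial /
      Real.sqrt j.factorial : ℝ) : ℂ))
    (c' := fun j => z * ((Real.sqrt (n + d).factorial / Real.sqrt n.factorial * μ ^ (d + 1) *
        ∑ s ∈ Finset.range (n + 1), if s ≤ j then
          n.choose s * (1 - c * μ) ^ (n - s) * (c * μ * μ) ^ s *
            ((j + d).choose (s + d) * (1 - μ) ^ (j - s)) else 0 : ℝ) : ℂ))
    (F := fun X => z * ((Real.sqrt (n + d).factorial / Real.sqrt n.factorial * μ ^ (d + 1) *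
      (∑ s ∈ Finset.range (n + 1), n.choose s * (1 - c * μ) ^ (n - s) * (c * μ * μ) ^ s * X ^ s *
        (1 / (1 - (1 - μ) * X) ^ (s + d + 1))) : ℝ) : ℂ)) ?_ ?_ j)
  · intro X hX hX1
    have hσ1 : 1 < (1 - X)⁻¹ := (one_lt_inv₀ (by linarith)).2 (by linarith)
    have hX' : 0 < 1 - X := by linarith
    have hD : 0 < 1 - (1 - μ) * X := by nlinarith
    have hτ : ((1 - X)⁻¹ - 1 / 2 + a / 2)⁻¹ = (1 - X) * μ * (1 - (1 - μ) * X)⁻¹ := by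
      rw [inv_eq_iff_eq_inv, mul_inv, mul_inv, inv_inv]
      field_simp
      linear_combination (1 - X) * hμa
    have h1 := (hL _ hσ1).mul_left ((((1 - X)⁻¹ : ℝ) : ℂ) ^ (d + 1))
    have hval : ((((1 - X)⁻¹ : ℝ) : ℂ) ^ (d + 1)) * (z * ((Real.sqrt (n + d).factorial /
        Real.sqrt n.factorial * (((1 - X)⁻¹ - 1 / 2 + a / 2)⁻¹ ^ (d + 1) *
          (1 - c * ((1 - X)⁻¹ - 1 / 2 + a / 2)⁻¹) ^ n) : ℝ) : ℂ)) =
        z * ((Real.sqrt (n + d).factorial / Real.sqrt n.factorial * μ ^ (d + 1) *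
      (∑ s ∈ Finset.range (n + 1), n.choose s * (1 - c * μ) ^ (n - s) * (c * μ * μ) ^ s * X ^ s *
        (1 / (1 - (1 - μ) * X) ^ (s + d + 1))) : ℝ) : ℂ) := by
      have e1 : 1 - c * ((1 - X) * μ * (1 - (1 - μ) * X)⁻¹) =
          c * μ * μ * X * (1 - (1 - μ) * X)⁻¹ + (1 - c * μ) := by
        linear_combination (-c * μ) * mul_inv_cancel₀ hD.ne'
      have e2 : ((1 - X)⁻¹) ^ (d + 1) * ((1 - X) * μ * (1 - (1 - μ) * X)⁻¹) ^ (d + 1) =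
          μ ^ (d + 1) * ((1 - (1 - μ) * X)⁻¹) ^ (d + 1) := by
        rw [← mul_pow, ← mul_pow]
        congr 1
        field_simp
      rw [hτ, e1, add_pow, mul_left_comm, ← Complex.ofReal_pow, ← Complex.ofReal_mul]
      congr 2
      rw [mul_left_comm, ← mul_assoc (((1 - X)⁻¹) ^ (d + 1)), e2,
        mul_assoc (Real.sqrt (n + d).factorial / Real.sqrt n.factorial), mul_assoc (μ ^ (d + 1))]
      congr 2
      rw [Finset.mul_sum]
      refine Finset.sum_congr rfl fun s _ => ?_
      rw [mul_pow _ ((1 - (1 - μ) * X)⁻¹), mul_pow _ X, one_div, ← inv_pow, add_assoc s,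
        pow_add _ s]
      ring
    rw [hval] at h1
    refine h1.congr_fun fun j => ?_
    have hne : ((1 - X : ℝ) : ℂ) ≠ 0 := Complex.ofReal_ne_zero.2 hX'.ne'
    have e3 : (((1 - X)⁻¹ : ℝ) : ℂ) ^ (d + 1) * ((1 - X : ℝ) : ℂ) ^ (d + 1) = 1 := by
      rw [← mul_pow, Complex.ofReal_inv, inv_mul_cancel₀ hne, one_pow]
    rw [inv_inv, sub_sub_cancel]
    simp only [Complex.ofReal_mul, Complex.ofReal_pow (1 - X), Complex.ofReal_pow X]
    linear_combination (-y j * ((Real.sqrt (j + d).factorial / Real.sqrt j.factorial : ℝ) : ℂ) *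
      (X : ℂ) ^ j) * e3
  · intro X hX hX1
    have hr : ‖(((1 - μ) * X : ℝ) : ℂ)‖ < 1 := by
      rw [Complex.norm_real, Real.norm_eq_abs, abs_lt]
      constructor <;> nlinarith
    have h1 := hasSum_sum (s := Finset.range (n + 1)) fun s _ =>
      (hasSum_shift (hasSum_choose_mul_geometric_of_norm_lt_one (s + d) hr) s).mul_left
        (((n.choose s * (1 - c * μ) ^ (n - s) * (c * μ * μ) ^ s * X ^ s : ℝ)) : ℂ)
    have h2 := h1.mul_left (z * ((Real.sqrt (n + d).factorial / Real.sqrt n.factorial *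
      μ ^ (d + 1) : ℝ) : ℂ))
    have hval : z * ((Real.sqrt (n + d).factorial / Real.sqrt n.factorial * μ ^ (d + 1) *
      (∑ s ∈ Finset.range (n + 1), n.choose s * (1 - c * μ) ^ (n - s) * (c * μ * μ) ^ s * X ^ s *
        (1 / (1 - (1 - μ) * X) ^ (s + d + 1))) : ℝ) : ℂ) = z * ((Real.sqrt (n + d).factorial /
        Real.sqrt n.factorial * μ ^ (d + 1) : ℝ) : ℂ) * ∑ s ∈ Finset.range (n + 1),
        (((n.choose s * (1 - c * μ) ^ (n - s) * (c * μ * μ) ^ s * X ^ s : ℝ)) : ℂ) *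
        (1 / (1 - (((1 - μ) * X : ℝ) : ℂ)) ^ (s + d + 1)) := by
      push_cast
      ring
    rw [← hval] at h2
    refine h2.congr_fun fun j => ?_
    rw [Complex.ofReal_mul, ← mul_assoc, mul_assoc]
    congr 1
    rw [Complex.ofReal_sum, Finset.sum_mul]
    refine Finset.sum_congr rfl fun s _ => ?_
    split_ifs with hs
    · have e1 : j - s + (s + d) = j + d := by omega
      have e2 : (X : ℂ) ^ j = (X : ℂ) ^ s * (X : ℂ) ^ (j - s) := by
        rw [← pow_add, Nat.add_sub_of_le hs]
      rw [e1, e2]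
      push_cast
      rw [mul_pow _ (X : ℂ)]
      ring
    · simp


end Laplace

/-! ### Gauge-covariant Gaussian channels -/

section Channel

variable {H : Type*} [NormedAddCommGroup H] [InnerProductSpace ℂ H] [CompleteSpace H]
  {b : HilbertBasis ℕ ℂ H} {Φ : (H →L[ℂ] H) → (H →L[ℂ] H)}

open scoped ComplexOrder in
theorem IsQuantumChannel.isPositive (hΦ : IsQuantumChannel b Φ) {X : H →L[ℂ] H}
    (hX : X.IsPositive) (ht : IsTraceClass b X) : (Φ X).IsPositive := by
  have h := hΦ.completelyPositive 1 (fun _ _ => X) (fun _ _ => ht) (fun v => by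
    simpa using hX.inner_nonneg_right (v 0))
  rw [ContinuousLinearMap.isPositive_iff_complex]
  intro v
  have h1 : 0 ≤ inner ℂ v (Φ X v) := by simpa using h fun _ => v
  have h2 := RCLike.nonneg_iff.1 h1
  have h3 : inner ℂ (Φ X v) v = inner ℂ v (Φ X v) := by
    rw [← inner_conj_symm, RCLike.conj_eq_iff_im.2 h2.2]
  rw [h3]
  refine ⟨?_, h2.1⟩
  apply Complex.ext
  · simp
  · simpa using h2.2.symm

theorem inner_apply_of_apply_basis {Y : H →L[ℂ] H} {y : ℕ → ℂ} {d : ℕ}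
    (hY : ∀ j, Y (b j) = y j • b (j + d)) (j : ℕ) (v : H) :
    inner ℂ (b (j + d)) (Y v) = y j * inner ℂ (b j) v := by
  have h : ContinuousLinearMap.adjoint Y (b (j + d)) = (starRingEnd ℂ (y j)) • b j := by
    refine eq_of_inner_basis b fun i => ?_
    rw [ContinuousLinearMap.adjoint_inner_right, hY, inner_smul_left, inner_smul_right,
      orthonormal_iff_ite.1 b.orthonormal, orthonormal_iff_ite.1 b.orthonormal]
    by_cases hij : i = j <;> simp [hij]
  rw [← ContinuousLinearMap.adjoint_inner_left, h, inner_smul_left, RCLike.conj_conj]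

theorem inner_apply_of_apply_basis_of_lt {Y : H →L[ℂ] H} {y : ℕ → ℂ} {d : ℕ}
    (hY : ∀ j, Y (b j) = y j • b (j + d)) {m : ℕ} (hm : m < d) (v : H) :
    inner ℂ (b m) (Y v) = 0 := by
  have h : ContinuousLinearMap.adjoint Y (b m) = 0 := by
    refine eq_of_inner_basis b fun i => ?_
    rw [ContinuousLinearMap.adjoint_inner_right, hY, inner_smul_left,
      orthonormal_iff_ite.1 b.orthonormal, if_neg (by omega)]
    simp
  rw [← ContinuousLinearMap.adjoint_inner_left, h, inner_zero_left]

/-- The characteristic function of an operator supported on the `d`-th lower diagonal. -/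
theorem characteristicFunction_of_apply_basis {Y : H →L[ℂ] H} {y : ℕ → ℂ} {d : ℕ}
    (hY : ∀ j, Y (b j) = y j • b (j + d)) (k : Fin 2 → ℝ) :
    characteristicFunction b Y k = ∑' j, y j * inner ℂ (b j) (weylFock b k (j + d)) := by
  rw [characteristicFunction, ← (add_left_injective d).tsum_eq]
  · exact tsum_congr fun j => inner_apply_of_apply_basis hY j _
  · intro m hm
    by_contra h
    refine hm (inner_apply_of_apply_basis_of_lt hY ?_ _)
    by_contra h'
    exact h ⟨m - d, Nat.sub_add_cancel (not_lt.1 h')⟩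

theorem norm_inner_weylFock_le (b : HilbertBasis ℕ ℂ H) (k : Fin 2 → ℝ) (j n : ℕ) :
    ‖inner ℂ (b j) (weylFock b k n)‖ ≤ 1 := by
  refine (norm_inner_le_norm _ _).trans ?_
  rw [b.orthonormal.1, norm_weylFock, one_mul]

theorem inner_timeEvolution (b : HilbertBasis ℕ ℂ H) (t : ℝ) (j : ℕ) (v : H) :
    inner ℂ (b j) (timeEvolution b t v) =
      Complex.exp (((-(t * j) : ℝ) : ℂ) * Complex.I) * inner ℂ (b j) v := by
  have hY : ∀ i, timeEvolution b t (b i) =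
      Complex.exp (((-(t * i) : ℝ) : ℂ) * Complex.I) • b (i + 0) := timeEvolution_apply b t
  exact inner_apply_of_apply_basis hY j v

theorem timeEvolution_mul_rankOne (b : HilbertBasis ℕ ℂ H) (t : ℝ) (m n : ℕ) :
    timeEvolution b t * rankOne ℂ (b m) (b n) * timeEvolution b (-t) =
      Complex.exp (((t * (n - m) : ℝ) : ℂ) * Complex.I) • rankOne ℂ (b m) (b n) := by
  refine clm_ext_basis b fun k => ?_
  simp only [mul_apply_eq_comp, timeEvolution_apply, map_smul, InnerProductSpace.rankOne_apply,
    smul_apply, orthonormal_iff_ite.1 b.orthonormal, smul_smul]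
  split_ifs with h
  · subst h
    rw [mul_one, one_mul, ← Complex.exp_add]
    congr 2
    push_cast
    ring
  · simp

/-- Gauge covariance: `Φ` maps each diagonal of the Fock matrix to itself. -/
theorem IsGaugeCovariant.inner_eq_zero (hgauge : IsGaugeCovariant b Φ) (hΦ : IsQuantumChannel b Φ)
    {j k m n : ℕ} (h : j + n ≠ k + m) :
    inner ℂ (b j) (Φ (rankOne ℂ (b m) (b n)) (b k)) = 0 := by
  set δ : ℝ := (j : ℝ) + n - (k + m) with hδ
  have hδ0 : δ ≠ 0 := by
    intro h0
    apply h
    have : (j : ℝ) + n = k + m := by linarith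
    exact_mod_cast this
  have hX := isTraceClass_rankOne b (b m) (b n)
  -- conjugation by the evolution over the time `π / δ` multiplies this matrix element by `-1`
  have h1 := hgauge (Real.pi / δ) _ hX
  rw [timeEvolution_mul_rankOne, hΦ.map_smul _ _ hX] at h1
  have h2 := congrArg (fun Z : H →L[ℂ] H => inner ℂ (b j) (Z (b k))) h1
  simp only [smul_apply, mul_apply_eq_comp, timeEvolution_apply, map_smul, inner_smul_right,
    inner_timeEvolution] at h2
  set E := inner ℂ (b j) (Φ (rankOne ℂ (b m) (b n)) (b k))
  rw [← mul_assoc, ← Complex.exp_add] at h2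
  have h3 : Complex.exp (((Real.pi / δ * (n - m) : ℝ) : ℂ) * Complex.I) =
      -Complex.exp (((-(-(Real.pi / δ) * k) : ℝ) : ℂ) * Complex.I +
        ((-(Real.pi / δ * j) : ℝ) : ℂ) * Complex.I) := by
    rw [neg_eq_neg_one_mul, ← Complex.exp_pi_mul_I, ← Complex.exp_add, ← add_mul, ← add_mul,
      ← Complex.ofReal_add, ← Complex.ofReal_add]
    congr 3
    field_simp
    rw [hδ]
    ring
  rw [h3] at h2
  have h4 : Complex.exp (((-(-(Real.pi / δ) * k) : ℝ) : ℂ) * Complex.I +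
        ((-(Real.pi / δ * j) : ℝ) : ℂ) * Complex.I) * E = 0 := by linear_combination (-1 / 2) * h2
  exact (mul_eq_zero.1 h4).resolve_left (Complex.exp_ne_zero _)

theorem IsGaugeCovariant.apply_basis (hgauge : IsGaugeCovariant b Φ) (hΦ : IsQuantumChannel b Φ)
    (n d j : ℕ) : Φ (rankOne ℂ (b (n + d)) (b n)) (b j) =
      inner ℂ (b (j + d)) (Φ (rankOne ℂ (b (n + d)) (b n)) (b j)) • b (j + d) := by
  refine eq_of_inner_basis b fun i => ?_
  rw [inner_smul_right, orthonormal_iff_ite.1 b.orthonormal]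
  by_cases h : i = j + d
  · simp [h]
  · rw [if_neg h, mul_zero]
    exact hgauge.inner_eq_zero hΦ (by omega)

open Matrix in
/-- The action of a gauge-covariant Gaussian channel on the characteristic functions of the
operators `|n+d⟩⟨n|`, along one ray in phase space. -/
theorem IsGaussianChannel.exists_hasSum (hΦ : IsGaussianChannel b Φ)
    (hgauge : IsGaugeCovariant b Φ) : ∃ (α v : ℝ) (η : ℂ), ∀ (n d : ℕ) (r : ℝ),
      HasSum (fun j => inner ℂ (b (j + d)) (Φ (rankOne ℂ (b (n + d)) (b n)) (b j)) *
        ((Real.sqrt j.factorial / Real.sqrt (j + d).factorial : ℝ) * (-(r : ℂ)) ^ d *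
          (Real.exp (-r ^ 2 / 2) * laguerre j d (r ^ 2) : ℝ)))
        (Complex.exp (-(α * r ^ 2 / 2) + Complex.I * (v * r)) *
          ((Real.sqrt n.factorial / Real.sqrt (n + d).factorial : ℝ) *
          (-((r : ℂ) * starRingEnd ℂ η)) ^ d *
          (Real.exp (-(‖η‖ ^ 2 * r ^ 2) / 2) * laguerre n d (‖η‖ ^ 2 * r ^ 2) : ℝ))) := by
  obtain ⟨M, α, y, -, hG⟩ := hΦ.gaussian
  refine ⟨α 1 1, -Real.sqrt 2 * y 1, (M 1 1 : ℂ) - Complex.I * M 1 0, fun n d r => ?_⟩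
  set η : ℂ := (M 1 1 : ℂ) - Complex.I * M 1 0
  have h2 : ((Real.sqrt 2 : ℝ) : ℂ) ≠ 0 :=
    Complex.ofReal_ne_zero.2 (Real.sqrt_ne_zero'.2 two_pos)
  have h22 : ((Real.sqrt 2 : ℝ) : ℂ) * ((Real.sqrt 2 : ℝ) : ℂ) = 2 := by
    rw [← Complex.ofReal_mul, Real.mul_self_sqrt two_pos.le]
    rfl
  -- the point of phase space with amplitude `r`
  let k : Fin 2 → ℝ := ![0, -Real.sqrt 2 * r]
  have hk : displacement k = r := by
    simp [displacement, k, h2]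
  have hkM : displacement (k ᵥ* M) = r * η := by
    simp [displacement, k, Matrix.vecMul, dotProduct, Fin.sum_univ_two, η]
    field_simp
    rw [sub_eq_add_neg]
  have hexp : -(1 / 4) * ((k ⬝ᵥ (α *ᵥ k) : ℝ) : ℂ) + Complex.I * ((k ⬝ᵥ y : ℝ) : ℂ) =
      -(((α 1 1 : ℝ) : ℂ) * r ^ 2 / 2) + Complex.I * (((-Real.sqrt 2 * y 1 : ℝ) : ℂ) * r) := by
    simp [k, Matrix.mulVec, dotProduct, Fin.sum_univ_two]
    linear_combination (-(1 / 4) * (r : ℂ) ^ 2 * (α 1 1 : ℂ)) * h22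
  have hX := isTraceClass_rankOne b (b (n + d)) (b n)
  have hY := hgauge.apply_basis hΦ.toIsQuantumChannel n d
  have hy := summable_norm_of_apply_basis hY (hΦ.mapsTo _ hX)
  have hs : HasSum (fun j => inner ℂ (b (j + d)) (Φ (rankOne ℂ (b (n + d)) (b n)) (b j)) *
      inner ℂ (b j) (weylFock b k (j + d)))
      (characteristicFunction b (Φ (rankOne ℂ (b (n + d)) (b n))) k) := by
    rw [characteristicFunction_of_apply_basis hY]
    refine (Summable.of_norm_bounded hy fun j => ?_).hasSum
    rw [norm_mul]
    exact mul_le_of_le_one_right (norm_nonneg _) (norm_inner_weylFock_le b k j _)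
  have hX' : ∀ j, rankOne ℂ (b (n + d)) (b n) (b j) =
      (if n = j then (1 : ℂ) else 0) • b (j + d) := by
    intro j
    rw [InnerProductSpace.rankOne_apply, orthonormal_iff_ite.1 b.orthonormal]
    split_ifs with h
    · rw [h]
    · simp
  rw [hG _ hX, hexp, characteristicFunction_of_apply_basis hX', tsum_eq_single n (fun j hj => by
    rw [if_neg hj.symm, zero_mul]), if_pos rfl, one_mul, inner_weylFock, hkM] at hs
  simp only [inner_weylFock, hk] at hs
  have e1 : ‖(r : ℂ) * η‖ ^ 2 = ‖η‖ ^ 2 * r ^ 2 := by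
    rw [norm_mul, mul_pow, Complex.norm_real, Real.norm_eq_abs, sq_abs, mul_comm]
  have e2 : ‖(r : ℂ)‖ ^ 2 = r ^ 2 := by
    rw [Complex.norm_real, Real.norm_eq_abs, sq_abs]
  rw [e1, map_mul, Complex.conj_ofReal] at hs
  rw [e2] at hs
  exact hs

end Channel

/-! ### Products of an attenuator and the adjoint of an attenuator -/

section AttenuatorForm

theorem choose_mul_factorial (t d j : ℕ) (h : t ≤ j) :
    ((j + d).choose (t + d) : ℝ) * (t + d).factorial * j.factorial =
      j.choose t * t.factorial * (j + d).factorial := by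
  have h1 := Nat.choose_mul_factorial_mul_factorial (show t + d ≤ j + d by omega)
  have h2 := Nat.choose_mul_factorial_mul_factorial h
  rw [show j + d - (t + d) = j - t by omega] at h1
  have h3 : (j - t).factorial * ((j + d).choose (t + d) * (t + d).factorial * j.factorial) =
      (j - t).factorial * (j.choose t * t.factorial * (j + d).factorial) := by
    rw [← h1, ← h2]
    ring
  exact_mod_cast Nat.eq_of_mul_eq_mul_left (j - t).factorial_pos h3

theorem sqrt_choose_mul_choose (t d j : ℕ) (h : t ≤ j) :
    Real.sqrt (j + d).factorial / Real.sqrt j.factorial *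
        Real.sqrt ((j + d).choose (t + d) * j.choose t) =
      (j + d).choose (t + d) * (Real.sqrt (t + d).factorial / Real.sqrt t.factorial) := by
  have h1 : (0 : ℝ) < j.factorial := by positivity
  have h2 : (0 : ℝ) < t.factorial := by positivity
  rw [← Real.sqrt_div (by positivity), ← Real.sqrt_div (by positivity),
    ← Real.sqrt_mul (by positivity)]
  have e : ((j + d).choose (t + d) : ℝ) = Real.sqrt (((j + d).choose (t + d) : ℝ) ^ 2) := by
    rw [Real.sqrt_sq (by positivity)]
  nth_rw 2 [e]
  rw [← Real.sqrt_mul (by positivity)]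
  congr 1
  field_simp
  linear_combination (-(j + d).choose (t + d) : ℝ) * choose_mul_factorial t d j h

theorem sqrt_choose_mul_choose' (t d n : ℕ) (h : t ≤ n) :
    Real.sqrt (t + d).factorial / Real.sqrt t.factorial *
        Real.sqrt ((n + d).choose (t + d) * n.choose t) =
      Real.sqrt (n + d).factorial / Real.sqrt n.factorial * n.choose t := by
  have h1 : (0 : ℝ) < n.factorial := by positivity
  have h2 : (0 : ℝ) < t.factorial := by positivity
  rw [← Real.sqrt_div (by positivity), ← Real.sqrt_div (by positivity),
    ← Real.sqrt_mul (by positivity)]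
  have e : (n.choose t : ℝ) = Real.sqrt ((n.choose t : ℝ) ^ 2) := by
    rw [Real.sqrt_sq (by positivity)]
  nth_rw 2 [e]
  rw [← Real.sqrt_mul (by positivity)]
  congr 1
  field_simp
  linear_combination (n.choose t : ℝ) * choose_mul_factorial t d n h

theorem attenuator_swap (lam : ℝ) (s t m n : ℕ) :
    attenuator lam s t m n = attenuator lam t s n m := by
  unfold attenuator
  by_cases h : s ≤ m ∧ m + t = n + s
  · rw [if_pos h, if_pos (by omega), mul_comm (m.choose s : ℝ), add_comm s t,
      show m - s = n - t by omega]
  · rw [if_neg h, if_neg (by omega)]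

/-- The Fock-basis kernel of an attenuator with transmissivity `lam` followed by the adjoint of an
attenuator with transmissivity `μ`. -/
noncomputable def gaussianKernel (μ lam : ℝ) (j k m n : ℕ) : ℝ :=
  ∑ s ∈ Finset.range (m + 1), ∑ t ∈ Finset.range (n + 1),
    attenuator μ s t j k * attenuator lam s t m n

theorem gaussianKernel_swap (μ lam : ℝ) (j k m n : ℕ) :
    gaussianKernel μ lam j k m n = gaussianKernel μ lam k j n m := by
  unfold gaussianKernel
  rw [Finset.sum_comm]
  refine Finset.sum_congr rfl fun t _ => Finset.sum_congr rfl fun s _ => ?_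
  rw [attenuator_swap, attenuator_swap lam]

theorem gaussianKernel_eq_zero {μ lam : ℝ} {j k m n : ℕ} (h : j + n ≠ k + m) :
    gaussianKernel μ lam j k m n = 0 := by
  refine Finset.sum_eq_zero fun s _ => Finset.sum_eq_zero fun t _ => ?_
  unfold attenuator
  split_ifs with h1 h2
  · omega
  all_goals simp

theorem gaussianKernel_eq_sum {M m n : ℕ} (μ lam : ℝ) (j k : ℕ) (hm : m ≤ M) (hn : n ≤ M) :
    gaussianKernel μ lam j k m n = ∑ s ∈ Finset.range (M + 1), ∑ t ∈ Finset.range (M + 1),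
      attenuator μ s t j k * attenuator lam s t m n := by
  have hz : ∀ s t, (m < s ∨ n < t) → attenuator μ s t j k * attenuator lam s t m n = 0 := by
    intro s t h
    have : attenuator lam s t m n = 0 := by
      unfold attenuator
      rw [if_neg (by omega)]
    rw [this, mul_zero]
  unfold gaussianKernel
  rw [← Finset.sum_subset (Finset.range_mono (by omega : m + 1 ≤ M + 1)) fun s _ hs =>
    Finset.sum_eq_zero fun t _ => hz s t (Or.inl (by simpa using hs))]
  refine Finset.sum_congr rfl fun s _ => ?_
  exact Finset.sum_subset (Finset.range_mono (by omega)) fun t _ ht =>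
    hz s t (Or.inr (by simpa using ht))

/-- The coefficients found by Laplace inversion are the values of `gaussianKernel`. -/
theorem factorial_mul_gaussianKernel {μ e : ℝ} (hμ : 0 ≤ μ) (he : 0 ≤ e) (j n d : ℕ) :
    Real.sqrt (j + d).factorial / Real.sqrt j.factorial *
        (μ * gaussianKernel μ (e ^ 2 * μ) (j + d) j (n + d) n) =
      e ^ d * (Real.sqrt (n + d).factorial / Real.sqrt n.factorial * μ ^ (d + 1) *
        ∑ s ∈ Finset.range (n + 1), if s ≤ j then
          n.choose s * (1 - e ^ 2 * μ) ^ (n - s) * (e ^ 2 * μ * μ) ^ s *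
            ((j + d).choose (s + d) * (1 - μ) ^ (j - s)) else 0) := by
  have hroot : Real.sqrt μ * Real.sqrt (e ^ 2 * μ) = e * μ := by
    rw [← Real.sqrt_mul hμ, show μ * (e ^ 2 * μ) = (e * μ) ^ 2 by ring,
      Real.sqrt_sq (by positivity)]
  have hterm : ∀ t ∈ Finset.range (n + 1), ∑ s ∈ Finset.range (n + d + 1),
      attenuator μ s t (j + d) j * attenuator (e ^ 2 * μ) s t (n + d) n = if t ≤ j then
        Real.sqrt ((j + d).choose (t + d) * j.choose t) * (1 - μ) ^ (j - t) *
        (Real.sqrt ((n + d).choose (t + d) * n.choose t) * (1 - e ^ 2 * μ) ^ (n - t)) *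
          (e * μ) ^ (t + d + t) else 0 := by
    intro t ht
    have htn : t ≤ n := Nat.lt_succ_iff.1 (Finset.mem_range.1 ht)
    rw [Finset.sum_eq_single_of_mem (t + d) (Finset.mem_range.2 (by omega)) fun s _ hs => by
      unfold attenuator
      rw [if_neg (by omega), zero_mul]]
    unfold attenuator
    by_cases h : t ≤ j
    · rw [if_pos (by omega), if_pos (by omega), if_pos h, ← hroot, mul_pow,
        show j + d - (t + d) = j - t by omega, show n + d - (t + d) = n - t by omega]
      ring
    · rw [if_neg (by omega), if_neg h, zero_mul]
  unfold gaussianKernel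
  rw [Finset.sum_comm, Finset.sum_congr rfl hterm]
  simp only [Finset.mul_sum]
  refine Finset.sum_congr rfl fun t ht => ?_
  have htn : t ≤ n := Nat.lt_succ_iff.1 (Finset.mem_range.1 ht)
  split_ifs with h
  · have e1 := sqrt_choose_mul_choose t d j h
    have e2 := sqrt_choose_mul_choose' t d n htn
    have e3 : (e * μ) ^ (t + d + t) = (e ^ 2 * μ * μ) ^ t * (e ^ d * μ ^ d) := by
      rw [show e ^ 2 * μ * μ = (e * μ) * (e * μ) by ring, mul_pow (e * μ) (e * μ), ← mul_pow,
        pow_add, pow_add]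
      ring
    rw [e3]
    set A := Real.sqrt ((j + d).choose (t + d) * j.choose t : ℝ)
    set B := Real.sqrt ((n + d).choose (t + d) * n.choose t : ℝ)
    set C := μ * (1 - μ) ^ (j - t) * (1 - e ^ 2 * μ) ^ (n - t) * ((e ^ 2 * μ * μ) ^ t *
      (e ^ d * μ ^ d))
    calc _ = (Real.sqrt (j + d).factorial / Real.sqrt j.factorial * A) * B * C := by ring
      _ = (j + d).choose (t + d) * (Real.sqrt (t + d).factorial / Real.sqrt t.factorial * B) * C :=
        by
        rw [e1]; ring
      _ = _ := by rw [e2]; ring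
  · simp

end AttenuatorForm

/-! ### Identification of the channel -/

section Identification

variable {H : Type*} [NormedAddCommGroup H] [InnerProductSpace ℂ H] [CompleteSpace H]
  {b : HilbertBasis ℕ ℂ H} {Φ : (H →L[ℂ] H) → (H →L[ℂ] H)}

theorem displacement_ray (r : ℝ) : displacement ![0, -Real.sqrt 2 * r] = r := by
  have h2 : ((Real.sqrt 2 : ℝ) : ℂ) ≠ 0 :=
    Complex.ofReal_ne_zero.2 (Real.sqrt_ne_zero'.2 two_pos)
  simp [displacement, h2]

/-- The Laguerre functions are bounded, being matrix elements of unitary operators. -/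
theorem abs_laguerre_le (b : HilbertBasis ℕ ℂ H) (j d : ℕ) {x : ℝ} (hx : 0 ≤ x) :
    |Real.sqrt j.factorial / Real.sqrt (j + d).factorial *
      (Real.exp (-x / 2) * laguerre j d x)| * Real.sqrt x ^ d ≤ 1 := by
  have h := norm_inner_weylFock_le b ![0, -Real.sqrt 2 * Real.sqrt x] j (j + d)
  rw [inner_weylFock, displacement_ray, Complex.conj_ofReal, Complex.norm_real,
    Real.norm_of_nonneg (Real.sqrt_nonneg x), Real.sq_sqrt hx, norm_mul, norm_mul, norm_pow,
    norm_neg, Complex.norm_real, Complex.norm_real, Complex.norm_real,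
    Real.norm_of_nonneg (Real.sqrt_nonneg x), mul_right_comm] at h
  rwa [abs_mul]

theorem laguerre_zero (d : ℕ) (x : ℝ) : laguerre 0 d x = 1 := by
  simp [laguerre]

/-- Every gauge-covariant Gaussian channel is, up to the factor `μ` and a phase rotation, an
attenuator followed by the adjoint of an attenuator. -/
theorem IsGaussianChannel.exists_gaussianKernel (hΦ : IsGaussianChannel b Φ)
    (hgauge : IsGaugeCovariant b Φ) : ∃ μ lam θ : ℝ, 0 ≤ μ ∧ μ ≤ 1 ∧ 0 ≤ lam ∧ lam ≤ 1 ∧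
      ∀ j k m n : ℕ, inner ℂ (b j) (Φ (rankOne ℂ (b m) (b n)) (b k)) =
        Complex.exp (((θ * (m - n) : ℝ) : ℂ) * Complex.I) *
          ((μ * gaussianKernel μ lam j k m n : ℝ) : ℂ) := by
  obtain ⟨α, v, η, h⟩ := hΦ.exists_hasSum hgauge
  have hX : ∀ n d, IsTraceClass b (rankOne ℂ (b (n + d)) (b n)) := fun n d =>
    isTraceClass_rankOne b _ _
  let y : ℕ → ℕ → ℕ → ℂ := fun n d j =>
    inner ℂ (b (j + d)) (Φ (rankOne ℂ (b (n + d)) (b n)) (b j))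
  have hy : ∀ n d, Summable fun j => ‖y n d j‖ := fun n d =>
    summable_norm_of_apply_basis (hgauge.apply_basis hΦ.toIsQuantumChannel n d)
      (hΦ.mapsTo _ (hX n d))
  have hpos : ∀ n j, 0 ≤ (y n 0 j).re ∧ (y n 0 j).im = 0 := by
    intro n j
    have hp := hΦ.isPositive (InnerProductSpace.isPositive_rankOne_self (b n))
      (isTraceClass_rankOne b _ _)
    exact RCLike.nonneg_iff.1 (hp.inner_nonneg_right (b j))
  -- evenness in `r` of the output for the vacuum forces the displacement to vanish
  have hv : v = 0 := by
    by_contra hv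
    have e := (h 0 0 (Real.pi / (2 * v))).unique (by simpa using h 0 0 (-(Real.pi / (2 * v))))
    simp [laguerre_zero] at e
    rw [Complex.exp_add, Complex.exp_add] at e
    have e1 := mul_left_cancel₀ (Complex.exp_ne_zero _) e
    have hvC : (v : ℂ) ≠ 0 := Complex.ofReal_ne_zero.2 hv
    have e2 : Complex.I * ((v : ℂ) * (Real.pi / (2 * v))) = Real.pi / 2 * Complex.I := by
      field_simp
    rw [e2] at e1
    have e3 : Complex.exp (Real.pi / 2 * Complex.I) *
        Complex.exp (Real.pi / 2 * Complex.I) = -1 := by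
      rw [← Complex.exp_add, ← Complex.exp_pi_mul_I]
      congr 1
      ring
    have e4 : Complex.exp (-(Real.pi / 2 * Complex.I)) * Complex.exp (Real.pi / 2 * Complex.I) =
      1 := by
      rw [← Complex.exp_add, neg_add_cancel, Complex.exp_zero]
    rw [← e1, e3] at e4
    norm_num at e4
  subst hv
  have ha : 0 ≤ α + ‖η‖ ^ 2 := by
    have htr : ∑' j, y 0 0 j = 1 := by
      refine (hΦ.map_trace _ (hX 0 0)).trans ?_
      rw [trace, tsum_eq_single 0 fun n hn => by
        simp [orthonormal_iff_ite.1 b.orthonormal, hn.symm]]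
      simp [b.orthonormal.1]
    have hnorm : HasSum (fun j => ‖y 0 0 j‖) 1 := by
      have h1 := Complex.hasSum_re (hy 0 0).of_norm.hasSum
      rw [htr, Complex.one_re] at h1
      refine h1.congr_fun fun j => ?_
      obtain ⟨h2, h3⟩ := hpos 0 j
      rw [← Complex.abs_re_eq_norm.2 h3, abs_of_nonneg h2]
    have h1 := (h 0 0 1).norm_le_of_bounded hnorm fun j => by
      have h2 := abs_laguerre_le b j 0 zero_le_one
      rw [pow_zero, mul_one] at h2
      rw [norm_mul]
      refine mul_le_of_le_one_right (norm_nonneg _) ?_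
      rw [pow_zero, mul_one, ← Complex.ofReal_mul, Complex.norm_real, one_pow]
      exact h2
    simp [laguerre_zero] at h1
    have e1 : -((α : ℂ) / 2) = ((-(α / 2) : ℝ) : ℂ) := by push_cast; ring
    have e2 : -(‖η‖ : ℂ) ^ 2 / 2 = ((-(‖η‖ ^ 2 / 2) : ℝ) : ℂ) := by push_cast; ring
    rw [e1, e2, Complex.norm_exp, Complex.norm_exp, Complex.ofReal_re, Complex.ofReal_re,
      ← Real.exp_add, Real.exp_le_one_iff] at h1
    linarith
  set a := α + ‖η‖ ^ 2
  set μ := 2 / (1 + a) with hμ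
  have hμ0 : 0 < μ := by positivity
  have hcoeff : ∀ n d j, y n d j * ((Real.sqrt (j + d).factorial / Real.sqrt j.factorial : ℝ) : ℂ) =
      (starRingEnd ℂ η) ^ d * ((Real.sqrt (n + d).factorial / Real.sqrt n.factorial * μ ^ (d + 1) *
        ∑ s ∈ Finset.range (n + 1), if s ≤ j then
          n.choose s * (1 - ‖η‖ ^ 2 * μ) ^ (n - s) * (‖η‖ ^ 2 * μ * μ) ^ s *
            ((j + d).choose (s + d) * (1 - μ) ^ (j - s)) else 0 : ℝ) : ℂ) := by
    intro n d j
    refine coeff_eq_of_laguerre ha (hy n d) ?_ ?_ j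
    · exact fun j x hx => abs_laguerre_le b j d hx.le
    · intro x hx
      have hsx : (-(Real.sqrt x : ℂ)) ^ d ≠ 0 :=
        pow_ne_zero _ (neg_ne_zero.2 (Complex.ofReal_ne_zero.2 (Real.sqrt_pos.2 hx).ne'))
      have h1 := (h n d (Real.sqrt x)).mul_left ((-(Real.sqrt x : ℂ)) ^ d)⁻¹
      have hval : ((-(Real.sqrt x : ℂ)) ^ d)⁻¹ * (Complex.exp (-(α * Real.sqrt x ^ 2 / 2) +
          Complex.I * ((0 : ℝ) * Real.sqrt x)) * ((Real.sqrt n.factorial /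
          Real.sqrt (n + d).factorial : ℝ) * (-((Real.sqrt x : ℂ) * starRingEnd ℂ η)) ^ d *
          (Real.exp (-(‖η‖ ^ 2 * Real.sqrt x ^ 2) / 2) *
            laguerre n d (‖η‖ ^ 2 * Real.sqrt x ^ 2) : ℝ))) = (starRingEnd ℂ η) ^ d *
          ((Real.sqrt n.factorial / Real.sqrt (n + d).factorial *
            (Real.exp (-(a * x) / 2) * laguerre n d (‖η‖ ^ 2 * x)) : ℝ) : ℂ) := by
        have e1 : Complex.exp (-(α * Real.sqrt x ^ 2 / 2) +
            Complex.I * ((0 : ℝ) * Real.sqrt x)) = ((Real.exp (-(α * x / 2)) : ℝ) : ℂ) := by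
          rw [← Complex.ofReal_pow, Real.sq_sqrt hx.le]
          push_cast
          congr 1
          ring
        have e2 : Real.exp (-(a * x) / 2) = Real.exp (-(α * x / 2)) *
            Real.exp (-(‖η‖ ^ 2 * x) / 2) := by
          rw [← Real.exp_add]
          congr 1
          simp only [a]
          ring
        rw [e1, e2, Real.sq_sqrt hx.le, ← neg_mul, mul_pow (-(Real.sqrt x : ℂ))]
        push_cast
        field_simp
      rw [hval] at h1
      refine h1.congr_fun fun j => ?_
      rw [Real.sq_sqrt hx.le, show inner ℂ (b (j + d)) (Φ (rankOne ℂ (b (n + d)) (b n)) (b j)) =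
        y n d j from rfl]
      push_cast
      field_simp
  have hμ1 : μ ≤ 1 := by
    have h1 := hcoeff 0 0 1
    have h2 := (hpos 0 1).1
    simp at h1
    rw [h1] at h2
    norm_cast at h2
    by_contra hlt
    nlinarith
  have hlam1 : ‖η‖ ^ 2 * μ ≤ 1 := by
    have h1 := hcoeff 1 0 0
    have h2 := (hpos 1 0).1
    simp at h1
    rw [h1] at h2
    norm_cast at h2
    by_contra hlt
    nlinarith
  have hle : ∀ n d j, y n d j = Complex.exp (((-Complex.arg η * d : ℝ) : ℂ) * Complex.I) *
      ((μ * gaussianKernel μ (‖η‖ ^ 2 * μ) (j + d) j (n + d) n : ℝ) : ℂ) := by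
    intro n d j
    have h1 := hcoeff n d j
    have h2 := factorial_mul_gaussianKernel hμ0.le (norm_nonneg η) j n d
    have hη : starRingEnd ℂ η = ‖η‖ * Complex.exp (((-Complex.arg η : ℝ) : ℂ) * Complex.I) := by
      conv_lhs => rw [← Complex.norm_mul_exp_arg_mul_I η]
      rw [map_mul, Complex.conj_ofReal, ← Complex.exp_conj, map_mul, Complex.conj_ofReal,
        Complex.conj_I]
      push_cast
      ring_nf
    have hR : ((Real.sqrt (j + d).factorial / Real.sqrt j.factorial : ℝ) : ℂ) ≠ 0 := by
      refine Complex.ofReal_ne_zero.2 (div_ne_zero ?_ ?_) <;>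
        exact (Real.sqrt_pos.2 (by positivity)).ne'
    have h3 := congrArg (fun r : ℝ => (r : ℂ)) h2
    simp only [Complex.ofReal_mul (_ / _) (μ * _), Complex.ofReal_mul (_ ^ d),
      Complex.ofReal_pow] at h3
    apply mul_right_cancel₀ hR
    rw [h1, hη, mul_pow, ← Complex.exp_nat_mul]
    have e4 : ((d : ℕ) : ℂ) * (((-Complex.arg η : ℝ) : ℂ) * Complex.I) =
      ((-Complex.arg η * d : ℝ) : ℂ) * Complex.I := by
      push_cast
      ring
    rw [e4]
    linear_combination (-Complex.exp (((-Complex.arg η * d : ℝ) : ℂ) * Complex.I)) * h3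
  refine ⟨μ, ‖η‖ ^ 2 * μ, -Complex.arg η, hμ0.le, hμ1, by positivity, hlam1, fun j k m n => ?_⟩
  by_cases hjk : j + n = k + m
  · rcases le_total n m with hnm | hnm
    · obtain ⟨d, rfl⟩ := Nat.exists_eq_add_of_le hnm
      obtain rfl : j = k + d := by omega
      refine (hle n d k).trans ?_
      congr 4
      push_cast
      ring
    · obtain ⟨d, rfl⟩ := Nat.exists_eq_add_of_le hnm
      obtain rfl : k = j + d := by omega
      rw [← InnerProductSpace.adjoint_rankOne, hΦ.map_adjoint _ (hX m d),
        ContinuousLinearMap.adjoint_inner_right, ← inner_conj_symm, gaussianKernel_swap]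
      have := congrArg (starRingEnd ℂ) (hle m d j)
      rw [map_mul, Complex.conj_ofReal, ← Complex.exp_conj, map_mul, Complex.conj_ofReal,
        Complex.conj_I] at this
      refine this.trans ?_
      congr 2
      push_cast
      ring
  · rw [hgauge.inner_eq_zero hΦ.toIsQuantumChannel hjk, gaussianKernel_eq_zero hjk]
    simp

end Identification

/-! ### Ky Fan's principle for the channel -/

section Truncation

variable {H : Type*} [NormedAddCommGroup H] [InnerProductSpace ℂ H]

/-- The orthogonal projection onto the span of `|0⟩, …, |M⟩`. -/
noncomputable def truncation (b : HilbertBasis ℕ ℂ H) (M : ℕ) (v : H) : H :=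
  ∑ i : Fin (M + 1), inner ℂ (b i) v • b i

theorem inner_truncation (b : HilbertBasis ℕ ℂ H) {M j : ℕ} (hj : j ≤ M) (v : H) :
    inner ℂ (b j) (truncation b M v) = inner ℂ (b j) v := by
  simp only [truncation, inner_sum, inner_smul_right, orthonormal_iff_ite.1 b.orthonormal]
  rw [Finset.sum_eq_single (⟨j, Nat.lt_succ_iff.2 hj⟩ : Fin (M + 1))]
  · simp
  · intro i _ hi
    rw [if_neg, mul_zero]
    intro h
    exact hi (Fin.ext h.symm)
  · simp

theorem inner_truncation_of_lt (b : HilbertBasis ℕ ℂ H) {M j : ℕ} (hj : M < j) (v : H) :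
    inner ℂ (b j) (truncation b M v) = 0 := by
  simp only [truncation, inner_sum, inner_smul_right, orthonormal_iff_ite.1 b.orthonormal]
  refine Finset.sum_eq_zero fun i _ => ?_
  have := i.2
  rw [if_neg (by omega), mul_zero]

theorem inner_truncation_left (b : HilbertBasis ℕ ℂ H) (M : ℕ) (u v : H) :
    inner ℂ (truncation b M u) v = inner ℂ u (truncation b M v) := by
  simp only [truncation, inner_sum, sum_inner, inner_smul_right, inner_smul_left, inner_conj_symm]
  exact Finset.sum_congr rfl fun i _ => mul_comm _ _

theorem norm_truncation_le (b : HilbertBasis ℕ ℂ H) (M : ℕ) (v : H) : ‖truncation b M v‖ ≤ ‖v‖ := by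
  have h1 : ‖truncation b M v‖ ^ 2 ≤ ‖v‖ ^ 2 := by
    have h2 := (hasSum_norm_inner_sq b (truncation b M v))
    refine hasSum_le_of_sum_le h2 fun s => ?_
    refine le_trans (Finset.sum_le_sum fun i _ => ?_) (sum_norm_inner_sq_le b s v)
    rcases le_or_gt i M with h | h
    · rw [inner_truncation b h]
    · rw [inner_truncation_of_lt b h]
      simp
  exact (pow_le_pow_iff_left₀ (norm_nonneg _) (norm_nonneg _) two_ne_zero).1 h1

theorem tendsto_truncation (b : HilbertBasis ℕ ℂ H) (v : H) :
    Tendsto (fun M => truncation b M v) atTop (𝓝 v) := by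
  have h := ((tendsto_add_atTop_iff_nat 1).2 (b.hasSum_repr v).tendsto_sum_nat)
  refine h.congr fun M => ?_
  rw [truncation, Finset.sum_range]
  simp only [b.repr_apply_apply]

/-- The projection onto the first `q` vectors of an orthonormal sequence, compressed to the span of
`|0⟩, …, |M⟩`, is sub-majorized by the projection onto the first `q` Fock states. -/
theorem isSubmajorized_truncation [CompleteSpace H] (b : HilbertBasis ℕ ℂ H) {M q : ℕ} (hq : q ≤ M)
    {φ : ℕ → H} (hφ : Orthonormal ℂ φ) :
    IsSubmajorized b M (∑ a ∈ Finset.range q, rankOne ℂ (truncation b M (φ a))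
      (truncation b M (φ a)))
      (fun j => if j < q then 1 else 0) where
  isPositive := by
    rw [← ContinuousLinearMap.nonneg_iff_isPositive]
    exact Finset.sum_nonneg fun a _ => (ContinuousLinearMap.nonneg_iff_isPositive _).2
      (InnerProductSpace.isPositive_rankOne_self _)
  apply_of_lt := fun n hn => by
    simp only [sum_apply, InnerProductSpace.rankOne_apply]
    refine Finset.sum_eq_zero fun a _ => ?_
    rw [← inner_conj_symm, inner_truncation_of_lt b hn, map_zero, zero_smul]
  antitone := fun i j hij => by
    dsimp only
    split_ifs with h1 h2 <;> first | omega | norm_num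
  eq_zero_of_lt := fun n hn => if_neg (by omega)
  sum_le := fun x χ h r => by
    have hx : ∀ n, x n = ∑ a ∈ Finset.range q, ‖inner ℂ (φ a) (truncation b M (χ n))‖ ^ 2 := by
      intro n
      rw [← h.inner_eigenvector n, sum_apply, inner_sum, Complex.re_sum]
      refine Finset.sum_congr rfl fun a _ => ?_
      rw [InnerProductSpace.rankOne_apply, inner_smul_right, ← inner_conj_symm (χ n),
        inner_truncation_left, Complex.mul_conj, Complex.ofReal_re, Complex.normSq_eq_norm_sq]
    have hsum : ∑ j ∈ Finset.range r, (if j < q then (1 : ℝ) else 0) = min (r : ℝ) q := by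
      rw [← Finset.sum_filter, Finset.sum_const, nsmul_eq_mul, mul_one, ← Nat.cast_min]
      congr 1
      rw [← Finset.card_range (min r q)]
      congr 1
      ext j
      simp
    rw [hsum]
    refine le_min ?_ ?_
    · calc ∑ n ∈ Finset.range r, x n ≤ ∑ n ∈ Finset.range r, (1 : ℝ) := by
            refine Finset.sum_le_sum fun n _ => ?_
            rw [hx]
            refine (hφ.sum_inner_products_le _).trans ?_
            refine pow_le_one₀ (norm_nonneg _) ((norm_truncation_le b M _).trans ?_)
            exact (h.orthonormal.1 n).le
        _ = r := by simp
    · simp only [hx]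
      rw [Finset.sum_comm]
      calc _ ≤ ∑ a ∈ Finset.range q, (1 : ℝ) := by
            refine Finset.sum_le_sum fun a _ => ?_
            have h1 := h.orthonormal.sum_inner_products_le (truncation b M (φ a))
              (s := Finset.range r)
            have h2 : ‖truncation b M (φ a)‖ ^ 2 ≤ 1 :=
              pow_le_one₀ (norm_nonneg _) ((norm_truncation_le b M _).trans (hφ.1 a).le)
            refine le_trans (le_of_eq ?_) (h1.trans h2)
            refine Finset.sum_congr rfl fun n _ => ?_
            rw [← inner_truncation_left, norm_inner_symm]
        _ = q := by simp

end Truncation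

section ChannelKyFan

variable {H : Type*} [NormedAddCommGroup H] [InnerProductSpace ℂ H] [CompleteSpace H]
  {b : HilbertBasis ℕ ℂ H} {Φ : (H →L[ℂ] H) → (H →L[ℂ] H)}

theorem IsQuantumChannel.map_zero (hΦ : IsQuantumChannel b Φ) : Φ 0 = 0 := by
  have h := hΦ.map_smul 0 _ (isTraceClass_rankOne b 0 0)
  rwa [zero_smul, zero_smul] at h

theorem IsQuantumChannel.map_rankOne_sum_left (hΦ : IsQuantumChannel b Φ) {ι : Type*} (s : Finset ι)
    (c : ι → ℂ) (u : ι → H) (v : H) :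
    Φ (rankOne ℂ (∑ i ∈ s, c i • u i) v) = ∑ i ∈ s, c i • Φ (rankOne ℂ (u i) v) := by
  classical
  induction s using Finset.induction_on with
  | empty => simp [hΦ.map_zero]
  | insert i s hi ih =>
    rw [Finset.sum_insert hi, Finset.sum_insert hi, ← ih,
      ← hΦ.map_smul _ _ (isTraceClass_rankOne b _ _),
      _root_.map_add, add_apply, _root_.map_smul, smul_apply,
        hΦ.map_add _ _ (isTraceClass_smul (isTraceClass_rankOne b _ _) _)
        (isTraceClass_rankOne b _ _)]

theorem IsQuantumChannel.map_rankOne_sum_right (hΦ : IsQuantumChannel b Φ) {ι : Type*}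
    (s : Finset ι)
    (c : ι → ℂ) (u : H) (v : ι → H) :
    Φ (rankOne ℂ u (∑ i ∈ s, c i • v i)) =
      ∑ i ∈ s, starRingEnd ℂ (c i) • Φ (rankOne ℂ u (v i)) := by
  classical
  induction s using Finset.induction_on with
  | empty => simp [hΦ.map_zero]
  | insert i s hi ih =>
    rw [Finset.sum_insert hi, Finset.sum_insert hi, ← ih,
      ← hΦ.map_smul _ _ (isTraceClass_rankOne b _ _),
      _root_.map_add, map_smulₛₗ, hΦ.map_add _ _ (isTraceClass_smul (isTraceClass_rankOne b _ _) _)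
        (isTraceClass_rankOne b _ _)]

theorem IsQuantumChannel.inner_truncation (hΦ : IsQuantumChannel b Φ) (M : ℕ) (φ ψ : H) :
    inner ℂ (truncation b M φ) (Φ (rankOne ℂ (truncation b M ψ) (truncation b M ψ))
      (truncation b M φ)) = ∑ q : Fin (M + 1) × Fin (M + 1), ∑ p : Fin (M + 1) × Fin (M + 1),
        starRingEnd ℂ (inner ℂ (b q.1) φ * starRingEnd ℂ (inner ℂ (b q.2) φ)) *
          (inner ℂ (b p.1) ψ * starRingEnd ℂ (inner ℂ (b p.2) ψ)) *
          inner ℂ (b q.1) (Φ (rankOne ℂ (b p.1) (b p.2)) (b q.2)) := by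
  have hop : Φ (rankOne ℂ (truncation b M ψ) (truncation b M ψ)) =
      ∑ p : Fin (M + 1) × Fin (M + 1), (inner ℂ (b p.1) ψ * starRingEnd ℂ (inner ℂ (b p.2) ψ)) •
        Φ (rankOne ℂ (b p.1) (b p.2)) := by
    rw [Fintype.sum_prod_type]
    unfold truncation
    rw [hΦ.map_rankOne_sum_left]
    refine Finset.sum_congr rfl fun m _ => ?_
    rw [hΦ.map_rankOne_sum_right, Finset.smul_sum]
    exact Finset.sum_congr rfl fun n _ => smul_smul _ _ _
  rw [hop]
  unfold truncation
  rw [sum_inner]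
  conv_rhs => rw [Fintype.sum_prod_type]
  refine Finset.sum_congr rfl fun j _ => ?_
  have hT : ∀ T : H →L[ℂ] H, T (∑ k : Fin (M + 1), inner ℂ (b k) φ • b k) =
      ∑ k : Fin (M + 1), T (inner ℂ (b k) φ • b k) := fun T => map_sum T _ _
  rw [hT, inner_sum]
  refine Finset.sum_congr rfl fun k _ => ?_
  rw [sum_apply, inner_sum]
  refine Finset.sum_congr rfl fun p _ => ?_
  simp only [smul_apply, inner_smul_left, inner_smul_right, _root_.map_smul, map_mul,
    RCLike.conj_conj]
  ring

/-- The kernel of the channel, in terms of two attenuators. -/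
theorem inner_truncation_eq_hsPairing (hΦ : IsQuantumChannel b Φ) {μ lam θ : ℝ}
    (h : ∀ j k m n : ℕ, inner ℂ (b j) (Φ (rankOne ℂ (b m) (b n)) (b k)) =
        Complex.exp (((θ * (m - n) : ℝ) : ℂ) * Complex.I) *
          ((μ * gaussianKernel μ lam j k m n : ℝ) : ℂ)) (M : ℕ) (φ ψ : H) :
    (inner ℂ (truncation b M φ) (Φ (rankOne ℂ (truncation b M ψ) (truncation b M ψ))
      (truncation b M φ))).re = μ * hsPairing
      (kernelAction (attenuatorMatrix M μ) (matrixElements b M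
        (rankOne ℂ (truncation b M φ) (truncation b M φ))))
      (kernelAction (attenuatorMatrix M lam) (matrixElements b M
        (rankOne ℂ (truncation b M (timeEvolution b (-θ) ψ))
          (truncation b M (timeEvolution b (-θ) ψ))))) := by
  have hE : ∀ v : H, ∀ p : Fin (M + 1) × Fin (M + 1), matrixElements b M
      (rankOne ℂ (truncation b M v) (truncation b M v)) p =
      inner ℂ (b p.1) v * starRingEnd ℂ (inner ℂ (b p.2) v) := by
    intro v p
    rw [matrixElements, InnerProductSpace.rankOne_apply, inner_smul_right,
      GaussianChannel.inner_truncation b (Nat.lt_succ_iff.1 p.1.2),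
        ← inner_conj_symm (truncation b M v),
      GaussianChannel.inner_truncation b (Nat.lt_succ_iff.1 p.2.2), mul_comm]
  have hK : ∀ q p : Fin (M + 1) × Fin (M + 1), gaussianKernel μ lam q.1 q.2 p.1 p.2 =
      ∑ r, attenuatorMatrix M μ r q * attenuatorMatrix M lam r p := by
    intro q p
    rw [gaussianKernel_eq_sum μ lam _ _ (Nat.lt_succ_iff.1 p.1.2) (Nat.lt_succ_iff.1 p.2.2),
      Fintype.sum_prod_type, Finset.sum_range]
    simp only [Finset.sum_range, attenuatorMatrix, Matrix.of_apply]
  rw [hΦ.inner_truncation, hsPairing, ← Complex.re_ofReal_mul]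
  congr 1
  simp only [kernelAction, hE, inner_timeEvolution, h, hK, map_sum, Finset.sum_mul_sum]
  simp only [Finset.mul_sum, Complex.ofReal_sum]
  conv_rhs => rw [Finset.sum_comm]
  refine Finset.sum_congr rfl fun q _ => ?_
  conv_rhs => rw [Finset.sum_comm]
  refine Finset.sum_congr rfl fun p _ => Finset.sum_congr rfl fun r _ => ?_
  have hexp : Complex.exp (((θ * ((p.1 : ℕ) - (p.2 : ℕ)) : ℝ) : ℂ) * Complex.I) =
      Complex.exp (((-(-θ * (p.1 : ℕ)) : ℝ) : ℂ) * Complex.I) *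
        starRingEnd ℂ (Complex.exp (((-(-θ * (p.2 : ℕ)) : ℝ) : ℂ) * Complex.I)) := by
    rw [← Complex.exp_conj, map_mul, Complex.conj_ofReal, Complex.conj_I, ← Complex.exp_add]
    congr 1
    push_cast
    ring
  rw [hexp]
  simp only [map_mul, Complex.conj_ofReal, RCLike.conj_conj, Complex.ofReal_mul]
  ring

theorem kernelAction_sum {ι α : Type*} [Fintype ι] (A : Matrix ι ι ℝ) (s : Finset α)
    (y : α → ι → ℂ) (p : ι) :
    kernelAction A (fun p => ∑ i ∈ s, y i p) p = ∑ i ∈ s, kernelAction A (y i) p := by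
  simp only [kernelAction, Finset.mul_sum]
  exact Finset.sum_comm

theorem hsPairing_kernelAction_sum {ι α β : Type*} [Fintype ι] (A B : Matrix ι ι ℝ)
    (s : Finset α) (t : Finset β) (y : α → ι → ℂ) (x : β → ι → ℂ) :
    ∑ i ∈ s, ∑ j ∈ t, hsPairing (kernelAction A (y i)) (kernelAction B (x j)) =
      hsPairing (kernelAction A fun p => ∑ i ∈ s, y i p)
        (kernelAction B fun p => ∑ j ∈ t, x j p) := by
  simp only [hsPairing, kernelAction_sum, map_sum, Finset.sum_mul_sum, Complex.re_sum]
  rw [Finset.sum_comm (s := Finset.univ)]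
  refine Finset.sum_congr rfl fun i _ => ?_
  exact Finset.sum_comm

/-- The inequality `∑ ⟨φ_a|Φ(|ψ_n⟩⟨ψ_n|)|φ_a⟩ ≤ ∑ ⟨a|Φ(|n⟩⟨n|)|a⟩` for vectors projected onto the
span of `|0⟩, …, |M⟩`. -/
theorem sum_inner_truncation_le (hΦ : IsQuantumChannel b Φ) {μ lam θ : ℝ}
    (hμ : 0 ≤ μ) (hμ1 : μ ≤ 1) (hlam : 0 ≤ lam) (hlam1 : lam ≤ 1)
    (h : ∀ j k m n : ℕ, inner ℂ (b j) (Φ (rankOne ℂ (b m) (b n)) (b k)) =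
        Complex.exp (((θ * (m - n) : ℝ) : ℂ) * Complex.I) *
          ((μ * gaussianKernel μ lam j k m n : ℝ) : ℂ))
    {φ ψ : ℕ → H} (hφ : Orthonormal ℂ φ) (hψ : Orthonormal ℂ ψ) {p q M : ℕ} (hp : p ≤ M)
    (hq : q ≤ M) :
    ∑ a ∈ Finset.range q, ∑ n ∈ Finset.range p, (inner ℂ (truncation b M (φ a))
      (Φ (rankOne ℂ (truncation b M (ψ n)) (truncation b M (ψ n))) (truncation b M (φ a)))).re ≤
    ∑ a ∈ Finset.range q, ∑ n ∈ Finset.range p,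
      (inner ℂ (b a) (Φ (rankOne ℂ (b n) (b n)) (b a))).re := by
  have htb : ∀ i, i ≤ M → truncation b M (b i) = b i := by
    intro i hi
    refine eq_of_inner_basis b fun j => ?_
    rcases le_or_gt j M with hj | hj
    · rw [GaussianChannel.inner_truncation b hj]
    · rw [inner_truncation_of_lt b hj, b.orthonormal.2 (by omega)]
  have hrhs : ∑ a ∈ Finset.range q, ∑ n ∈ Finset.range p,
      (inner ℂ (b a) (Φ (rankOne ℂ (b n) (b n)) (b a))).re =
      ∑ a ∈ Finset.range q, ∑ n ∈ Finset.range p, (inner ℂ (truncation b M (b a))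
      (Φ (rankOne ℂ (truncation b M (b n)) (truncation b M (b n))) (truncation b M (b a)))).re := by
    refine Finset.sum_congr rfl fun a ha => Finset.sum_congr rfl fun n hn => ?_
    rw [htb a ((Finset.mem_range.1 ha).le.trans hq), htb n ((Finset.mem_range.1 hn).le.trans hp)]
  have hadd : ∀ (χ : ℕ → H) (r : ℕ), (fun i => ∑ a ∈ Finset.range r, matrixElements b M
      (rankOne ℂ (truncation b M (χ a)) (truncation b M (χ a))) i) = matrixElements b M
      (∑ a ∈ Finset.range r, rankOne ℂ (truncation b M (χ a)) (truncation b M (χ a))) := by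
    intro χ r
    funext i
    simp only [matrixElements, sum_apply, inner_sum]
  have hdiag : ∀ (u : ℕ → ℂ) (r : ℕ), r ≤ M → (∀ n, ‖u n‖ = 1) → matrixElements b M
      (∑ a ∈ Finset.range r, rankOne ℂ (truncation b M (u a • b a)) (truncation b M (u a • b a))) =
      diagonalElements M fun j => if j < r then 1 else 0 := by
    intro u r hr hu
    funext p
    simp only [matrixElements, diagonalElements, sum_apply, inner_sum,
      InnerProductSpace.rankOne_apply, inner_smul_right]
    have hterm : ∀ a ∈ Finset.range r, inner ℂ (truncation b M (u a • b a)) (b p.2) *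
        inner ℂ (b p.1) (truncation b M (u a • b a)) =
        if a = p.1 then (if (p.1 : ℕ) = p.2 then 1 else 0) else 0 := by
      intro a _
      have h1 : (starRingEnd ℂ (u a)) * u a = 1 := by
        rw [RCLike.conj_mul, hu]
        simp
      rw [← inner_conj_symm (truncation b M _), GaussianChannel.inner_truncation b
        (Nat.lt_succ_iff.1 p.2.2), GaussianChannel.inner_truncation b (Nat.lt_succ_iff.1 p.1.2),
        inner_smul_right, inner_smul_right, orthonormal_iff_ite.1 b.orthonormal,
        orthonormal_iff_ite.1 b.orthonormal]
      by_cases h2 : a = p.1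
      · subst h2
        by_cases h3 : (p.1 : ℕ) = p.2
        · simp [← h3, h1]
        · simp [h3, Ne.symm h3]
      · simp [h2, Ne.symm h2]
    rw [Finset.sum_congr rfl hterm, Finset.sum_ite_eq']
    simp only [Finset.mem_range]
    split_ifs <;> simp
  have hU : Orthonormal ℂ fun n => timeEvolution b (-θ) (ψ n) :=
    hψ.comp_linearIsometry (b.repr.trans (HilbertBasis.mk (orthonormal_rotated b (-θ))
      (span_rotated b (-θ))).repr.symm).toLinearIsometry
  rw [hrhs]
  simp only [inner_truncation_eq_hsPairing hΦ h, ← Finset.mul_sum]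
  refine mul_le_mul_of_nonneg_left ?_ hμ
  rw [hsPairing_kernelAction_sum, hsPairing_kernelAction_sum, hadd φ, hadd (fun n => b n),
    hadd (fun n => timeEvolution b (-θ) (ψ n)), hadd (fun n => timeEvolution b (-θ) (b n))]
  simp only [timeEvolution_apply]
  have h1 := hdiag (fun _ => 1) q hq (by simp)
  simp only [one_smul] at h1
  rw [h1, hdiag (fun n => Complex.exp (((-(-θ * n) : ℝ) : ℂ) * Complex.I)) p hp fun n =>
    Complex.norm_exp_ofReal_mul_I _]
  exact (isSubmajorized_truncation b hq hφ).hsPairing_attenuator_le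
    (isSubmajorized_truncation b hp hU) hlam hlam1 hμ hμ1

/-- A channel is continuous from vectors (via rank-one operators) to operators. -/
theorem tendsto_map_rankOne (hΦ : IsQuantumChannel b Φ) {α : Type*} {l : Filter α} {u : α → H}
    {v : H} (hu : Tendsto u l (𝓝 v)) :
    Tendsto (fun i => Φ (rankOne ℂ (u i) (u i))) l (𝓝 (Φ (rankOne ℂ v v))) := by
  obtain ⟨C, hC⟩ := hΦ.continuous
  have hbound : ∀ x y : H, ‖Φ (rankOne ℂ x y)‖ ≤ C * (‖x‖ * ‖y‖) := by
    intro x y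
    have hX := isTraceClass_rankOne b x y
    refine (norm_le_traceNorm (hΦ.mapsTo _ hX)).trans ((hC _ hX).trans ?_)
    rw [traceNorm_rankOne]
  have hsplit : ∀ x y : H, Φ (rankOne ℂ x x) - Φ (rankOne ℂ y y) =
      Φ (rankOne ℂ x (x - y)) + Φ (rankOne ℂ (x - y) y) := by
    intro x y
    have e1 : rankOne ℂ x x = rankOne ℂ x (x - y) + rankOne ℂ x y := by
      rw [← map_add, sub_add_cancel]
    have e2 : rankOne ℂ x y = rankOne ℂ (x - y) y + rankOne ℂ y y := by
      rw [← add_apply, ← map_add, sub_add_cancel]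
    rw [e1, hΦ.map_add _ _ (isTraceClass_rankOne b _ _) (isTraceClass_rankOne b _ _), e2,
      hΦ.map_add _ _ (isTraceClass_rankOne b _ _) (isTraceClass_rankOne b _ _)]
    abel
  rw [tendsto_iff_norm_sub_tendsto_zero]
  have h0 : Tendsto (fun i => ‖u i - v‖) l (𝓝 0) := tendsto_iff_norm_sub_tendsto_zero.1 hu
  have h1 : Tendsto (fun i => C * (‖u i‖ * ‖u i - v‖) + C * (‖u i - v‖ * ‖v‖)) l (𝓝 0) := by
    have := ((hu.norm.mul h0).const_mul C).add ((h0.mul_const ‖v‖).const_mul C)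
    simpa using this
  refine squeeze_zero (fun _ => norm_nonneg _) (fun i => ?_) h1
  rw [hsplit]
  exact (norm_add_le _ _).trans (add_le_add (hbound _ _) (hbound _ _))

/-- Among all pairs of orthonormal families, the Fock states maximize
`∑ ⟨φ_a|Φ(|ψ_n⟩⟨ψ_n|)|φ_a⟩`. -/
theorem IsGaussianChannel.sum_inner_le (hΦ : IsGaussianChannel b Φ) (hgauge : IsGaugeCovariant b Φ)
    {φ ψ : ℕ → H} (hφ : Orthonormal ℂ φ) (hψ : Orthonormal ℂ ψ) (p q : ℕ) :
    ∑ a ∈ Finset.range q, ∑ n ∈ Finset.range p,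
      (inner ℂ (φ a) (Φ (rankOne ℂ (ψ n) (ψ n)) (φ a))).re ≤
    ∑ a ∈ Finset.range q, ∑ n ∈ Finset.range p,
      (inner ℂ (b a) (Φ (rankOne ℂ (b n) (b n)) (b a))).re := by
  obtain ⟨μ, lam, θ, hμ, hμ1, hlam, hlam1, h⟩ := hΦ.exists_gaussianKernel hgauge
  refine le_of_tendsto (tendsto_finsetSum _ fun a _ => tendsto_finsetSum _ fun n _ =>
    (Complex.continuous_re.tendsto _).comp ((tendsto_truncation b (φ a)).inner
      ((isBoundedBilinearMap_apply.continuous.tendsto (_, φ a)).comp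
        ((tendsto_map_rankOne hΦ.toIsQuantumChannel (tendsto_truncation b (ψ n))).prodMk_nhds
          (tendsto_truncation b (φ a)))))) ?_
  filter_upwards [eventually_ge_atTop (max p q)] with M hM
  exact sum_inner_truncation_le hΦ.toIsQuantumChannel hμ hμ1 hlam hlam1 h hφ hψ
    ((le_max_left p q).trans hM) ((le_max_right p q).trans hM)

end ChannelKyFan

/-! ### Rearranging the input -/

section Rearrangement

variable {H : Type*} [NormedAddCommGroup H] [InnerProductSpace ℂ H] [CompleteSpace H]
  {b : HilbertBasis ℕ ℂ H} {Φ : (H →L[ℂ] H) → (H →L[ℂ] H)}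

/-- The image of a diagonalized operator, in terms of the images of its eigenprojections. -/
theorem IsQuantumChannel.tendsto_sum (hΦ : IsQuantumChannel b Φ) {X : H →L[ℂ] H} {x : ℕ → ℝ}
    {ψ : ℕ → H} (h : IsDiagonalizedBy X x ψ) (hx : Summable x) :
    Tendsto (fun p => ∑ n ∈ Finset.range p, (x n : ℂ) • Φ (rankOne ℂ (ψ n) (ψ n))) atTop
      (𝓝 (Φ X)) := by
  obtain ⟨C, hC⟩ := hΦ.continuous
  have htail : ∀ p, IsTraceClass b
      (X - ∑ n ∈ Finset.range p, (x n : ℂ) • rankOne ℂ (ψ n) (ψ n)) := fun p =>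
    (h.tail p).isTraceClass b ((summable_nat_add_iff p).2 hx)
  have hsplit : ∀ p, Φ X = ∑ n ∈ Finset.range p, (x n : ℂ) • Φ (rankOne ℂ (ψ n) (ψ n)) +
      Φ (X - ∑ n ∈ Finset.range p, (x n : ℂ) • rankOne ℂ (ψ n) (ψ n)) := by
    intro p
    induction p with
    | zero => simp
    | succ p ih =>
      have hP := isTraceClass_smul (isTraceClass_rankOne b (ψ p) (ψ p)) (x p : ℂ)
      have e : X - ∑ n ∈ Finset.range p, (x n : ℂ) • rankOne ℂ (ψ n) (ψ n) =
          (x p : ℂ) • rankOne ℂ (ψ p) (ψ p) +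
            (X - ∑ n ∈ Finset.range (p + 1), (x n : ℂ) • rankOne ℂ (ψ n) (ψ n)) := by
        rw [Finset.sum_range_succ]
        abel
      rw [ih, e, hΦ.map_add _ _ hP (htail (p + 1)),
        hΦ.map_smul _ _ (isTraceClass_rankOne b _ _)]
      rw [Finset.sum_range_succ (fun n => (x n : ℂ) • Φ (rankOne ℂ (ψ n) (ψ n))), add_assoc]
  rw [tendsto_iff_norm_sub_tendsto_zero]
  have hlim : Tendsto (fun p => C * ∑' n, x (n + p)) atTop (𝓝 0) := by
    have := (tendsto_sum_nat_add x).const_mul C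
    rwa [mul_zero] at this
  refine squeeze_zero (fun _ => norm_nonneg _) (fun p => ?_) hlim
  have e : ∑ n ∈ Finset.range p, (x n : ℂ) • Φ (rankOne ℂ (ψ n) (ψ n)) - Φ X =
      -Φ (X - ∑ n ∈ Finset.range p, (x n : ℂ) • rankOne ℂ (ψ n) (ψ n)) := by
    rw [hsplit p]
    abel
  rw [e, norm_neg]
  refine (norm_le_traceNorm (hΦ.mapsTo _ (htail p))).trans ((hC _ (htail p)).trans ?_)
  rw [(h.tail p).traceNorm_eq b ((summable_nat_add_iff p).2 hx)]

theorem IsQuantumChannel.tendsto_inner (hΦ : IsQuantumChannel b Φ) {X : H →L[ℂ] H} {x : ℕ → ℝ}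
    {ψ : ℕ → H} (h : IsDiagonalizedBy X x ψ) (hx : Summable x) (u v : H) :
    Tendsto (fun p => ∑ n ∈ Finset.range p, (x n : ℂ) *
      inner ℂ u (Φ (rankOne ℂ (ψ n) (ψ n)) v)) atTop (𝓝 (inner ℂ u (Φ X v))) := by
  have h1 := ((ContinuousLinearMap.apply ℂ H v).continuous.tendsto _).comp (hΦ.tendsto_sum h hx)
  have h2 := (tendsto_const_nhds (x := u)).inner (𝕜 := ℂ) h1
  refine h2.congr fun p => ?_
  simp only [Function.comp_apply, ContinuousLinearMap.apply_apply, sum_apply, inner_sum, smul_apply,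
    inner_smul_right]

theorem IsQuantumChannel.tendsto_sum_inner (hΦ : IsQuantumChannel b Φ) {X : H →L[ℂ] H}
    {x : ℕ → ℝ} {ψ : ℕ → H} (h : IsDiagonalizedBy X x ψ) (hx : Summable x) (φ : ℕ → H) (q : ℕ) :
    Tendsto (fun p => ∑ n ∈ Finset.range p, x n *
      ∑ a ∈ Finset.range q, (inner ℂ (φ a) (Φ (rankOne ℂ (ψ n) (ψ n)) (φ a))).re) atTop
      (𝓝 (∑ a ∈ Finset.range q, (inner ℂ (φ a) (Φ X (φ a))).re)) := by
  have h1 := tendsto_finsetSum (Finset.range q) fun a _ =>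
    (Complex.continuous_re.tendsto _).comp (hΦ.tendsto_inner h hx (φ a) (φ a))
  refine h1.congr fun p => ?_
  simp only [Function.comp_apply, Complex.re_sum, Complex.re_ofReal_mul, Finset.mul_sum]
  exact Finset.sum_comm

/-- Ky Fan sums of the output grow when the input is replaced by its Fock rearrangement. -/
theorem IsGaussianChannel.sum_inner_le_of_isDiagonalizedBy (hΦ : IsGaussianChannel b Φ)
    (hgauge : IsGaugeCovariant b Φ) {X Y : H →L[ℂ] H} {x : ℕ → ℝ} {ψ φ : ℕ → H}
    (hX : IsDiagonalizedBy X x ψ) (hY : IsDiagonalizedBy Y x b) (hx : Summable x)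
    (hφ : Orthonormal ℂ φ) (q : ℕ) :
    ∑ a ∈ Finset.range q, (inner ℂ (φ a) (Φ X (φ a))).re ≤
      ∑ a ∈ Finset.range q, (inner ℂ (b a) (Φ Y (b a))).re := by
  refine le_of_tendsto_of_tendsto' (hΦ.tendsto_sum_inner hX hx φ q)
    (hΦ.tendsto_sum_inner hY hx b q) fun p => ?_
  refine sum_mul_le_sum_mul_of_antitone hX.antitone hX.nonneg (fun r => ?_) p
  rw [Finset.sum_comm, Finset.sum_comm (s := Finset.range r)]
  exact hΦ.sum_inner_le hgauge hφ hX.orthonormal r q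

theorem isDiagonalizedBy_tsum {x : ℕ → ℝ} {ψ : ℕ → H} (hx : Antitone x) (hx0 : ∀ n, 0 ≤ x n)
    (hs : Summable x) (hψ : Orthonormal ℂ ψ) :
    IsDiagonalizedBy (∑' n, (x n : ℂ) • rankOne ℂ (ψ n) (ψ n)) x ψ where
  antitone := hx
  nonneg := hx0
  orthonormal := hψ
  hasSum := fun v => by
    have h : Summable fun n => (x n : ℂ) • rankOne ℂ (ψ n) (ψ n) := by
      refine Summable.of_norm (hs.congr fun n => ?_)
      rw [norm_smul, InnerProductSpace.norm_rankOne, hψ.1 n, Complex.norm_real,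
        Real.norm_of_nonneg (hx0 n), mul_one, mul_one]
    have h2 := h.hasSum.mapL (ContinuousLinearMap.apply ℂ H v)
    simp only [ContinuousLinearMap.apply_apply, smul_apply] at h2
    exact h2

theorem isDiagonalizedBy_fockRearrangement (b : HilbertBasis ℕ ℂ H) {X : H →L[ℂ] H}
    (hX : X.IsPositive) (ht : IsTraceClass b X) :
    IsDiagonalizedBy (fockRearrangement b X) (eigenvalues X) b := by
  obtain ⟨ψ, h⟩ := isDiagonalizedBy_eigenvalues b hX ht
  exact isDiagonalizedBy_tsum h.antitone h.nonneg (h.summable ht) b.orthonormal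

theorem isPassive_of_isDiagonalizedBy {X : H →L[ℂ] H} {x : ℕ → ℝ} (h : IsDiagonalizedBy X x b)
    (ht : IsTraceClass b X) : IsPassive b X := by
  refine ⟨h.isPositive, ht, ?_⟩
  have h' := isDiagonalizedBy_fockRearrangement b h.isPositive ht
  rw [h.eigenvalues_eq] at h'
  ext v
  exact (h.hasSum v).unique (h'.hasSum v)

theorem IsGaussianChannel.isPassivePreserving (hΦ : IsGaussianChannel b Φ)
    (hgauge : IsGaugeCovariant b Φ) : IsPassivePreserving b Φ := by
  rintro X ⟨hX, ht, hpass⟩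
  have hdiag := isDiagonalizedBy_fockRearrangement b hX ht
  rw [← hpass] at hdiag
  have hx := hdiag.summable ht
  have hY := hΦ.isPositive hX ht
  have htY := hΦ.mapsTo X ht
  have hzero : ∀ j k, j ≠ k → inner ℂ (b j) (Φ X (b k)) = 0 := by
    intro j k hjk
    refine tendsto_nhds_unique (hΦ.tendsto_inner hdiag hx (b j) (b k)) ?_
    refine tendsto_const_nhds.congr fun p => (Finset.sum_eq_zero fun n _ => ?_).symm
    rw [hgauge.inner_eq_zero hΦ.toIsQuantumChannel (by omega), mul_zero]
  set y : ℕ → ℝ := fun k => (inner ℂ (b k) (Φ X (b k))).re with hy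
  have hnonneg : ∀ k, 0 ≤ y k := fun k => hY.re_inner_nonneg_right (b k)
  have hb : ∀ k, Φ X (b k) = (y k : ℂ) • b k := by
    intro k
    refine eq_of_inner_basis b fun j => ?_
    rw [inner_smul_right, orthonormal_iff_ite.1 b.orthonormal]
    by_cases h : j = k
    · subst h
      rw [if_pos rfl, mul_one]
      have h1 := (RCLike.nonneg_iff.1 (hY.inner_nonneg_right (b j))).2
      exact Complex.ext (by simp [hy]) (by simpa using h1)
    · rw [if_neg h, mul_zero, hzero j k h]
  -- exchanging `|m⟩` for `|m+1⟩` in the family `|0⟩, …, |m⟩` does not increase the Ky Fan sum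
  have hanti : Antitone y := by
    refine antitone_nat_of_succ_le fun m => ?_
    have h1 := hΦ.sum_inner_le_of_isDiagonalizedBy hgauge hdiag hdiag hx
      (b.orthonormal.comp _ (Equiv.swap m (m + 1)).injective) (m + 1)
    rw [Finset.sum_range_succ, Finset.sum_range_succ _ m] at h1
    have h2 : ∀ a ∈ Finset.range m, (inner ℂ ((b ∘ Equiv.swap m (m + 1)) a)
        (Φ X ((b ∘ Equiv.swap m (m + 1)) a))).re = (inner ℂ (b a) (Φ X (b a))).re := by
      intro a ha
      have := Finset.mem_range.1 ha
      rw [Function.comp_apply, Equiv.swap_apply_of_ne_of_ne (by omega) (by omega)]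
    rw [Finset.sum_congr rfl h2, Function.comp_apply, Equiv.swap_apply_left] at h1
    exact le_of_add_le_add_left h1
  refine isPassive_of_isDiagonalizedBy (x := y) ⟨hanti, hnonneg, b.orthonormal, fun v => ?_⟩ htY
  have h1 := (Φ X).hasSum (b.hasSum_repr v)
  refine h1.congr_fun fun n => ?_
  rw [_root_.map_smul, hb, InnerProductSpace.rankOne_apply, b.repr_apply_apply, smul_smul,
    smul_smul,
    mul_comm]

theorem IsGaussianChannel.isFockOptimal (hΦ : IsGaussianChannel b Φ)
    (hgauge : IsGaugeCovariant b Φ) : IsFockOptimal b Φ := by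
  intro X hX ht n
  obtain ⟨ψ, hψ⟩ := isDiagonalizedBy_eigenvalues b hX ht
  have hx := hψ.summable ht
  have hR := isDiagonalizedBy_fockRearrangement b hX ht
  have htR := hR.isTraceClass b hx
  obtain ⟨φ, hφ⟩ := isDiagonalizedBy_eigenvalues b (hΦ.isPositive hX ht) (hΦ.mapsTo X ht)
  obtain ⟨χ, hχ⟩ := isDiagonalizedBy_eigenvalues b (hΦ.isPositive hR.isPositive htR)
    (hΦ.mapsTo _ htR)
  calc ∑ i ∈ Finset.range (n + 1), eigenvalues (Φ X) i
      = ∑ i ∈ Finset.range (n + 1), (inner ℂ (φ i) (Φ X (φ i))).re :=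
        Finset.sum_congr rfl fun i _ => (hφ.inner_eigenvector i).symm
    _ ≤ ∑ i ∈ Finset.range (n + 1), (inner ℂ (b i) (Φ (fockRearrangement b X) (b i))).re :=
        hΦ.sum_inner_le_of_isDiagonalizedBy hgauge hψ hR hx hφ.orthonormal (n + 1)
    _ ≤ ∑ i ∈ Finset.range (n + 1), eigenvalues (Φ (fockRearrangement b X)) i := by
        have h := hχ.sum_inner_le (b.orthonormal.comp (fun i : Fin (n + 1) => (i : ℕ))
          Fin.val_injective)
        simp only [Function.comp_apply, Fintype.card_fin] at h
        rwa [Finset.sum_range]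

theorem IsGaussianChannel.majorizedBy (hΦ : IsGaussianChannel b Φ)
    (hgauge : IsGaugeCovariant b Φ) {X : H →L[ℂ] H} (hX : X.IsPositive) (ht : IsTraceClass b X) :
    MajorizedBy b (Φ X) (Φ (fockRearrangement b X)) := by
  refine ⟨hΦ.isFockOptimal hgauge X hX ht, ?_⟩
  obtain ⟨ψ, hψ⟩ := isDiagonalizedBy_eigenvalues b hX ht
  have hx := hψ.summable ht
  have hR := isDiagonalizedBy_fockRearrangement b hX ht
  rw [hΦ.map_trace X ht, hΦ.map_trace _ (hR.isTraceClass b hx), hψ.trace_eq b hx, hR.trace_eq b hx]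

end Rearrangement

end GaussianChannel

/-- Every one-mode gauge-covariant Gaussian quantum channel is passive-preserving and
Fock-optimal; since it preserves the trace, weak sub-majorization is even majorization. -/
theorem mainTheorem2 {H : Type*} [NormedAddCommGroup H] [InnerProductSpace ℂ H] [CompleteSpace H]
    (b : HilbertBasis ℕ ℂ H) (Φ : (H →L[ℂ] H) → (H →L[ℂ] H))
    (hΦ : GaussianChannel.IsGaussianChannel b Φ) (hgauge : GaussianChannel.IsGaugeCovariant b Φ) :
    GaussianChannel.IsPassivePreserving b Φ ∧ GaussianChannel.IsFockOptimal b Φ ∧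
      ∀ X : H →L[ℂ] H, X.IsPositive → GaussianChannel.IsTraceClass b X →
        GaussianChannel.MajorizedBy b (Φ X) (Φ (GaussianChannel.fockRearrangement b X)) := by
  exact ⟨hΦ.isPassivePreserving hgauge, hΦ.isFockOptimal hgauge,
    fun X hX ht => hΦ.majorizedBy hgauge hX ht⟩
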